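/- Let $m\ge 2$, $1\le n\le m$, $p\ge 1$ be integers, let $\alpha_1,\dots,\alpha_n$ be real with $0<2\alpha_j<1$, and let each of $\lambda_1,\dots,\lambda_p$ be real or purely imaginary. On $R_m^{n+}=\{x\in\mathbb R^m: x_1>0,\dots,x_n>0\}$ consider $$Lu:=\sum_{i=1}^m u_{x_ix_i}+\sum_{j=1}^n\frac{2\alpha_j}{x_j}u_{x_j}-\sum_{l=1}^p\lambda_l^2\,u=0. \qquad (1)$$ For an integer $l\ge 0$ put $(\kappa)_l=\kappa(\kappa+1)\cdots(\kappa+l-1)$ and, for an integer $l<0$, $(\kappa)_l=\Gamma(\kappa+l)/\Gamma(\kappa)$. The confluent hypergeometric function is $$\mathrm H_A^{(n,p)}\!\left[\begin{matrix}a,b_1,\dots,b_n;\\ c_1,\dots,c_n;\end{matrix}\ \xi,\eta\right]=\sum_{m_1,\dots,m_{n+p}\ge 0}\frac{(a)_{m_1+\dots+m_n-m_{n+1}-\dots-m_{n+p}}\,(b_1)_{m_1}\cdots(b_n)_{m_n}}{m_1!\cdots m_{n+p}!\,(c_1)_{m_1}\cdots(c_n)_{m_n}}\,\xi_1^{m_1}\cdots\xi_n^{m_n}\eta_1^{m_{n+1}}\cdots\eta_p^{m_{n+p}}$$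 for $|\xi_1|+\dots+|\xi_n|<1$, and for other $\xi$ it is the analytic continuation along the segment from $0$ to $\xi$: its value at $(\xi,\eta)$ is $f(1)$, where $f$ is holomorphic in a neighbourhood of $[0,1]\subset\mathbb C$ and $f(z)$ is the sum of the series at $(z\xi,\eta)$ for small $z$. Fix $x_0=(x_{01},\dots,x_{0m})\in R_m^{n+}$ and for $x\in R_m^{n+}$, $x\ne x_0$, put $$r^2=\sum_{i=1}^m(x_i-x_{0i})^2,\quad r_j^2=(x_j+x_{0j})^2+\sum_{i\ne j}(x_i-x_{0i})^2,\quad \xi_j=\frac{r^2-r_j^2}{r^2}\ (1\le j\le n),\quad \eta_l=-\tfrac14\lambda_l^2r^2\ (1\le l\le p).$$ For $0\le k\le n$ let $$\tilde\alpha_k=\frac m2+k-1-\sum_{i=1}^k\alpha_i+\sum_{i=k+1}^n\alpha_i,\qquad \gamma_k=2^{2\tilde\alpha_k-m}\,\frac{\Gamma(\tilde\alpha_k)}{\pi^{m/2}}\prod_{j=1}^k\frac{\Gamma(1-\alpha_j)}{\Gamma(2-2\alpha_j)}\prod_{i=k+1}^n\frac{\Gamma(\alpha_i)}{\Gamma(2\alpha_i)},$$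 $$q_k(x,x_0)=\gamma_k\prod_{i=1}^k(x_ix_{0i})^{1-2\alpha_i}\;r^{-2\tilde\alpha_k}\;\mathrm H_A^{(n,p)}\!\left[\begin{matrix}\tilde\alpha_k,1-\alpha_1,\dots,1-\alpha_k,\alpha_{k+1},\dots,\alpha_n;\\ 2-2\alpha_1,\dots,2-2\alpha_k,2\alpha_{k+1},\dots,2\alpha_n;\end{matrix}\ \xi,\eta\right].$$ Let $0\le k\le n$ be such that $\tilde\alpha_k$ is not a positive integer (so that all the coefficients of the series exist). Then $q_k(\cdot,x_0)$ is a fundamental solution of (1) with pole $x_0$. Precisely: 1. The continuation that defines $\mathrm H_A^{(n,p)}$ in $q_k(x,x_0)$ exists for every $x\in R_m^{n+}\setminus\{x_0\}$; where $|\xi_1|+\dots+|\xi_n|<1$, the series converges absolutely and $q_k$ is given by its sum. 2. $q_k(\cdot,x_0)$ is real-analytic on $R_m^{n+}\setminus\{x_0\}$ and satisfies (1) there. 3. $q_k(\cdot,x_0)$ is locally integrable on $R_m^{n+}$ and $L\,q_k(\cdot,x_0)=-\big(\prod_{j=1}^n x_{0j}^{-2\alpha_j}\big)\,\delta_{x_0}$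 in the sense of distributions on $R_m^{n+}$: for every complex-valued $\varphi\in C_c^\infty(R_m^{n+})$, $$\int_{R_m^{n+}} q_k(x,x_0)\Big(\sum_{i=1}^m\varphi_{x_ix_i}-\sum_{j=1}^n\Big(\frac{2\alpha_j}{x_j}\varphi\Big)_{x_j}-\sum_{l=1}^p\lambda_l^2\varphi\Big)\,dx=-\prod_{j=1}^n x_{0j}^{-2\alpha_j}\,\varphi(x_0).$$ 4. As $x\to x_0$: if $m>2$, then $r^{m-2}q_k(x,x_0)\to\dfrac{\Gamma(\frac m2-1)}{4\pi^{m/2}}\prod_{j=1}^n x_{0j}^{-2\alpha_j}$; if $m=2$, then $\dfrac{q_k(x,x_0)}{\log(1/r)}\to\dfrac1{2\pi}\prod_{j=1}^n x_{0j}^{-2\alpha_j}$. -/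

import Mathlib

open Set Filter Topology MeasureTheory

noncomputable section

/-! ### The confluent hypergeometric function of `n + p` variables -/

/-- The Pochhammer symbol `(κ)_ν` with an integer index: `κ (κ + 1) ⋯ (κ + ν - 1)` if `ν ≥ 0`, and
the quotient `Γ(κ + ν) / Γ(κ)` if `ν < 0` (the quotient exists when `κ` is not an integer). -/
def poch (κ : ℂ) : ℤ → ℂ
  | Int.ofNat l => (ascPochhammer ℂ l).eval κ
  | Int.negSucc l => Complex.Gamma (κ + ((Int.negSucc l : ℤ) : ℂ)) / Complex.Gamma κ

/-- The term of index `(m₁, …, mₙ), (mₙ₊₁, …, mₙ₊ₚ)` of the series of the confluent hypergeometric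
function. -/
def HATerm {n p : ℕ} (a : ℂ) (b c : Fin n → ℂ) (ξ : Fin n → ℂ) (η : Fin p → ℂ)
    (μ : (Fin n → ℕ) × (Fin p → ℕ)) : ℂ :=
  poch a ((∑ i, (μ.1 i : ℤ)) - ∑ j, (μ.2 j : ℤ)) * (∏ i, poch (b i) (μ.1 i)) /
      ((∏ i, ((μ.1 i).factorial : ℂ)) * (∏ j, ((μ.2 j).factorial : ℂ)) * ∏ i, poch (c i) (μ.1 i)) *
    (∏ i, ξ i ^ μ.1 i) * ∏ j, η j ^ μ.2 j

/-- The sum of the series, which is used where `|ξ₁| + ⋯ + |ξₙ| < 1`. -/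
def HASeries {n p : ℕ} (a : ℂ) (b c : Fin n → ℂ) (ξ : Fin n → ℂ) (η : Fin p → ℂ) : ℂ :=
  ∑' μ : (Fin n → ℕ) × (Fin p → ℕ), HATerm a b c ξ η μ

/-- The segment `[0, 1]` in the complex plane. -/
def unitSegment : Set ℂ := (fun t : ℝ => (t : ℂ)) '' Icc (0 : ℝ) 1

/-- `f` is holomorphic in a neighbourhood of `[0, 1]` and continues the germ at `z = 0` of
`z ↦ H_A(a, b; c; z ξ, η)` along that segment. -/
def IsHAContinuation {n p : ℕ} (a : ℂ) (b c : Fin n → ℂ) (ξ : Fin n → ℂ) (η : Fin p → ℂ)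
    (f : ℂ → ℂ) : Prop :=
  AnalyticOnNhd ℂ f unitSegment ∧
    ∀ᶠ z in 𝓝 (0 : ℂ), f z = HASeries a b c (fun i => z * ξ i) η

open Classical in
/-- The confluent hypergeometric function `H_A^{(n,p)}(a, b; c; ξ, η)`: the sum of its series,
analytically continued in `ξ` along the segment from `0` to `ξ`. -/
def HA {n p : ℕ} (a : ℂ) (b c : Fin n → ℂ) (ξ : Fin n → ℂ) (η : Fin p → ℂ) : ℂ :=
  if h : ∃ f, IsHAContinuation a b c ξ η f then h.choose 1 else 0

/-- The value of the continuation does not depend on the choice made in `HA`. -/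
theorem HA_eq_of_isHAContinuation {n p : ℕ} {a : ℂ} {b c : Fin n → ℂ} {ξ : Fin n → ℂ}
    {η : Fin p → ℂ} {f : ℂ → ℂ} (hf : IsHAContinuation a b c ξ η f) : HA a b c ξ η = f 1 := by
  have h : ∃ f, IsHAContinuation a b c ξ η f := ⟨f, hf⟩
  have hg := h.choose_spec
  have hc : IsPreconnected unitSegment :=
    isPreconnected_Icc.image _ Complex.continuous_ofReal.continuousOn
  have h0 : (0 : ℂ) ∈ unitSegment := ⟨0, by simp, by simp⟩
  have h1 : (1 : ℂ) ∈ unitSegment := ⟨1, by simp, by simp⟩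
  have he : h.choose =ᶠ[𝓝 0] f := by
    filter_upwards [hg.2, hf.2] with z hz hz'
    rw [hz, hz']
  have := hg.1.eqOn_of_preconnected_of_eventuallyEq hf.1 hc h0 he h1
  rw [HA, dif_pos h]
  exact this

/-! ### The equation -/

/-- The partial derivative `∂f / ∂xᵢ`. -/
def pd {m : ℕ} (i : Fin m) (f : EuclideanSpace ℝ (Fin m) → ℂ) (x : EuclideanSpace ℝ (Fin m)) : ℂ :=
  fderiv ℝ f x (EuclideanSpace.single i 1)

/-- The domain `x₁ > 0, …, xₙ > 0` in `ℝᵐ`. -/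
def posDomain {n m : ℕ} (hnm : n ≤ m) : Set (EuclideanSpace ℝ (Fin m)) :=
  {x | ∀ j : Fin n, 0 < x (Fin.castLE hnm j)}

/-- The left-hand side `∑ᵢ u_{xᵢxᵢ} + ∑ⱼ (2αⱼ / xⱼ) u_{xⱼ} - ∑ₖ λₖ² u` of the equation. -/
def helmholtzOp {n m p : ℕ} (hnm : n ≤ m) (α : Fin n → ℝ) (lam : Fin p → ℂ)
    (u : EuclideanSpace ℝ (Fin m) → ℂ) (x : EuclideanSpace ℝ (Fin m)) : ℂ :=
  (∑ i, pd i (pd i u) x) +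
    (∑ j, ((2 * α j / x (Fin.castLE hnm j) : ℝ) : ℂ) * pd (Fin.castLE hnm j) u x) -
    (∑ k, lam k ^ 2) * u x

/-- The formal adjoint `∑ᵢ φ_{xᵢxᵢ} - ∑ⱼ (2αⱼ φ / xⱼ)_{xⱼ} - ∑ₖ λₖ² φ`. -/
def helmholtzAdjoint {n m p : ℕ} (hnm : n ≤ m) (α : Fin n → ℝ) (lam : Fin p → ℂ)
    (φ : EuclideanSpace ℝ (Fin m) → ℂ) (x : EuclideanSpace ℝ (Fin m)) : ℂ :=
  (∑ i, pd i (pd i φ) x) -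
    (∑ j, pd (Fin.castLE hnm j)
      (fun y => ((2 * α j / y (Fin.castLE hnm j) : ℝ) : ℂ) * φ y) x) -
    (∑ k, lam k ^ 2) * φ x

/-- `u` is a fundamental solution with pole `x₀`: in the sense of distributions on the domain,
`x₁^{2α₁} ⋯ xₙ^{2αₙ} L u = -δ_{x₀}`, that is, `L u = -(x₀₁^{-2α₁} ⋯ x₀ₙ^{-2αₙ}) δ_{x₀}`, where `L u`
is the left-hand side of the equation. -/
def IsFundamentalSolution {n m p : ℕ} (hnm : n ≤ m) (α : Fin n → ℝ) (lam : Fin p → ℂ)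
    (x₀ : EuclideanSpace ℝ (Fin m)) (u : EuclideanSpace ℝ (Fin m) → ℂ) : Prop :=
  LocallyIntegrableOn u (posDomain hnm) volume ∧
    ∀ φ : EuclideanSpace ℝ (Fin m) → ℂ, ContDiff ℝ (⊤ : ℕ∞) φ → HasCompactSupport φ →
      tsupport φ ⊆ posDomain hnm →
        ∫ x, u x * helmholtzAdjoint hnm α lam φ x =
          -((∏ j, x₀ (Fin.castLE hnm j) ^ (-2 * α j) : ℝ) : ℂ) * φ x₀

/-! ### The functions `q₀, …, qₙ`

The index `i : Fin n` stands for the number `i + 1` in `{1, …, n}`, so that `i < k` in the code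
means that this number is at most `k`. -/

/-- `r² = ∑ᵢ (xᵢ - x₀ᵢ)²`. -/
def rSq {m : ℕ} (x₀ x : EuclideanSpace ℝ (Fin m)) : ℝ := ∑ i, (x i - x₀ i) ^ 2

/-- `rⱼ² = (xⱼ + x₀ⱼ)² + ∑_{i ≠ j} (xᵢ - x₀ᵢ)²`. -/
def rjSq {n m : ℕ} (hnm : n ≤ m) (x₀ x : EuclideanSpace ℝ (Fin m)) (j : Fin n) : ℝ :=
  (x (Fin.castLE hnm j) + x₀ (Fin.castLE hnm j)) ^ 2 +
    ∑ i ∈ Finset.univ.erase (Fin.castLE hnm j), (x i - x₀ i) ^ 2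

/-- `ξⱼ = (r² - rⱼ²) / r²`. -/
def xiVar {n m : ℕ} (hnm : n ≤ m) (x₀ x : EuclideanSpace ℝ (Fin m)) (j : Fin n) : ℝ :=
  (rSq x₀ x - rjSq hnm x₀ x j) / rSq x₀ x

/-- `ηₖ = -λₖ² r² / 4`. -/
def etaVar {m p : ℕ} (lam : Fin p → ℂ) (x₀ x : EuclideanSpace ℝ (Fin m)) (k : Fin p) : ℂ :=
  -(1 / 4) * lam k ^ 2 * (rSq x₀ x : ℂ)

/-- `α̃ₖ = m/2 + k - 1 - ∑_{i ≤ k} αᵢ + ∑_{i > k} αᵢ`. -/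
def alphaTilde {n : ℕ} (m k : ℕ) (α : Fin n → ℝ) : ℝ :=
  (m : ℝ) / 2 + k - 1 - (∑ i : Fin n with i.val < k, α i) + ∑ i : Fin n with ¬ i.val < k, α i

/-- `γₖ = 2^{2α̃ₖ - m} Γ(α̃ₖ) π^{-m/2} ∏_{j ≤ k} Γ(1 - αⱼ)/Γ(2 - 2αⱼ) ∏_{i > k} Γ(αᵢ)/Γ(2αᵢ)`. -/
def gammaCoeff {n : ℕ} (m k : ℕ) (α : Fin n → ℝ) : ℝ :=
  (2 : ℝ) ^ (2 * alphaTilde m k α - m) * (Real.Gamma (alphaTilde m k α) / Real.pi ^ ((m : ℝ) / 2)) *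
    (∏ j : Fin n with j.val < k, Real.Gamma (1 - α j) / Real.Gamma (2 - 2 * α j)) *
    ∏ i : Fin n with ¬ i.val < k, Real.Gamma (α i) / Real.Gamma (2 * α i)

/-- The numerator parameters `1 - α₁, …, 1 - αₖ, αₖ₊₁, …, αₙ`. -/
def bParam {n : ℕ} (k : ℕ) (α : Fin n → ℝ) (i : Fin n) : ℂ :=
  if (i : ℕ) < k then ((1 - α i : ℝ) : ℂ) else ((α i : ℝ) : ℂ)

/-- The denominator parameters `2 - 2α₁, …, 2 - 2αₖ, 2αₖ₊₁, …, 2αₙ`. -/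
def cParam {n : ℕ} (k : ℕ) (α : Fin n → ℝ) (i : Fin n) : ℂ :=
  if (i : ℕ) < k then ((2 - 2 * α i : ℝ) : ℂ) else ((2 * α i : ℝ) : ℂ)

/-- The factor `γₖ ∏_{i ≤ k} (xᵢ x₀ᵢ)^{1 - 2αᵢ} r^{-2α̃ₖ}`. -/
def qFactor {n m : ℕ} (hnm : n ≤ m) (k : ℕ) (α : Fin n → ℝ)
    (x₀ x : EuclideanSpace ℝ (Fin m)) : ℝ :=
  gammaCoeff m k α *
    (∏ i : Fin n with i.val < k, (x (Fin.castLE hnm i) * x₀ (Fin.castLE hnm i)) ^ (1 - 2 * α i)) *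
    √(rSq x₀ x) ^ (-2 * alphaTilde m k α)

/-- `qₖ(x, x₀)`. -/
def qFun {n m p : ℕ} (hnm : n ≤ m) (k : ℕ) (α : Fin n → ℝ) (lam : Fin p → ℂ)
    (x₀ x : EuclideanSpace ℝ (Fin m)) : ℂ :=
  (qFactor hnm k α x₀ x : ℂ) *
    HA (alphaTilde m k α : ℂ) (bParam k α) (cParam k α) (fun j => (xiVar hnm x₀ x j : ℂ))
      (etaVar lam x₀ x)

end

open ProbabilityTheory (betaMeasure beta)

noncomputable section

/-! ### Pochhammer symbols -/

/-! Write bⱼ = 1 - αⱼ for j ≤ k and bⱼ = αⱼ for j > k, eⱼ = bⱼ - αⱼ, B = ∑ bⱼ, a = α̃ₖ = m/2 - 1 + B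
and κ = -¼ ∑ λₗ². The denominator parameters are 2bⱼ, and (b)_l / (2b)_l is the l-th moment of the
symmetric beta law with parameter b. Hence the series is the average, over t in the unit cube, of a
series in the two sums ∑ tⱼ ξⱼ and ∑ ηₗ only, and the binomial theorem sums the latter
(`hasSum_HATerm`). Up to a constant, qₖ becomes ∏ xⱼ^{eⱼ} times the average of F_a(ρ), where F_c(z)
= z^{-c} ∑ Γ(c - N) (κ z)ᴺ / N! is `radialSol` and ρ = r² + 4 ∑ tⱼ xⱼ x₀ⱼ (`qFun_eq`). All ξⱼ are ≤
0 in the domain, so 1 - z ∑ tⱼ ξⱼ stays in the right half-plane along [0, 1]. This gives the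
continuation and, with x as the parameter, real-analyticity.

The functions F_c satisfy F_c' = -F_{c+1} and z F_{c+2} = (c + 1) F_{c+1} - κ F_c. Applied to F_a(ρ
+ ε), the operator with parameters bⱼ gives -4ε F_{a+2}(ρ + ε) plus terms that are divergences in t
with respect to the beta weights and therefore average to zero (`helmholtzOp_rhoIntegral`). The
factor ∏ xⱼ^{eⱼ} converts the parameters αⱼ into bⱼ, because eⱼ is a root of e (e - 1 + 2αⱼ) = 0.
With ε = 0 this is the equation off the pole.

With ε > 0 there is no singularity, and integration by parts against a test function is exact. What
remains is the limit of ε times the average of F_{a+2}(ρ + ε). Its size is read off from the Laplace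
transform of the beta law, for which w^b E[e^{-wt}] → Γ(2b)/Γ(b): averaging (R + ∑ tⱼ wⱼ)^{-c} gains
the power R^B (`tendsto_rpow_mul_betaPower`). So the kernel behaves like ε (r² + ε)^{-(m/2+1)}, an
approximate identity at scale √ε (`tendsto_integral_betaPower_mul`), and γₖ is the constant that
gives it the right mass (`qConst_mul_eq`). The same averages with c = a give the power law near the
pole for m > 2 and, since then c = B, the logarithm for m = 2 (`tendsto_betaPower_div_log`). -/

theorem poch_eq_Gamma_div {a : ℂ} (ha : a ∈ Complex.integerComplement) (l : ℤ) :
    poch a l = Complex.Gamma (a + l) / Complex.Gamma a := by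
  cases l with
  | ofNat l =>
    have := Complex.Gamma_add_nat_div_Gamma_eq (n := l) a fun k hk =>
      Complex.integerComplement_add_ne_zero ha k (by rw [hk]; simp)
    simpa [poch] using this.symm
  | negSucc l => rfl

theorem poch_natCast (b : ℂ) (l : ℕ) : poch b (l : ℤ) = (ascPochhammer ℂ l).eval b := rfl

theorem sub_natCast_mem_integerComplement {b : ℂ} (hb : b ∈ Complex.integerComplement) (N : ℕ) :
    b - N ∈ Complex.integerComplement := by
  have := (Complex.add_intCast_mem_integerComplement (x := b) (-(N : ℤ))).2 hb
  simpa [sub_eq_add_neg] using this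

theorem Gamma_ne_zero_of_mem_integerComplement {b : ℂ} (hb : b ∈ Complex.integerComplement) :
    Complex.Gamma b ≠ 0 :=
  Complex.Gamma_ne_zero fun k hk =>
    Complex.integerComplement_add_ne_zero hb k (by rw [hk]; simp)

theorem norm_ascPochhammer_eval_le (c : ℂ) (M : ℕ) {A : ℝ} (hA : ‖c‖ ≤ A) :
    ‖(ascPochhammer ℂ M).eval c‖ ≤ (ascPochhammer ℝ M).eval A := by
  have hA0 : 0 ≤ A := (norm_nonneg c).trans hA
  induction M with
  | zero => simp
  | succ M ih =>
    rw [ascPochhammer_succ_eval, ascPochhammer_succ_eval, norm_mul]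
    have h : ‖c + M‖ ≤ A + M := (norm_add_le _ _).trans (by simpa using hA)
    exact mul_le_mul ih h (norm_nonneg _) ((norm_nonneg _).trans ih)

theorem hasSum_ascPochhammer_mul_pow (c : ℂ) {s : ℂ} (hs : ‖s‖ < 1) :
    HasSum (fun M : ℕ => (ascPochhammer ℂ M).eval c * s ^ M / M.factorial) ((1 - s) ^ (-c)) := by
  have h := (Complex.one_div_one_sub_cpow_hasFPowerSeriesOnBall_zero c).hasSum (y := s)
    (by simpa [Metric.mem_eball, edist_zero_right, enorm_eq_nnnorm,
      ← NNReal.coe_lt_one] using hs)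
  simp only [zero_add, FormalMultilinearSeries.ofScalars_apply_eq, smul_eq_mul, one_div] at h
  rw [Complex.cpow_neg]
  refine h.congr_fun ?_
  intro M
  have := Ring.factorial_nsmul_multichoose_eq_ascPochhammer c M
  rw [Polynomial.ascPochhammer_smeval_eq_eval, nsmul_eq_mul, Ring.multichoose_eq] at this
  rw [← this]
  have hM : (M.factorial : ℂ) ≠ 0 := Nat.cast_ne_zero.2 M.factorial_ne_zero
  field_simp

theorem hasSum_ascPochhammer_mul_pow_real (c : ℝ) {s : ℝ} (hs0 : 0 ≤ s) (hs : s < 1) :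
    HasSum (fun M : ℕ => (ascPochhammer ℝ M).eval c * s ^ M / M.factorial) ((1 - s) ^ (-c)) := by
  have h := hasSum_ascPochhammer_mul_pow c (s := (s : ℂ)) (by simpa [abs_of_nonneg hs0] using hs)
  rw [← Complex.hasSum_ofReal]
  have e : (((1 - s) ^ (-c) : ℝ) : ℂ) = (1 - (s : ℂ)) ^ (-(c : ℂ)) := by
    rw [Complex.ofReal_cpow (by linarith)]; push_cast; rfl
  rw [e]
  refine h.congr_fun fun M => ?_
  push_cast
  congr 2
  have := Polynomial.eval₂_at_apply (p := ascPochhammer ℝ M) Complex.ofRealHom c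
  rw [Polynomial.eval₂_eq_eval_map, ascPochhammer_map] at this
  simpa using this.symm

/-- The values of the Gamma function at `b, b - 1, b - 2, …` grow at most geometrically. -/
theorem exists_norm_Gamma_sub_le {b : ℂ} (hb : b ∈ Complex.integerComplement) :
    ∃ C D : ℝ, 0 < C ∧ 0 < D ∧ ∀ N : ℕ, ‖Complex.Gamma (b - N)‖ ≤ C * D ^ N := by
  -- The integers form a closed set that misses b, so all b - k stay at distance at least d from 0.
  -- Each use of Γ(z + 1) = z Γ(z) going down then costs at most a factor 1/d.
  obtain ⟨d, hd, hdb⟩ : ∃ d > 0, ∀ k : ℤ, d ≤ ‖b - k‖ := by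
    have h1 := (Complex.isClosed_range_intCast.notMem_iff_infDist_pos (range_nonempty _)).1 hb
    exact ⟨_, h1, fun k => by
      rw [← dist_eq_norm]; exact Metric.infDist_le_dist_of_mem ⟨k, rfl⟩⟩
  have hG := Gamma_ne_zero_of_mem_integerComplement hb
  refine ⟨‖Complex.Gamma b‖, d⁻¹, norm_pos_iff.2 hG, inv_pos.2 hd, fun N => ?_⟩
  induction N with
  | zero => simp
  | succ N ih =>
    have h0 : b - (N + 1 : ℕ) ≠ 0 := 
      Complex.integerComplement.ne_zero (sub_natCast_mem_integerComplement hb (N + 1))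
    have h1 := Complex.Gamma_add_one _ h0
    rw [show b - (N + 1 : ℕ) + 1 = b - N by push_cast; ring] at h1
    have h2 := hdb (N + 1 : ℕ)
    rw [h1, norm_mul] at ih
    have h3 : d * ‖Complex.Gamma (b - (N + 1 : ℕ))‖ ≤ ‖Complex.Gamma b‖ * d⁻¹ ^ N :=
      le_trans (mul_le_mul_of_nonneg_right (by simpa using h2) (norm_nonneg _)) ih
    rw [pow_succ, ← mul_assoc, ← div_eq_mul_inv, le_div_iff₀ hd]
    linarith

/-! ### The entire function `∑ Γ(b - N) wᴺ / N!` -/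

/-- The entire function `w ↦ ∑ Γ(b - N) wᴺ / N!`. -/
def gammaSeries (b w : ℂ) : ℂ := ∑' N : ℕ, Complex.Gamma (b - N) / N.factorial * w ^ N

theorem summable_norm_gammaSeries {b : ℂ} (hb : b ∈ Complex.integerComplement) {R : ℝ}
    (hR : 0 ≤ R) :
    Summable fun N : ℕ => ‖Complex.Gamma (b - N) / N.factorial‖ * R ^ N := by
  obtain ⟨C, D, hC, hD, h⟩ := exists_norm_Gamma_sub_le hb
  refine Summable.of_nonneg_of_le (fun N => by positivity) (fun N => ?_)
    ((Real.summable_pow_div_factorial (D * R)).mul_left C)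
  rw [norm_div, Complex.norm_natCast, mul_pow]
  calc _ ≤ C * D ^ N / N.factorial * R ^ N := by gcongr; exact h N
    _ = _ := by ring

theorem hasSum_gammaSeries {b : ℂ} (hb : b ∈ Complex.integerComplement) (w : ℂ) :
    HasSum (fun N : ℕ => Complex.Gamma (b - N) / N.factorial * w ^ N) (gammaSeries b w) := by
  refine Summable.hasSum (Summable.of_norm ?_)
  simpa [norm_mul, norm_pow] using summable_norm_gammaSeries hb (norm_nonneg w)

theorem gammaSeries_zero {b : ℂ} (hb : b ∈ Complex.integerComplement) :
    gammaSeries b 0 = Complex.Gamma b := by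
  rw [← (hasSum_gammaSeries hb 0).tsum_eq, tsum_eq_single 0]
  · simp
  · intro N hN; simp [hN]

/-- Coefficientwise this is Γ(b + 1 - N) = (b - N) Γ(b - N). The factor N cancels against N!, which
shifts the index and lowers b by one. -/
theorem gammaSeries_add_one {b : ℂ} (hb : b ∈ Complex.integerComplement) (w : ℂ) :
    gammaSeries (b + 1) w = b * gammaSeries b w - w * gammaSeries (b - 1) w := by
  have hb1 : b - 1 ∈ Complex.integerComplement := by
    simpa using sub_natCast_mem_integerComplement hb 1
  have hb2 : b + 1 ∈ Complex.integerComplement := by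
    simpa using (Complex.add_intCast_mem_integerComplement (x := b) 1).2 hb
  have h1 := hasSum_gammaSeries hb2 w
  have h2 := (hasSum_gammaSeries hb w).mul_left b
  have h3 := (hasSum_gammaSeries hb1 w).mul_left w
  have h4 : HasSum (fun N : ℕ => (N : ℂ) * (Complex.Gamma (b - N) / N.factorial) * w ^ N)
      (w * gammaSeries (b - 1) w) := by
    rw [← hasSum_nat_add_iff' 1]
    simp only [Finset.range_one, Finset.sum_singleton, Nat.cast_zero, zero_mul, sub_zero]
    refine h3.congr_fun fun N => ?_
    have hN : (N.factorial : ℂ) ≠ 0 := Nat.cast_ne_zero.2 N.factorial_ne_zero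
    have hN' : (N : ℂ) + 1 ≠ 0 := by exact_mod_cast N.succ_ne_zero
    rw [Nat.factorial_succ, show b - (N + 1 : ℕ) = b - 1 - N by push_cast; ring]
    push_cast
    field_simp
    ring
  refine h1.unique ((h2.sub h4).congr_fun fun N => ?_)
  have h0 : b - N ≠ 0 := 
    Complex.integerComplement.ne_zero (sub_natCast_mem_integerComplement hb N)
  rw [show b + 1 - N = b - N + 1 by ring, Complex.Gamma_add_one _ h0]
  ring

/-- Termwise differentiation: the factor N + 1 cancels against (N + 1)!, and Γ(b - (N + 1)) is Γ((b
- 1) - N). -/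
theorem hasDerivAt_gammaSeries {b : ℂ} (hb : b ∈ Complex.integerComplement) (w : ℂ) :
    HasDerivAt (gammaSeries b) (gammaSeries (b - 1) w) w := by
  have hb1 : b - 1 ∈ Complex.integerComplement := by
    simpa using sub_natCast_mem_integerComplement hb 1
  set c : ℕ → ℂ := fun N => Complex.Gamma (b - N) / N.factorial with hc
  have hstep : ∀ N : ℕ, c (N + 1) * ((N + 1 : ℕ) : ℂ) =
      Complex.Gamma (b - 1 - N) / N.factorial := fun N => by
    have hN : (N.factorial : ℂ) ≠ 0 := Nat.cast_ne_zero.2 N.factorial_ne_zero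
    have hN' : (N : ℂ) + 1 ≠ 0 := by exact_mod_cast N.succ_ne_zero
    simp only [hc]
    rw [Nat.factorial_succ, show b - (N + 1 : ℕ) = b - 1 - N by push_cast; ring]
    push_cast
    field_simp
  set R : ℝ := ‖w‖ + 1
  have hR : 0 ≤ R := by positivity
  have hu : Summable fun N : ℕ => ‖c N‖ * N * R ^ (N - 1) := by
    rw [← summable_nat_add_iff 1]
    refine (summable_norm_gammaSeries hb1 hR).congr fun N => ?_
    rw [← hstep, norm_mul, Complex.norm_natCast]
    simp
  have hmain := hasDerivAt_tsum_of_isPreconnected (𝕜 := ℂ) (F := ℂ)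
    (g := fun N z => c N * z ^ N)
    (g' := fun N z => c N * (N * z ^ (N - 1))) (t := Metric.ball 0 R) (y₀ := 0) (y := w)
    hu Metric.isOpen_ball (convex_ball _ _).isPreconnected
    (fun N y _ => (hasDerivAt_pow N y).const_mul _)
    (fun N y hy => by
      have hy' : ‖y‖ ≤ R := by simpa using (Metric.mem_ball.1 hy).le
      rw [norm_mul, norm_mul, norm_pow, Complex.norm_natCast, ← mul_assoc]
      gcongr)
    (Metric.mem_ball_self (by positivity)) (hasSum_gammaSeries hb 0).summable
    (by simp [R])
  have hs : Summable fun N : ℕ => c N * (N * w ^ (N - 1)) := by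
    refine Summable.of_norm_bounded hu fun N => ?_
    rw [norm_mul, norm_mul, norm_pow, Complex.norm_natCast, ← mul_assoc]
    gcongr
    simp [R]
  have e : ∑' N : ℕ, c N * (N * w ^ (N - 1)) = gammaSeries (b - 1) w := by
    rw [hs.tsum_eq_zero_add]
    simp only [Nat.cast_zero, zero_mul, mul_zero, zero_add, Nat.add_sub_cancel, ← mul_assoc, hstep]
    rfl
  rw [← e]
  exact hmain

theorem differentiable_gammaSeries {b : ℂ} (hb : b ∈ Complex.integerComplement) :
    Differentiable ℂ (gammaSeries b) := fun w => (hasDerivAt_gammaSeries hb w).differentiableAt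

/-! ### The radial solutions -/

/-- The function `z ↦ z⁻ᵇ ∑ Γ(b - N) (κ z)ᴺ / N!`; as a function of `z = r²` it is a radial solution
of a Helmholtz equation in dimension `2 b + 2`. -/
def radialSol (κ b z : ℂ) : ℂ := z ^ (-b) * gammaSeries b (κ * z)

/-- The recurrence of the entire factor is exactly what closes the family under differentiation: the
derivative of the power and that of the series combine into a single shift of b. -/
theorem hasDerivAt_radialSol (κ : ℂ) {b : ℂ} (hb : b ∈ Complex.integerComplement) {z : ℂ}
    (hz : z ∈ Complex.slitPlane) :
    HasDerivAt (radialSol κ b) (-radialSol κ (b + 1) z) z := by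
  have hz0 : z ≠ 0 := Complex.slitPlane_ne_zero hz
  have h1 : HasDerivAt (fun z : ℂ => z ^ (-b)) (-b * z ^ (-b - 1)) z := by
    simpa using (hasDerivAt_id z).cpow_const (c := -b) hz
  have h2 : HasDerivAt (fun z : ℂ => gammaSeries b (κ * z)) (gammaSeries (b - 1) (κ * z) * κ) z :=
    (hasDerivAt_gammaSeries hb (κ * z)).comp z (by simpa using (hasDerivAt_id z).const_mul κ)
  refine (h1.mul h2).congr_deriv ?_
  have e : z ^ (-b) = z ^ (-b - 1) * z := by
    rw [Complex.cpow_sub _ _ hz0, Complex.cpow_one]; field_simp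
  rw [radialSol, gammaSeries_add_one hb, neg_add', e]
  ring

/-- Together with the derivative rule this is the radial equation z F'' + (b + 1) F' + κ F = 0. -/
theorem radialSol_add_two (κ : ℂ) {b : ℂ} (hb : b ∈ Complex.integerComplement) {z : ℂ}
    (hz : z ≠ 0) :
    z * radialSol κ (b + 2) z = (b + 1) * radialSol κ (b + 1) z - κ * radialSol κ b z := by
  have hb2 : b + 1 ∈ Complex.integerComplement := by
    simpa using (Complex.add_intCast_mem_integerComplement (x := b) 1).2 hb
  have h := gammaSeries_add_one hb2 (κ * z)
  rw [add_sub_cancel_right] at h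
  have e1 : z ^ (-b) = z ^ (-b - 2) * z ^ 2 := by
    rw [Complex.cpow_sub _ _ hz, Complex.cpow_ofNat]; field_simp
  have e2 : z ^ (-(b + 1)) = z ^ (-b - 2) * z := by
    rw [show -b - 2 = -(b + 1) - 1 by ring, Complex.cpow_sub _ _ hz, Complex.cpow_one]; field_simp
  have e3 : -(b + 2) = -b - 2 := by ring
  simp only [radialSol, e1, e2, e3]
  rw [show b + 2 = b + 1 + 1 by ring, h]
  ring

theorem norm_ofReal_cpow_neg_ofReal {s : ℝ} (hs : 0 < s) (b : ℝ) :
    ‖(s : ℂ) ^ (-(b : ℂ))‖ = s ^ (-b) := by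
  rw [← Complex.ofReal_neg, Complex.norm_cpow_eq_rpow_re_of_pos hs, Complex.ofReal_re]

/-- Near zero only the term N = 0 matters: by the mean value inequality on a disc, the entire factor
differs from its value Γ(b) at 0 by O(s). The correction due to κ is thus one power of s smaller
than the singularity. -/
theorem exists_norm_radialSol_sub_le (κ : ℂ) {b : ℝ} (hb : (b : ℂ) ∈ Complex.integerComplement)
    (R : ℝ) :
    ∃ C : ℝ, 0 ≤ C ∧ ∀ s : ℝ, 0 < s → s ≤ R →
      ‖radialSol κ b s - ((Real.Gamma b * s ^ (-b) : ℝ) : ℂ)‖ ≤ C * (s * s ^ (-b)) := by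
  have hb1 : (b : ℂ) - 1 ∈ Complex.integerComplement := by
    simpa using sub_natCast_mem_integerComplement hb 1
  obtain ⟨C, hC⟩ := (isCompact_closedBall (0 : ℂ) (‖κ‖ * |R|)).exists_bound_of_continuousOn
    (differentiable_gammaSeries hb1).continuous.continuousOn
  have hC0 : 0 ≤ C := (norm_nonneg _).trans (hC 0 (Metric.mem_closedBall_self (by positivity)))
  refine ⟨C * ‖κ‖, by positivity, fun s hs hsR => ?_⟩
  have hmem : κ * s ∈ Metric.closedBall (0 : ℂ) (‖κ‖ * |R|) := by
    rw [mem_closedBall_zero_iff, norm_mul, Complex.norm_real, Real.norm_eq_abs]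
    gcongr
  have h := (convex_closedBall (0 : ℂ) (‖κ‖ * |R|)).norm_image_sub_le_of_norm_hasDerivWithin_le
    (f := gammaSeries b) (f' := gammaSeries ((b : ℂ) - 1)) (C := C)
    (fun x _ => (hasDerivAt_gammaSeries hb x).hasDerivWithinAt) hC
    (Metric.mem_closedBall_self (by positivity)) hmem
  rw [gammaSeries_zero hb, sub_zero, norm_mul, Complex.norm_real, Real.norm_of_nonneg hs.le] at h
  have e : radialSol κ b s - ((Real.Gamma b * s ^ (-b) : ℝ) : ℂ) =
      (s : ℂ) ^ (-(b : ℂ)) * (gammaSeries b (κ * s) - Complex.Gamma b) := by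
    rw [radialSol, Complex.ofReal_mul, Complex.ofReal_cpow hs.le, Complex.Gamma_ofReal]
    push_cast; ring
  rw [e, norm_mul, norm_ofReal_cpow_neg_ofReal hs]
  calc _ ≤ s ^ (-b) * (C * (‖κ‖ * s)) := by gcongr
    _ = _ := by ring

theorem exists_norm_radialSol_le (κ : ℂ) {b : ℝ} (hb : (b : ℂ) ∈ Complex.integerComplement)
    (R : ℝ) :
    ∃ C : ℝ, 0 ≤ C ∧ ∀ s : ℝ, 0 < s → s ≤ R → ‖radialSol κ b s‖ ≤ C * s ^ (-b) := by
  obtain ⟨C, hC0, hC⟩ := exists_norm_radialSol_sub_le κ hb R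
  refine ⟨C * |R| + |Real.Gamma b|, by positivity, fun s hs hsR => ?_⟩
  have h1 := norm_le_norm_add_norm_sub' (radialSol κ b s) ((Real.Gamma b * s ^ (-b) : ℝ) : ℂ)
  have h2 := hC s hs hsR
  have h3 : s ≤ |R| := hsR.trans (le_abs_self R)
  have h4 : 0 < s ^ (-b) := Real.rpow_pos_of_pos hs _
  rw [Complex.norm_real, Real.norm_eq_abs, abs_mul, abs_of_pos h4] at h1
  have h5 : C * (s * s ^ (-b)) ≤ C * (|R| * s ^ (-b)) := by gcongr
  linarith

/-! ### A double series -/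

/-- Separates the two indices: for fixed N the sum over M becomes a binomial series with parameter a
- N. -/
theorem poch_natCast_sub {a : ℂ} (ha : a ∈ Complex.integerComplement) (M N : ℕ) :
    poch a ((M : ℤ) - N) =
      Complex.Gamma (a - N) / Complex.Gamma a * (ascPochhammer ℂ M).eval (a - N) := by
  have ha' := sub_natCast_mem_integerComplement ha N
  rw [poch_eq_Gamma_div ha, ← poch_natCast, poch_eq_Gamma_div ha']
  have := Gamma_ne_zero_of_mem_integerComplement ha'
  have e : a + ((M : ℤ) - (N : ℤ) : ℤ) = a - N + (M : ℤ) := by push_cast; ring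
  rw [e]
  field_simp

/-- Summed over M, the N-th row is at most (1 - S)^{-(‖a‖ + N)} times a factor geometric in N,
because Γ(a - N) grows at most geometrically. The factorial of N beats all of this. -/
theorem summable_norm_poch_mul_pow {a : ℂ} (ha : a ∈ Complex.integerComplement) {S H : ℝ}
    (hS0 : 0 ≤ S) (hS : S < 1) (hH : 0 ≤ H) :
    Summable fun q : ℕ × ℕ => ‖poch a ((q.1 : ℤ) - q.2)‖ *
      (S ^ q.1 / q.1.factorial * (H ^ q.2 / q.2.factorial)) := by
  obtain ⟨C, D, hC, hD, hCD⟩ := exists_norm_Gamma_sub_le ha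
  set f : ℕ × ℕ → ℝ := fun q => C * D ^ q.1 / ‖Complex.Gamma a‖ * (H ^ q.1 / q.1.factorial) *
    ((ascPochhammer ℝ q.2).eval (‖a‖ + q.1) * S ^ q.2 / q.2.factorial) with hf
  have hpos : ∀ (A : ℝ) (M : ℕ), 0 ≤ A → 0 ≤ (ascPochhammer ℝ M).eval A := fun A M hA =>
    (norm_nonneg _).trans (norm_ascPochhammer_eval_le (0 : ℂ) M (by simpa using hA))
  have hrow : ∀ N : ℕ, HasSum (fun M => f (N, M))
      (C * D ^ N / ‖Complex.Gamma a‖ * (H ^ N / N.factorial) * (1 - S) ^ (-(‖a‖ + N))) := fun N =>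
    (hasSum_ascPochhammer_mul_pow_real (‖a‖ + N) hS0 hS).mul_left _
  have hsum : Summable f := by
    rw [summable_prod_of_nonneg]
    · refine ⟨fun N => (hrow N).summable, ?_⟩
      simp only [(hrow _).tsum_eq]
      have h1S : 0 < 1 - S := by linarith
      refine ((Real.summable_pow_div_factorial (D * H * (1 - S)⁻¹)).mul_left
        (C / ‖Complex.Gamma a‖ * (1 - S) ^ (-‖a‖))).congr fun N => ?_
      rw [neg_add, Real.rpow_add h1S, Real.rpow_neg h1S.le (N : ℝ), Real.rpow_natCast, mul_pow,
        mul_pow, inv_pow]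
      ring
    · intro q
      have := hpos (‖a‖ + q.1) q.2 (by positivity)
      simp only [hf, Pi.zero_apply]
      positivity
  refine Summable.of_nonneg_of_le (fun q => by positivity) (fun q => ?_)
    ((Equiv.prodComm ℕ ℕ).summable_iff.2 hsum)
  simp only [hf, Function.comp_apply, Equiv.prodComm_apply, Prod.fst_swap, Prod.snd_swap]
  rw [poch_natCast_sub ha, norm_mul, norm_div]
  have h1 := hCD q.2
  have h2 := norm_ascPochhammer_eval_le (a - q.2) q.1 (A := ‖a‖ + q.2)
    ((norm_sub_le _ _).trans (by simp))
  calc _ ≤ C * D ^ q.2 / ‖Complex.Gamma a‖ * (ascPochhammer ℝ q.1).eval (‖a‖ + q.2) *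
        (S ^ q.1 / q.1.factorial * (H ^ q.2 / q.2.factorial)) := by gcongr
    _ = _ := by ring

/-- Summing over M first gives (1 - s)^{-a} (1 - s)^N, and the extra power (1 - s)^N joins ηᴺ to
form the argument of the entire series. -/
theorem hasSum_poch_mul_pow {a : ℂ} (ha : a ∈ Complex.integerComplement) {s : ℂ} (hs : ‖s‖ < 1)
    (η : ℂ) :
    HasSum (fun q : ℕ × ℕ => poch a ((q.1 : ℤ) - q.2) *
        (s ^ q.1 / q.1.factorial * (η ^ q.2 / q.2.factorial)))
      ((Complex.Gamma a)⁻¹ * ((1 - s) ^ (-a) * gammaSeries a (η * (1 - s)))) := by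
  have hsum : Summable fun q : ℕ × ℕ => poch a ((q.1 : ℤ) - q.2) *
        (s ^ q.1 / q.1.factorial * (η ^ q.2 / q.2.factorial)) := by
    refine Summable.of_norm ?_
    refine (summable_norm_poch_mul_pow ha (norm_nonneg s) hs (norm_nonneg η)).congr fun q => ?_
    simp [norm_pow]
  have h1s : 1 - s ≠ 0 := by
    intro h
    rw [← sub_eq_zero.1 h] at hs
    simp at hs
  have hsum' := (Equiv.prodComm ℕ ℕ).summable_iff.2 hsum
  have hrow : ∀ N : ℕ, HasSum (fun M : ℕ => poch a ((M : ℤ) - N) *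
        (s ^ M / M.factorial * (η ^ N / N.factorial)))
      (Complex.Gamma (a - N) / Complex.Gamma a * (η ^ N / N.factorial) * (1 - s) ^ (-(a - N))) := by
    intro N
    refine ((hasSum_ascPochhammer_mul_pow (a - N) hs).mul_left
      (Complex.Gamma (a - N) / Complex.Gamma a * (η ^ N / N.factorial))).congr_fun fun M => ?_
    rw [poch_natCast_sub ha]
    ring
  have htot := hsum'.hasSum.prod_fiberwise (fun N => hrow N)
  have hval := (hasSum_gammaSeries ha (η * (1 - s))).mul_left
    ((Complex.Gamma a)⁻¹ * (1 - s) ^ (-a))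
  have e := htot.unique (hval.congr_fun fun N => by
    rw [show -(a - N) = -a + N by ring, Complex.cpow_add _ _ h1s, Complex.cpow_natCast, mul_pow]
    ring)
  have h2 := (Equiv.prodComm ℕ ℕ).hasSum_iff.1 hsum'.hasSum
  rw [e, mul_assoc] at h2
  exact h2

/-! ### Symmetric beta measures -/

theorem measurable_betaPDF (b : ℝ) : Measurable (ProbabilityTheory.betaPDF b b) :=
  ENNReal.measurable_ofReal.comp (ProbabilityTheory.measurable_betaPDFReal b b)

theorem integral_betaMeasure {E : Type*} [NormedAddCommGroup E] [NormedSpace ℝ E] {b : ℝ}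
    (hb : 0 < b) (f : ℝ → E) :
    ∫ t, f t ∂(betaMeasure b b) =
      ∫ t in Ioo (0 : ℝ) 1, (1 / beta b b * t ^ (b - 1) * (1 - t) ^ (b - 1)) • f t := by
  rw [betaMeasure, integral_withDensity_eq_integral_toReal_smul
    (measurable_betaPDF b) (ae_of_all _ fun t => ENNReal.ofReal_lt_top), ← integral_indicator measurableSet_Ioo]
  congr 1
  ext t
  by_cases ht : t ∈ Ioo (0 : ℝ) 1
  · have h := ProbabilityTheory.betaPDFReal_pos ht.1 ht.2 hb hb
    rw [indicator_of_mem ht, ProbabilityTheory.betaPDF, ENNReal.toReal_ofReal h.le,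
      ProbabilityTheory.betaPDFReal, if_pos ⟨ht.1, ht.2⟩]
  · rw [indicator_of_notMem ht, ProbabilityTheory.betaPDF, ProbabilityTheory.betaPDFReal, if_neg (by exact ht)]
    simp

theorem ae_betaMeasure_mem_Ioo (b : ℝ) : ∀ᵐ t ∂(betaMeasure b b), t ∈ Ioo (0 : ℝ) 1 := by
  rw [betaMeasure, ae_withDensity_iff (measurable_betaPDF b)]
  refine ae_of_all _ fun t ht => ?_
  by_contra h
  exact ht (by rw [ProbabilityTheory.betaPDF, ProbabilityTheory.betaPDFReal, if_neg (by exact h)]; simp)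

theorem integrableOn_beta_weight {b : ℝ} (hb : 0 < b) :
    IntegrableOn (fun t : ℝ => t ^ (b - 1) * (1 - t) ^ (b - 1)) (Ioo 0 1) := by
  have h := (Complex.betaIntegral_convergent (u := b) (v := b) (by simpa) (by simpa))
  rw [intervalIntegrable_iff_integrableOn_Ioo_of_le zero_le_one] at h
  refine IntegrableOn.congr_fun (Integrable.norm h) (fun t ht => ?_) measurableSet_Ioo
  have h1 : (1 : ℂ) - t = ((1 - t : ℝ) : ℂ) := by push_cast; rfl
  simp only [norm_mul]
  rw [h1, Complex.norm_cpow_eq_rpow_re_of_pos ht.1,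
    Complex.norm_cpow_eq_rpow_re_of_pos (by linarith [ht.2])]
  simp

/-- The moment is the quotient of the Euler integrals B(b + k, b) and B(b, b). This is where the
pairing of the parameters b and 2b in the series is used. -/
theorem integral_pow_betaMeasure {b : ℝ} (hb : 0 < b) (k : ℕ) :
    ∫ t, (t : ℂ) ^ k ∂(betaMeasure b b) =
      (ascPochhammer ℂ k).eval (b : ℂ) / (ascPochhammer ℂ k).eval ((2 * b : ℝ) : ℂ) := by
  have hG : ∀ x : ℝ, 0 < x → Complex.Gamma x ≠ 0 := fun x hx =>
    Complex.Gamma_ne_zero_of_re_pos (by simpa)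
  have h1 := Complex.betaIntegral_eq_Gamma_mul_div (u := ((b + k : ℝ) : ℂ)) (v := (b : ℂ))
    (by simp; positivity) (by simpa)
  have hne : ∀ x : ℝ, 0 < x → ∀ j : ℕ, (x : ℂ) ≠ -j := fun x hx j h => by
    have := congrArg Complex.re h
    simp at this
    have : (0 : ℝ) ≤ j := j.cast_nonneg
    linarith
  have h2 := Complex.Gamma_add_nat_div_Gamma_eq (n := k) (b : ℂ) (hne b hb)
  have h3 := Complex.Gamma_add_nat_div_Gamma_eq (n := k) ((2 * b : ℝ) : ℂ)
    (hne (2 * b) (by positivity))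
  rw [← h2, ← h3, integral_betaMeasure hb]
  have h4 : ∫ t in Ioo (0 : ℝ) 1, (1 / beta b b * t ^ (b - 1) * (1 - t) ^ (b - 1)) • (t : ℂ) ^ k =
      ((1 / beta b b : ℝ) : ℂ) * Complex.betaIntegral ((b + k : ℝ) : ℂ) b := by
    rw [Complex.betaIntegral, intervalIntegral.integral_of_le zero_le_one,
      integral_Ioc_eq_integral_Ioo, ← integral_const_mul]
    refine setIntegral_congr_fun measurableSet_Ioo fun t ht => ?_
    have e1 : (1 : ℂ) - t = ((1 - t : ℝ) : ℂ) := by push_cast; rfl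
    have e2 : ((b + k : ℝ) : ℂ) - 1 = ((b - 1 + k : ℝ) : ℂ) := by push_cast; ring
    have e3 : (b : ℂ) - 1 = ((b - 1 : ℝ) : ℂ) := by push_cast; ring
    simp only [Complex.real_smul]
    rw [e1, e2, e3, ← Complex.ofReal_cpow ht.1.le, ← Complex.ofReal_cpow (by linarith [ht.2]),
      Real.rpow_add ht.1, Real.rpow_natCast]
    push_cast
    ring
  rw [h4, h1, beta]
  have e4 : ((b + k : ℝ) : ℂ) + b = ((2 * b : ℝ) : ℂ) + k := by push_cast; ring
  have e5 : ((b + k : ℝ) : ℂ) = (b : ℂ) + k := by push_cast; ring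
  rw [e4, e5, ← two_mul b]
  have g1 := hG b hb
  have g2 := hG (2 * b) (by positivity)
  push_cast [← Complex.Gamma_ofReal] at g1 g2 ⊢
  field_simp

/-- Integration by parts against a symmetric beta measure. -/
theorem integral_betaMeasure_deriv_eq_zero {b : ℝ} (hb : 0 < b) {g g' : ℝ → ℂ}
    (hg : ∀ t ∈ Icc (0 : ℝ) 1, HasDerivAt g (g' t) t) (hg' : ContinuousOn g' (Icc 0 1)) :
    ∫ t, ((t * (1 - t) : ℝ) * g' t + (b * (1 - 2 * t) : ℝ) * g t) ∂(betaMeasure b b) = 0 := by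
  have hgc : ContinuousOn g (Icc 0 1) := fun t ht => (hg t ht).continuousAt.continuousWithinAt
  -- The primitive t^b (1 - t)^b g vanishes at both ends because b > 0, and its derivative is the
  -- unnormalised beta density times the integrand.
  set F : ℝ → ℂ := fun t => ((t ^ b * (1 - t) ^ b : ℝ) : ℂ) * g t with hF
  have hcont : ContinuousOn F (Icc 0 1) := by
    refine ContinuousOn.mul ?_ hgc
    refine Continuous.continuousOn (Complex.continuous_ofReal.comp ?_)
    exact (Real.continuous_rpow_const hb.le).mul
      ((Real.continuous_rpow_const hb.le).comp (continuous_const.sub continuous_id))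
  have hder : ∀ t ∈ Ioo (0 : ℝ) 1, HasDerivAt F
      (((t ^ (b - 1) * (1 - t) ^ (b - 1) : ℝ) : ℂ) *
        ((t * (1 - t) : ℝ) * g' t + (b * (1 - 2 * t) : ℝ) * g t)) t := by
    intro t ht
    have h1t : 0 < 1 - t := by linarith [ht.2]
    have h1 : HasDerivAt (fun t : ℝ => t ^ b) (b * t ^ (b - 1)) t :=
      Real.hasDerivAt_rpow_const (Or.inl ht.1.ne')
    have h2 : HasDerivAt (fun t : ℝ => (1 - t) ^ b) (-(b * (1 - t) ^ (b - 1))) t := by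
      have := ((hasDerivAt_id t).const_sub 1).rpow_const (p := b) (Or.inl h1t.ne')
      simpa using this
    have h3 := (h1.mul h2).ofReal_comp.mul (hg t (Ioo_subset_Icc_self ht))
    refine h3.congr_deriv ?_
    have e1 : t ^ b = t ^ (b - 1) * t := by rw [Real.rpow_sub_one ht.1.ne', div_mul_cancel₀ _ ht.1.ne']
    have e2 : (1 - t) ^ b = (1 - t) ^ (b - 1) * (1 - t) := by rw [Real.rpow_sub_one h1t.ne', div_mul_cancel₀ _ h1t.ne']
    simp only [Pi.mul_apply, e1, e2]
    push_cast
    ring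
  have hint : IntervalIntegrable (fun t : ℝ => ((t ^ (b - 1) * (1 - t) ^ (b - 1) : ℝ) : ℂ) *
        ((t * (1 - t) : ℝ) * g' t + (b * (1 - 2 * t) : ℝ) * g t)) volume 0 1 := by
    rw [intervalIntegrable_iff_integrableOn_Ioo_of_le zero_le_one]
    have hc : ContinuousOn (fun t : ℝ => ((t * (1 - t) : ℝ) : ℂ) * g' t +
        ((b * (1 - 2 * t) : ℝ) : ℂ) * g t) (Icc 0 1) := by
      refine ContinuousOn.add (ContinuousOn.mul ?_ hg') (ContinuousOn.mul ?_ hgc) <;>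
      exact (Complex.continuous_ofReal.comp (by fun_prop)).continuousOn
    obtain ⟨C, hC⟩ := isCompact_Icc.exists_bound_of_continuousOn hc
    refine Integrable.mul_bdd (c := C) (integrableOn_beta_weight hb).ofReal
      ((hc.mono Ioo_subset_Icc_self).aestronglyMeasurable measurableSet_Ioo) ?_
    exact ae_restrict_of_forall_mem measurableSet_Ioo fun t ht => hC t (Ioo_subset_Icc_self ht)
  have h := intervalIntegral.integral_eq_sub_of_hasDerivAt_of_le zero_le_one hcont hder hint
  rw [intervalIntegral.integral_of_le zero_le_one, integral_Ioc_eq_integral_Ioo] at h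
  have hF0 : F 1 - F 0 = 0 := by simp [hF, Real.zero_rpow hb.ne']
  rw [hF0] at h
  rw [integral_betaMeasure hb]
  rw [← mul_zero (((1 / beta b b : ℝ) : ℂ)), ← h, ← integral_const_mul]
  refine setIntegral_congr_fun measurableSet_Ioo fun t _ => ?_
  simp only [Complex.real_smul]
  push_cast
  ring

/-! ### The Laplace transform of a symmetric beta measure -/

/-- The Laplace transform of the symmetric beta measure. -/
def betaLaplace (b w : ℝ) : ℝ := ∫ t, Real.exp (-(w * t)) ∂(betaMeasure b b)

theorem betaLaplace_nonneg (b w : ℝ) : 0 ≤ betaLaplace b w :=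
  integral_nonneg fun _ => (Real.exp_pos _).le

theorem integrable_exp_betaMeasure {b : ℝ} (hb : 0 < b) {w : ℝ} (hw : 0 ≤ w) :
    Integrable (fun t => Real.exp (-(w * t))) (betaMeasure b b) := by
  have := ProbabilityTheory.isProbabilityMeasureBeta hb hb
  refine Integrable.of_bound (C := 1) (by fun_prop) ?_
  filter_upwards [ae_betaMeasure_mem_Ioo b] with t ht
  rw [Real.norm_of_nonneg (Real.exp_pos _).le, Real.exp_le_one_iff]
  have := mul_nonneg hw ht.1.le
  linarith

theorem betaLaplace_le_one {b : ℝ} (hb : 0 < b) {w : ℝ} (hw : 0 ≤ w) : betaLaplace b w ≤ 1 := by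
  have := ProbabilityTheory.isProbabilityMeasureBeta hb hb
  have h : betaLaplace b w ≤ ∫ _, (1 : ℝ) ∂(betaMeasure b b) := by
    refine integral_mono_ae (integrable_exp_betaMeasure hb hw) (integrable_const _) ?_
    filter_upwards [ae_betaMeasure_mem_Ioo b] with t ht
    rw [Real.exp_le_one_iff]
    have := mul_nonneg hw ht.1.le
    linarith
  simpa using h

theorem measurable_betaLaplace {b : ℝ} (hb : 0 < b) : Measurable (betaLaplace b) := by
  have := ProbabilityTheory.isProbabilityMeasureBeta hb hb
  have h : StronglyMeasurable (fun q : ℝ × ℝ => Real.exp (-(q.1 * q.2))) :=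
    Continuous.stronglyMeasurable (by fun_prop)
  exact (h.integral_prod_right' (ν := betaMeasure b b)).measurable

/-- The substitution s = w t sends the endpoint contribution to the Gamma integral. Cutting at 1/2
keeps (1 - t)^{b-1} below (1/2)^{b-1}, since b ≤ 1, and so gives a dominating function. -/
theorem tendsto_integral_Ioc_half {b : ℝ} (hb : 0 < b) (hb1 : b ≤ 1) :
    Tendsto (fun w : ℝ => w ^ b *
      ∫ t in Ioc (0 : ℝ) (1 / 2), t ^ (b - 1) * (1 - t) ^ (b - 1) * Real.exp (-(w * t)))
      atTop (𝓝 (Real.Gamma b)) := by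
  rw [Real.Gamma_eq_integral hb]
  have hconv : Tendsto (fun w : ℝ => ∫ s in Ioi (0 : ℝ),
      (Iic (w / 2)).indicator
        (fun s => Real.exp (-s) * s ^ (b - 1) * (1 - w⁻¹ * s) ^ (b - 1)) s) atTop
      (𝓝 (∫ s in Ioi (0 : ℝ), Real.exp (-s) * s ^ (b - 1))) := by
    refine tendsto_integral_filter_of_dominated_convergence
      (fun s => Real.exp (-s) * s ^ (b - 1) * (1 / 2 : ℝ) ^ (b - 1)) ?_ ?_ ?_ ?_
    · refine Eventually.of_forall fun w => Measurable.aestronglyMeasurable ?_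
      exact Measurable.indicator (by fun_prop) measurableSet_Iic
    · filter_upwards [eventually_gt_atTop 0] with w hw
      refine ae_restrict_of_forall_mem measurableSet_Ioi fun s (hs : 0 < s) => ?_
      by_cases h : s ∈ Iic (w / 2)
      · rw [indicator_of_mem h]
        have h2 : (1 / 2 : ℝ) ≤ 1 - w⁻¹ * s := by
          have : w⁻¹ * s ≤ w⁻¹ * (w / 2) := by gcongr; exact h
          rw [show w⁻¹ * (w / 2) = 1 / 2 by field_simp] at this
          linarith
        have h3 : (1 - w⁻¹ * s) ^ (b - 1) ≤ (1 / 2 : ℝ) ^ (b - 1) :=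
          Real.rpow_le_rpow_of_nonpos (by norm_num) h2 (by linarith)
        have h4 : 0 ≤ (1 - w⁻¹ * s) ^ (b - 1) := Real.rpow_nonneg (by linarith) _
        rw [Real.norm_of_nonneg (by positivity)]
        gcongr
      · rw [indicator_of_notMem h, norm_zero]
        positivity
    · exact (Real.GammaIntegral_convergent hb).mul_const _
    · refine ae_restrict_of_forall_mem measurableSet_Ioi fun s (hs : 0 < s) => ?_
      have h1 : Tendsto (fun w : ℝ => Real.exp (-s) * s ^ (b - 1) * (1 - w⁻¹ * s) ^ (b - 1)) atTop
          (𝓝 (Real.exp (-s) * s ^ (b - 1) * (1 - 0 * s) ^ (b - 1))) := by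
        refine Tendsto.const_mul _ (Tendsto.rpow_const ?_ (Or.inl (by simp)))
        exact (tendsto_inv_atTop_zero.mul_const s).const_sub 1
      simp only [zero_mul, sub_zero, Real.one_rpow, mul_one] at h1
      refine h1.congr' ?_
      filter_upwards [eventually_ge_atTop (2 * s)] with w hw
      rw [indicator_of_mem (by simp only [mem_Iic]; linarith)]
  refine hconv.congr' ?_
  filter_upwards [eventually_gt_atTop 0] with w hw
  have hsub := integral_comp_mul_left_Ioi' (fun s => (Iic (w / 2)).indicator
        (fun s => Real.exp (-s) * s ^ (b - 1) * (1 - w⁻¹ * s) ^ (b - 1)) s) 0 hw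
  rw [mul_zero] at hsub
  rw [← hsub, smul_eq_mul, ← Ioi_inter_Iic, ← setIntegral_indicator measurableSet_Iic,
    ← integral_const_mul, ← integral_const_mul]
  refine setIntegral_congr_fun measurableSet_Ioi fun t (ht : 0 < t) => ?_
  have hiff : w * t ∈ Iic (w / 2) ↔ t ∈ Iic (1 / 2 : ℝ) := by
    simp only [mem_Iic]
    rw [show w / 2 = w * (1 / 2) by ring, mul_le_mul_iff_right₀ hw]
  by_cases h : t ∈ Iic (1 / 2 : ℝ)
  · simp only [indicator_of_mem h, indicator_of_mem (hiff.2 h)]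
    rw [Real.mul_rpow hw.le ht.le, inv_mul_cancel_left₀ hw.ne', Real.rpow_sub_one hw.ne']
    field_simp
  · simp only [indicator_of_notMem h, indicator_of_notMem (mt hiff.1 h), mul_zero]

/-- Watson's lemma: the endpoint t = 0 contributes Γ(b), the half (1/2, 1) is exponentially small,
and the normalisation 1 / B(b, b) = Γ(2b) / Γ(b)² gives the constant. -/
theorem tendsto_rpow_mul_betaLaplace {b : ℝ} (hb : 0 < b) (hb1 : b ≤ 1) :
    Tendsto (fun w : ℝ => w ^ b * betaLaplace b w) atTop
      (𝓝 (Real.Gamma (2 * b) / Real.Gamma b)) := by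
  have hw0 := integrableOn_beta_weight hb
  have h1 := tendsto_integral_Ioc_half hb hb1
  have h2 : Tendsto (fun w : ℝ => w ^ b *
      ∫ t in Ioo (1 / 2 : ℝ) 1, t ^ (b - 1) * (1 - t) ^ (b - 1) * Real.exp (-(w * t)))
      atTop (𝓝 0) := by
    have hlim : Tendsto (fun w : ℝ => w ^ b * Real.exp (-(1 / 2) * w) *
        ∫ t in Ioo (1 / 2 : ℝ) 1, t ^ (b - 1) * (1 - t) ^ (b - 1)) atTop (𝓝 0) := by
      have := (tendsto_rpow_mul_exp_neg_mul_atTop_nhds_zero b (1 / 2) (by norm_num)).mul_const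
        (∫ t in Ioo (1 / 2 : ℝ) 1, t ^ (b - 1) * (1 - t) ^ (b - 1))
      simpa using this
    have hsub : Ioo (1 / 2 : ℝ) 1 ⊆ Ioo 0 1 := Ioo_subset_Ioo_left (by norm_num)
    refine tendsto_of_tendsto_of_tendsto_of_le_of_le' tendsto_const_nhds hlim ?_ ?_
    · filter_upwards [eventually_gt_atTop 0] with w hw
      refine mul_nonneg (by positivity) (setIntegral_nonneg measurableSet_Ioo fun t ht => ?_)
      have : 0 ≤ 1 - t := by linarith [ht.2]
      have : 0 ≤ t := by linarith [ht.1]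
      positivity
    · filter_upwards [eventually_gt_atTop 0] with w hw
      rw [mul_assoc, ← integral_const_mul (Real.exp _)]
      refine mul_le_mul_of_nonneg_left (integral_mono_of_nonneg ?_ ?_ ?_) (Real.rpow_nonneg hw.le b)
      · refine ae_restrict_of_forall_mem measurableSet_Ioo fun t ht => ?_
        have : 0 ≤ 1 - t := by linarith [ht.2]
        have : 0 ≤ t := by linarith [ht.1]
        simp only [Pi.zero_apply]
        positivity
      · exact (hw0.mono_set hsub).const_mul _
      · refine ae_restrict_of_forall_mem measurableSet_Ioo fun t ht => ?_
        have h3 : 0 ≤ 1 - t := by linarith [ht.2]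
        have h4 : 0 ≤ t := by linarith [ht.1]
        simp only
        rw [mul_comm (Real.exp _)]
        refine mul_le_mul_of_nonneg_left (Real.exp_le_exp.2 ?_) (by positivity)
        nlinarith [ht.1]
  have h3 := ((h1.add h2).const_mul (1 / beta b b))
  have hB : 1 / beta b b * (Real.Gamma b + 0) = Real.Gamma (2 * b) / Real.Gamma b := by
    rw [beta, ← two_mul b]
    have := Real.Gamma_pos_of_pos hb
    have := Real.Gamma_pos_of_pos (mul_pos two_pos hb)
    field_simp
    simp
  rw [hB] at h3
  refine h3.congr' ?_
  filter_upwards [eventually_gt_atTop 0] with w hw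
  have hint : IntegrableOn (fun t : ℝ => t ^ (b - 1) * (1 - t) ^ (b - 1) * Real.exp (-(w * t)))
      (Ioo 0 1) := by
    refine Integrable.mul_bdd (c := 1) hw0 (by fun_prop) ?_
    refine ae_restrict_of_forall_mem measurableSet_Ioo fun t ht => ?_
    rw [Real.norm_of_nonneg (Real.exp_pos _).le, Real.exp_le_one_iff]
    have := mul_pos hw ht.1
    linarith
  have hun : Ioo (0 : ℝ) 1 = Ioc 0 (1 / 2) ∪ Ioo (1 / 2) 1 :=
    (Ioc_union_Ioo_eq_Ioo (by norm_num) (by norm_num)).symm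
  rw [betaLaplace, integral_betaMeasure hb, ← mul_add, mul_left_comm, ← setIntegral_union
    (disjoint_left.2 fun t ht ht' => absurd ht.2 (not_le.2 ht'.1)) measurableSet_Ioo
    (hint.mono_set (by rw [hun]; exact subset_union_left))
    (hint.mono_set (by rw [hun]; exact subset_union_right)), ← hun, ← integral_const_mul]
  congr 1
  refine setIntegral_congr_fun measurableSet_Ioo fun t _ => ?_
  simp only [smul_eq_mul]
  ring

theorem exists_rpow_mul_betaLaplace_le {b : ℝ} (hb : 0 < b) (hb1 : b ≤ 1) :
    ∃ C : ℝ, 0 < C ∧ ∀ w : ℝ, 0 < w → w ^ b * betaLaplace b w ≤ C := by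
  have h := (tendsto_rpow_mul_betaLaplace hb hb1).eventually_le_const (lt_add_one _)
  obtain ⟨W, hW⟩ := (h.and (eventually_gt_atTop 0)).exists_forall_of_atTop
  set L := Real.Gamma (2 * b) / Real.Gamma b
  have hW0 : 0 < W := (hW W le_rfl).2
  refine ⟨max (L + 1) (W ^ b), lt_max_of_lt_right (by positivity), fun w hw => ?_⟩
  rcases le_total W w with hle | hle
  · exact ((hW w hle).1).trans (le_max_left _ _)
  · refine le_trans ?_ (le_max_right _ _)
    calc w ^ b * betaLaplace b w ≤ W ^ b * 1 := by
          gcongr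
          · exact betaLaplace_nonneg b w
          · exact betaLaplace_le_one hb hw.le
      _ = W ^ b := mul_one _

/-! ### Products of symmetric beta measures -/

/-- The product of the symmetric beta measures with parameters `b₁, …, bₙ`. -/
def betaProd {n : ℕ} (b : Fin n → ℝ) : Measure (Fin n → ℝ) :=
  Measure.pi fun i => betaMeasure (b i) (b i)

theorem isProbabilityMeasure_betaProd {n : ℕ} {b : Fin n → ℝ} (hb : ∀ i, 0 < b i) :
    IsProbabilityMeasure (betaProd b) := by
  have := fun i => ProbabilityTheory.isProbabilityMeasureBeta (hb i) (hb i)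
  unfold betaProd
  infer_instance

theorem ae_betaProd_mem_Ioo {n : ℕ} {b : Fin n → ℝ} (hb : ∀ i, 0 < b i) :
    ∀ᵐ t ∂(betaProd b), ∀ i, t i ∈ Ioo (0 : ℝ) 1 := by
  have := fun i => ProbabilityTheory.isProbabilityMeasureBeta (hb i) (hb i)
  rw [eventually_all]
  intro i
  exact (Measure.tendsto_eval_ae_ae (μ := fun i => betaMeasure (b i) (b i)) (i := i)).eventually
    (ae_betaMeasure_mem_Ioo (b i))

theorem ae_betaProd_mem_Icc {n : ℕ} {b : Fin n → ℝ} (hb : ∀ i, 0 < b i) :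
    ∀ᵐ t ∂(betaProd b), t ∈ Icc (0 : Fin n → ℝ) 1 := by
  filter_upwards [ae_betaProd_mem_Ioo hb] with t ht
  exact ⟨fun i => (ht i).1.le, fun i => (ht i).2.le⟩

theorem restrict_Icc_betaProd {n : ℕ} {b : Fin n → ℝ} (hb : ∀ i, 0 < b i) :
    (betaProd b).restrict (Icc 0 1) = betaProd b :=
  Measure.restrict_eq_self_of_ae_mem (ae_betaProd_mem_Icc hb)

theorem integrable_betaProd_of_continuousOn {n : ℕ} {E : Type*} [NormedAddCommGroup E]
    {b : Fin n → ℝ} (hb : ∀ i, 0 < b i)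
    {f : (Fin n → ℝ) → E} (hf : ContinuousOn f (Icc 0 1)) : Integrable f (betaProd b) := by
  have := isProbabilityMeasure_betaProd hb
  rw [← restrict_Icc_betaProd hb]
  exact hf.integrableOn_compact isCompact_Icc

/-- Fubini isolates the j-th coordinate and reduces to the one-dimensional integration by parts. -/
theorem integral_betaProd_deriv_eq_zero {n : ℕ} {b : Fin n → ℝ} (hb : ∀ i, 0 < b i) (j : Fin n)
    {G G' : (Fin n → ℝ) → ℂ} (hGc : ContinuousOn G (Icc 0 1)) (hGc' : ContinuousOn G' (Icc 0 1))
    (hG : ∀ t ∈ Icc (0 : Fin n → ℝ) 1,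
      HasDerivAt (fun s => G (Function.update t j s)) (G' t) (t j)) :
    ∫ t, ((t j * (1 - t j) : ℝ) * G' t + (b j * (1 - 2 * t j) : ℝ) * G t) ∂(betaProd b) = 0 := by
  have hprob := fun i => ProbabilityTheory.isProbabilityMeasureBeta (hb i) (hb i)
  obtain _ | n := n
  · exact j.elim0
  set H : (Fin (n + 1) → ℝ) → ℂ := fun t =>
    ((t j * (1 - t j) : ℝ) * G' t + (b j * (1 - 2 * t j) : ℝ) * G t) with hH
  have hHc : ContinuousOn H (Icc 0 1) := by
    refine ContinuousOn.add (ContinuousOn.mul ?_ hGc') (ContinuousOn.mul ?_ hGc) <;>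
    exact (Complex.continuous_ofReal.comp (by fun_prop)).continuousOn
  have hHi : Integrable H (betaProd b) := integrable_betaProd_of_continuousOn hb hHc
  have hmp := measurePreserving_piFinSuccAbove (fun i => betaMeasure (b i) (b i)) j
  have hmp' := hmp.symm
  rw [betaProd] at hHi ⊢
  rw [← hmp'.integral_comp' H, integral_prod_symm]
  · refine integral_eq_zero_of_ae ?_
    have hae := ae_betaProd_mem_Icc (b := fun i => b (j.succAbove i)) (fun i => hb _)
    rw [betaProd] at hae
    filter_upwards [hae] with t' ht'
    have hmem : ∀ s ∈ Icc (0 : ℝ) 1, (Fin.insertNth j s t' : Fin (n + 1) → ℝ) ∈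
        Icc (0 : Fin (n + 1) → ℝ) 1 := by
      intro s hs
      constructor <;> intro i <;> rcases Fin.eq_self_or_eq_succAbove j i with rfl | ⟨i, rfl⟩
      · simpa using hs.1
      · simpa using ht'.1 i
      · simpa using hs.2
      · simpa using ht'.2 i
    have hcont : Continuous fun s : ℝ => (Fin.insertNth j s t' : Fin (n + 1) → ℝ) := by
      refine continuous_pi fun i => ?_
      rcases Fin.eq_self_or_eq_succAbove j i with rfl | ⟨i, rfl⟩
      · simpa using continuous_id'
      · simpa using continuous_const
    have := integral_betaMeasure_deriv_eq_zero (hb j)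
      (g := fun s => G (Fin.insertNth j s t')) (g' := fun s => G' (Fin.insertNth j s t'))
      (fun s hs => by
        have := hG _ (hmem s hs)
        simpa [Fin.update_insertNth] using this)
      (hGc'.comp hcont.continuousOn hmem)
    simpa [hH, MeasurableEquiv.piFinSuccAbove_symm_apply, Fin.insertNthEquiv] using this
  · exact hmp'.integrable_comp_of_integrable hHi

/-! ### Sums over finite fibres and the multinomial theorem -/

theorem summable_norm_of_fiberwise {ι κ : Type*} [DecidableEq κ] {f : ι → ℂ} {π : ι → κ}
    {A : κ → Finset ι} (hA : ∀ x, x ∈ A (π x)) {h : κ → ℝ}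
    (hh : Summable h) (hfh : ∀ q, ∑ x ∈ A q, ‖f x‖ ≤ h q) : Summable fun x => ‖f x‖ := by
  classical
  have hpos : ∀ q, 0 ≤ h q := fun q => (Finset.sum_nonneg fun _ _ => norm_nonneg _).trans (hfh q)
  refine summable_of_sum_le (c := ∑' q, h q) (fun x => norm_nonneg _) fun u => ?_
  calc ∑ x ∈ u, ‖f x‖ = ∑ q ∈ u.image π, ∑ x ∈ u with π x = q, ‖f x‖ :=
        (Finset.sum_fiberwise_of_maps_to (fun x hx => Finset.mem_image_of_mem π hx) _).symm
    _ ≤ ∑ q ∈ u.image π, h q := by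
        refine Finset.sum_le_sum fun q _ => le_trans ?_ (hfh q)
        refine Finset.sum_le_sum_of_subset_of_nonneg (fun x hx => ?_) fun _ _ _ => norm_nonneg _
        obtain rfl := (Finset.mem_filter.1 hx).2
        exact hA x
    _ ≤ ∑' q, h q := hh.sum_le_tsum _ fun q _ => hpos q

theorem hasSum_of_fiberwise {ι κ : Type*} {f : ι → ℂ} {π : ι → κ}
    {A : κ → Finset ι} (hA : ∀ x q, x ∈ A q ↔ π x = q) (hf : Summable f) {S : ℂ}
    (hS : HasSum (fun q => ∑ x ∈ A q, f x) S) : HasSum f S := by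
  have h := hf.hasSum.tsum_fiberwise π
  have e : ∀ q, ∑' x : π ⁻¹' {q}, f x = ∑ x ∈ A q, f x := fun q => by
    have : π ⁻¹' {q} = (A q : Set ι) := by ext x; simp [hA]
    rw [this, Finset.tsum_subtype']
  simp only [e] at h
  rw [hS.unique h]
  exact hf.hasSum

theorem sum_piAntidiag_prod_pow_div_factorial {K : Type*} [Field K] [CharZero K] {n : ℕ}
    (s : Fin n → K) (M : ℕ) :
    ∑ μ ∈ Finset.piAntidiag Finset.univ M, ∏ i, (s i ^ μ i / (μ i).factorial) =
      (∑ i, s i) ^ M / M.factorial := by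
  rw [Finset.sum_pow_eq_sum_piAntidiag, Finset.sum_div]
  refine Finset.sum_congr rfl fun μ hμ => ?_
  have h := Nat.multinomial_spec Finset.univ μ
  rw [(Finset.mem_piAntidiag.1 hμ).1] at h
  have h' : (∏ i, ((μ i).factorial : K)) * Nat.multinomial Finset.univ μ = M.factorial := by
    exact_mod_cast h
  have h0 : (∏ i, ((μ i).factorial : K)) ≠ 0 :=
    Finset.prod_ne_zero_iff.2 fun i _ => Nat.cast_ne_zero.2 (Nat.factorial_ne_zero _)
  have hM : (M.factorial : K) ≠ 0 := Nat.cast_ne_zero.2 M.factorial_ne_zero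
  rw [Finset.prod_div_distrib, div_eq_div_iff h0 hM, ← h']
  ring

/-- The coefficient depends only on the totals of the two blocks of indices. Grouping by these
totals, which have finite fibres, the multinomial theorem collapses the series to a double series in
∑ sᵢ and ∑ ηⱼ. -/
theorem hasSum_multinomial {n p : ℕ} {c : ℕ × ℕ → ℂ} (s : Fin n → ℂ) (η : Fin p → ℂ)
    (hc : Summable fun q : ℕ × ℕ => ‖c q‖ * ((∑ i, ‖s i‖) ^ q.1 / q.1.factorial *
      ((∑ j, ‖η j‖) ^ q.2 / q.2.factorial))) :
    (Summable fun μ : (Fin n → ℕ) × (Fin p → ℕ) => ‖c (∑ i, μ.1 i, ∑ j, μ.2 j) *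
      ((∏ i, (s i ^ μ.1 i / (μ.1 i).factorial)) * ∏ j, (η j ^ μ.2 j / (μ.2 j).factorial))‖) ∧
    ∀ S, HasSum (fun q : ℕ × ℕ => c q * ((∑ i, s i) ^ q.1 / q.1.factorial *
      ((∑ j, η j) ^ q.2 / q.2.factorial))) S →
    HasSum (fun μ : (Fin n → ℕ) × (Fin p → ℕ) => c (∑ i, μ.1 i, ∑ j, μ.2 j) *
      ((∏ i, (s i ^ μ.1 i / (μ.1 i).factorial)) * ∏ j, (η j ^ μ.2 j / (μ.2 j).factorial))) S := by
  set π : (Fin n → ℕ) × (Fin p → ℕ) → ℕ × ℕ := fun μ => (∑ i, μ.1 i, ∑ j, μ.2 j) with hπ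
  set A : ℕ × ℕ → Finset ((Fin n → ℕ) × (Fin p → ℕ)) := fun q =>
    Finset.piAntidiag Finset.univ q.1 ×ˢ Finset.piAntidiag Finset.univ q.2 with hAdef
  have hA : ∀ x q, x ∈ A q ↔ π x = q := by
    intro x q
    simp [hAdef, hπ, Finset.mem_product, Prod.ext_iff]
  have hsum : Summable fun μ : (Fin n → ℕ) × (Fin p → ℕ) => ‖c (π μ) *
      ((∏ i, (s i ^ μ.1 i / (μ.1 i).factorial)) * ∏ j, (η j ^ μ.2 j / (μ.2 j).factorial))‖ := by
    refine summable_norm_of_fiberwise (π := π) (A := A) (fun x => (hA x _).2 rfl) hc fun q => ?_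
    refine le_of_eq ?_
    rw [← sum_piAntidiag_prod_pow_div_factorial (fun i => ‖s i‖),
      ← sum_piAntidiag_prod_pow_div_factorial (fun i => ‖η i‖), Finset.sum_mul_sum,
      ← Finset.sum_product', Finset.mul_sum]
    refine Finset.sum_congr rfl fun μ hμ => ?_
    rw [(hA μ q).1 hμ]
    simp [norm_prod]
  refine ⟨hsum, fun S hS => hasSum_of_fiberwise (π := π) hA hsum.of_norm (hS.congr_fun fun q => ?_)⟩
  rw [← sum_piAntidiag_prod_pow_div_factorial s, ← sum_piAntidiag_prod_pow_div_factorial η,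
    Finset.sum_mul_sum, ← Finset.sum_product', Finset.mul_sum]
  refine Finset.sum_congr rfl fun μ hμ => ?_
  rw [← (hA μ q).1 hμ]

/-! ### The integral representation of the series -/

/-- Each quotient of Pochhammer symbols is a moment, so passing from ξᵢ to tᵢ ξᵢ and averaging
absorbs all of them. -/
theorem HATerm_eq_integral {n p : ℕ} (a : ℂ) {b : Fin n → ℝ} (hb : ∀ i, 0 < b i) (ξ : Fin n → ℂ)
    (η : Fin p → ℂ) (μ : (Fin n → ℕ) × (Fin p → ℕ)) :
    HATerm a (fun i => (b i : ℂ)) (fun i => ((2 * b i : ℝ) : ℂ)) ξ η μ =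
      ∫ t, poch a (((∑ i, μ.1 i : ℕ) : ℤ) - (∑ j, μ.2 j : ℕ)) *
        ((∏ i, (((t i : ℂ) * ξ i) ^ μ.1 i / (μ.1 i).factorial)) *
          ∏ j, (η j ^ μ.2 j / (μ.2 j).factorial)) ∂(betaProd b) := by
  have hprob := fun i => ProbabilityTheory.isProbabilityMeasureBeta (hb i) (hb i)
  rw [integral_const_mul, integral_mul_const]
  simp only [mul_pow, mul_div_assoc]
  rw [betaProd, integral_fintype_prod_eq_prod (𝕜 := ℂ)
    (f := fun i (t : ℝ) => (t : ℂ) ^ μ.1 i * (ξ i ^ μ.1 i / (μ.1 i).factorial))]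
  simp only [integral_mul_const, integral_pow_betaMeasure (hb _)]
  simp only [HATerm, poch_natCast, Finset.prod_mul_distrib, Finset.prod_div_distrib]
  push_cast
  ring

/-- The Euler integral of the confluent hypergeometric function. -/
def eulerIntegral {n : ℕ} (a : ℂ) (b : Fin n → ℝ) (ξ : Fin n → ℂ) (η : ℂ) : ℂ :=
  (Complex.Gamma a)⁻¹ * ∫ t, (1 - ∑ i, (t i : ℂ) * ξ i) ^ (-a) *
    gammaSeries a (η * (1 - ∑ i, (t i : ℂ) * ξ i)) ∂(betaProd b)

/-- Sum and average are interchanged: on the cube the terms are dominated by those at t = (1, …, 1),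
which are absolutely summable. For fixed t the series is then known in closed form. -/
theorem hasSum_HATerm {n p : ℕ} {a : ℂ} (ha : a ∈ Complex.integerComplement) {b : Fin n → ℝ}
    (hb : ∀ i, 0 < b i) {ξ : Fin n → ℂ} (hξ : ∑ i, ‖ξ i‖ < 1) (η : Fin p → ℂ) :
    HasSum (HATerm a (fun i => (b i : ℂ)) (fun i => ((2 * b i : ℝ) : ℂ)) ξ η)
      (eulerIntegral a b ξ (∑ j, η j)) := by
  have hprob := isProbabilityMeasure_betaProd hb
  have hpoch : ∀ s : Fin n → ℂ, ∑ i, ‖s i‖ < 1 → Summable fun q : ℕ × ℕ =>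
      ‖poch a ((q.1 : ℤ) - q.2)‖ * ((∑ i, ‖s i‖) ^ q.1 / q.1.factorial *
      ((∑ j, ‖η j‖) ^ q.2 / q.2.factorial)) := fun s hs =>
    summable_norm_poch_mul_pow ha (by positivity) hs (by positivity)
  set F : (Fin n → ℕ) × (Fin p → ℕ) → (Fin n → ℝ) → ℂ := fun μ t =>
    poch a (((∑ i, μ.1 i : ℕ) : ℤ) - (∑ j, μ.2 j : ℕ)) *
        ((∏ i, (((t i : ℂ) * ξ i) ^ μ.1 i / (μ.1 i).factorial)) *
          ∏ j, (η j ^ μ.2 j / (μ.2 j).factorial)) with hF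
  have hFc : ∀ μ, Continuous (F μ) := fun μ => by
    simp only [hF]
    fun_prop
  have hFi : ∀ μ, Integrable (F μ) (betaProd b) := fun μ =>
    integrable_betaProd_of_continuousOn hb (hFc μ).continuousOn
  have hbound : ∀ μ, ∫ t, ‖F μ t‖ ∂(betaProd b) ≤
      ‖poch a (((∑ i, μ.1 i : ℕ) : ℤ) - (∑ j, μ.2 j : ℕ)) *
        ((∏ i, (ξ i ^ μ.1 i / (μ.1 i).factorial)) *
          ∏ j, (η j ^ μ.2 j / (μ.2 j).factorial))‖ := by
    intro μ
    rw [← one_smul ℝ ‖poch a _ * _‖, ← probReal_univ (μ := betaProd b), ← integral_const]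
    refine integral_mono_ae (hFi μ).norm (integrable_const _) ?_
    filter_upwards [ae_betaProd_mem_Icc hb] with t ht
    simp only [hF, norm_mul, norm_prod, norm_div, norm_pow]
    gcongr with i
    rw [Complex.norm_real, Real.norm_of_nonneg (ht.1 i)]
    exact mul_le_of_le_one_left (norm_nonneg _) (ht.2 i)
  have hsum : Summable fun μ => ∫ t, ‖F μ t‖ ∂(betaProd b) :=
    Summable.of_nonneg_of_le (fun μ => integral_nonneg fun t => norm_nonneg _) hbound
      (hasSum_multinomial (c := fun q => poch a ((q.1 : ℤ) - q.2)) ξ η (hpoch ξ hξ)).1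
  have h := hasSum_integral_of_summable_integral_norm hFi hsum
  have e : ∫ t, ∑' μ, F μ t ∂(betaProd b) = eulerIntegral a b ξ (∑ j, η j) := by
    rw [eulerIntegral, ← integral_const_mul]
    refine integral_congr_ae ?_
    filter_upwards [ae_betaProd_mem_Icc hb] with t ht
    have hle : ∑ i, ‖(t i : ℂ) * ξ i‖ < 1 := by
      refine lt_of_le_of_lt (Finset.sum_le_sum fun i _ => ?_) hξ
      rw [norm_mul, Complex.norm_real, Real.norm_of_nonneg (ht.1 i)]
      exact mul_le_of_le_one_left (norm_nonneg _) (ht.2 i)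
    exact ((hasSum_multinomial (c := fun q => poch a ((q.1 : ℤ) - q.2)) (fun i => (t i : ℂ) * ξ i) η
      (hpoch _ hle)).2 _ (hasSum_poch_mul_pow ha ((norm_sum_le _ _).trans_lt hle) _)).tsum_eq
  rw [e] at h
  refine h.congr_fun fun μ => ?_
  exact HATerm_eq_integral a hb ξ η μ

/-! ### Analytic dependence of integrals of radial solutions on parameters -/

/-- The two arguments lie in (-π/2, π/2), so their sum stays in the principal range and the
logarithm is additive. -/
theorem mul_cpow_of_re_pos {z w : ℂ} (hz : 0 < z.re) (hw : 0 < w.re) (c : ℂ) :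
    (z * w) ^ c = z ^ c * w ^ c := by
  have hz0 : z ≠ 0 := fun h => by simp [h] at hz
  have hw0 : w ≠ 0 := fun h => by simp [h] at hw
  have h1 := abs_lt.1 (Complex.abs_arg_lt_pi_div_two_iff.2 (Or.inl hz))
  have h2 := abs_lt.1 (Complex.abs_arg_lt_pi_div_two_iff.2 (Or.inl hw))
  rw [Complex.cpow_def_of_ne_zero (mul_ne_zero hz0 hw0), Complex.cpow_def_of_ne_zero hz0,
    Complex.cpow_def_of_ne_zero hw0, ← Complex.exp_add,
    Complex.log_mul hz0 hw0 ⟨by linarith [h1.1, h2.1], by linarith [h1.2, h2.2]⟩, add_mul]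

theorem radius_ofScalars_gammaSeries {b : ℂ} (hb : b ∈ Complex.integerComplement)
    {B : Type*} [NormedRing B] [NormedAlgebra ℂ B] :
    (FormalMultilinearSeries.ofScalars B
      fun N : ℕ => Complex.Gamma (b - N) / N.factorial).radius = ⊤ := by
  refine FormalMultilinearSeries.radius_eq_top_of_summable_norm _ fun r => ?_
  -- The norm bound for the coefficients is used from order one on only: at order zero the norm of
  -- the unit of `B` enters, and it need not be 1.
  rw [← summable_nat_add_iff 1]
  refine Summable.of_nonneg_of_le (fun N => by positivity) (fun N => ?_)
    ((summable_nat_add_iff 1).2 (summable_norm_gammaSeries hb r.2))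
  have := FormalMultilinearSeries.ofScalars_norm_le B
    (fun N : ℕ => Complex.Gamma (b - N) / N.factorial) (N + 1) N.succ_pos
  exact mul_le_mul_of_nonneg_right this (by positivity)

/-- The same scalar coefficients serve in ℂ and in any normed algebra; they are evaluated below in
an algebra of continuous functions. -/
theorem exists_ofScalars_one_add_cpow (B : Type*) [NormedRing B] [NormedAlgebra ℂ B] (a : ℂ) :
    ∃ c : ℕ → ℂ, 1 ≤ (FormalMultilinearSeries.ofScalars B c).radius ∧
      HasFPowerSeriesOnBall (fun z : ℂ => (1 + z) ^ a)
        (FormalMultilinearSeries.ofScalars ℂ c) 0 1 := by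
  refine ⟨(Ring.choose a ·), ?_, Complex.one_add_cpow_hasFPowerSeriesOnBall_zero⟩
  refine ENNReal.le_of_forall_nnreal_lt fun r hr => ?_
  have h1 : (r : ENNReal) < (FormalMultilinearSeries.ofScalars ℂ (Ring.choose a ·)).radius :=
    hr.trans_le (binomialSeries_radius_ge_one (𝕂 := ℂ) (𝔸 := ℂ) (a := a))
  refine FormalMultilinearSeries.le_radius_of_summable_norm _ ?_
  have h2 := FormalMultilinearSeries.summable_norm_mul_pow _ h1
  rw [← summable_nat_add_iff 1] at h2 ⊢
  refine Summable.of_nonneg_of_le (fun N => by positivity) (fun N => ?_) h2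
  have h3 := FormalMultilinearSeries.ofScalars_norm_le B (Ring.choose a ·) (N + 1) N.succ_pos
  rw [FormalMultilinearSeries.ofScalars_norm (E := ℂ)]
  exact mul_le_mul_of_nonneg_right h3 (by positivity)

/-! ### Superposition operators on the Banach algebra of continuous functions on a compact space -/

section BanachAlgebra

variable {K : Type*} [TopologicalSpace K] [CompactSpace K]

/-- Evaluation at a point is a continuous algebra homomorphism, so it commutes with the sum of a
power series. -/
theorem ContinuousMap.ofScalars_sum_apply {c : ℕ → ℂ} {h : C(K, ℂ)} {f : ℂ → ℂ} {r r' : ENNReal}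
    (hA : HasFPowerSeriesOnBall (FormalMultilinearSeries.ofScalars C(K, ℂ) c).sum
      (FormalMultilinearSeries.ofScalars C(K, ℂ) c) 0 r)
    (hf : HasFPowerSeriesOnBall f (FormalMultilinearSeries.ofScalars ℂ c) 0 r')
    (hr : h ∈ Metric.eball 0 r) (t : K) (hr' : h t ∈ Metric.eball 0 r') :
    (FormalMultilinearSeries.ofScalars C(K, ℂ) c).sum h t = f (h t) := by
  have h1 := (hA.hasSum hr).mapL (ContinuousMap.evalCLM ℂ t)
  have h2 := hf.hasSum hr'
  simp only [zero_add, FormalMultilinearSeries.ofScalars_apply_eq] at h1 h2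
  refine h1.unique (h2.congr_fun fun N => ?_)
  simp

/-- Write h = h₀ (1 + u) with u = h / h₀ - 1, which is small in the sup norm for h near h₀. The
binomial series in u is analytic, and h^a = h₀^a (1 + u)^a holds pointwise because h₀ and 1 + u have
positive real part. -/
theorem ContinuousMap.analyticAt_cpow (a : ℂ) {h₀ : C(K, ℂ)} (h0 : ∀ t, 0 < (h₀ t).re) :
    ∃ P : C(K, ℂ) → C(K, ℂ), AnalyticAt ℂ P h₀ ∧ ∀ᶠ h in 𝓝 h₀, ∀ t, P h t = h t ^ a := by
  have hne : ∀ t, h₀ t ≠ 0 := fun t ht => by have := h0 t; simp [ht] at this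
  obtain ⟨inv0, hinv⟩ : ∃ g : C(K, ℂ), ∀ t, g t = (h₀ t)⁻¹ :=
    ⟨⟨fun t => (h₀ t)⁻¹, h₀.continuous.inv₀ hne⟩, fun _ => rfl⟩
  obtain ⟨pow0, hpow⟩ : ∃ g : C(K, ℂ), ∀ t, g t = h₀ t ^ a :=
    ⟨⟨fun t => h₀ t ^ a, h₀.continuous.cpow continuous_const (fun t => Or.inl (h0 t))⟩,
      fun _ => rfl⟩
  obtain ⟨c, hr1, hC⟩ := exists_ofScalars_one_add_cpow C(K, ℂ) a
  have hb1 : HasFPowerSeriesOnBall (FormalMultilinearSeries.ofScalars C(K, ℂ) c).sum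
      (FormalMultilinearSeries.ofScalars C(K, ℂ) c) 0 1 :=
    ((FormalMultilinearSeries.ofScalars C(K, ℂ) c).hasFPowerSeriesOnBall
      (zero_lt_one.trans_le hr1)).mono zero_lt_one hr1
  have hu0 : inv0 * h₀ - 1 = 0 := by
    ext t
    simp [hinv, hne t]
  have hu : AnalyticAt ℂ (fun h : C(K, ℂ) => inv0 * h - 1) h₀ :=
    ((analyticAt_const).mul analyticAt_id).sub analyticAt_const
  refine ⟨fun h => pow0 * (FormalMultilinearSeries.ofScalars C(K, ℂ) c).sum (inv0 * h - 1), ?_, ?_⟩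
  · refine analyticAt_const.mul ?_
    refine AnalyticAt.comp (g := (FormalMultilinearSeries.ofScalars C(K, ℂ) c).sum) ?_ hu
    rw [hu0]
    exact hb1.analyticAt
  · have hc := hu.continuousAt.tendsto
    rw [hu0] at hc
    filter_upwards [hc (Metric.ball_mem_nhds 0 one_pos)] with h hh t
    have hh' : ‖inv0 * h - 1‖ < 1 := by simpa using hh
    have ht : ‖(inv0 * h - 1) t‖ < 1 := (ContinuousMap.norm_coe_le_norm _ t).trans_lt hh'
    have key := ContinuousMap.ofScalars_sum_apply (h := inv0 * h - 1) hb1 hC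
      (by rw [Metric.mem_eball, edist_zero_right, enorm_eq_nnnorm]; exact_mod_cast hh') t
      (by rw [Metric.mem_eball, edist_zero_right, enorm_eq_nnnorm]; exact_mod_cast ht)
    have e1 : 1 + (inv0 * h - 1) t = (h₀ t)⁻¹ * h t := by simp [hinv]
    have hre : 0 < ((h₀ t)⁻¹ * h t).re := by
      have := (abs_lt.1 ((Complex.abs_re_le_norm _).trans_lt ht)).1
      rw [← e1, Complex.add_re, Complex.one_re]
      linarith
    rw [e1] at key
    rw [ContinuousMap.mul_apply, key, hpow, ← mul_cpow_of_re_pos (h0 t) hre,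
      mul_inv_cancel_left₀ (hne t)]

theorem ContinuousMap.analyticAt_gammaSeries (κ : ℂ) {b : ℂ} (hb : b ∈ Complex.integerComplement)
    (h₀ : C(K, ℂ)) :
    ∃ P : C(K, ℂ) → C(K, ℂ), AnalyticAt ℂ P h₀ ∧ ∀ h t, P h t = gammaSeries b (κ * h t) := by
  set c : ℕ → ℂ := fun N => Complex.Gamma (b - N) / N.factorial with hc
  have hA := (FormalMultilinearSeries.ofScalars C(K, ℂ) c).hasFPowerSeriesOnBall
    (by rw [radius_ofScalars_gammaSeries hb]; exact ENNReal.zero_lt_top)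
  have hC := (FormalMultilinearSeries.ofScalars ℂ c).hasFPowerSeriesOnBall
    (by rw [radius_ofScalars_gammaSeries hb]; exact ENNReal.zero_lt_top)
  rw [radius_ofScalars_gammaSeries hb] at hA hC
  refine ⟨fun h => (FormalMultilinearSeries.ofScalars C(K, ℂ) c).sum (κ • h), ?_, fun h t => ?_⟩
  · refine AnalyticAt.comp (g := (FormalMultilinearSeries.ofScalars C(K, ℂ) c).sum)
      (hA.analyticAt_of_mem (by simp)) ?_
    exact (κ • ContinuousLinearMap.id ℂ C(K, ℂ)).analyticAt h₀
  · rw [ContinuousMap.ofScalars_sum_apply hA hC (by simp) t (by simp)]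
    change ∑' N, _ = _
    simp only [FormalMultilinearSeries.ofScalars_apply_eq, smul_eq_mul]
    rfl

/-- Integration is a bounded linear functional on C(K, ℂ), so analyticity of the integral reduces to
analyticity of the superposition h ↦ F ∘ h. -/
theorem analyticAt_integral_radialSol [MeasurableSpace K] [BorelSpace K] (μ : Measure K)
    [IsFiniteMeasure μ] (κ : ℂ) {b : ℂ} (hb : b ∈ Complex.integerComplement)
    {h₀ : C(K, ℂ)} (h0 : ∀ t, 0 < (h₀ t).re) :
    AnalyticAt ℂ (fun h : C(K, ℂ) => ∫ t, radialSol κ b (h t) ∂μ) h₀ := by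
  obtain ⟨P, hP, hPe⟩ := ContinuousMap.analyticAt_cpow (-b) h0
  obtain ⟨Q, hQ, hQe⟩ := ContinuousMap.analyticAt_gammaSeries κ hb h₀
  have hint : ∀ g : C(K, ℂ), Integrable g μ := fun g =>
    g.continuous.integrable_of_hasCompactSupport (HasCompactSupport.of_compactSpace g)
  let Λ : C(K, ℂ) →L[ℂ] ℂ := LinearMap.mkContinuous
    { toFun := fun g => ∫ t, g t ∂μ
      map_add' := fun f g => integral_add (hint f) (hint g)
      map_smul' := fun c f => integral_const_mul c _ } (μ.real univ) fun g => by
        rw [mul_comm]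
        exact norm_integral_le_of_norm_le_const (ae_of_all _ fun t => g.norm_coe_le_norm t)
  have h1 : AnalyticAt ℂ (fun h => Λ (P h * Q h)) h₀ :=
    (Λ.analyticAt _).comp (hP.mul hQ)
  refine h1.congr ?_
  filter_upwards [hPe] with h hh
  change ∫ t, (P h * Q h) t ∂μ = _
  simp only [ContinuousMap.mul_apply, hh, hQe, radialSol]

end BanachAlgebra

/-- The integral of a radial solution along the affine pencil `y₀ + t₁ y₁ + ⋯ + tₙ yₙ` against a
product of beta measures. -/
def radialIntegral {n : ℕ} (κ a : ℂ) (b : Fin n → ℝ) (y : ℂ × (Fin n → ℂ)) : ℂ :=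
  ∫ t, radialSol κ a (y.1 + ∑ i, (t i : ℂ) * y.2 i) ∂(betaProd b)

/-- The pencil depends linearly and continuously on y as an element of C([0, 1]ⁿ, ℂ). It has
positive real part because y₀ does and the other terms contribute non-negative real parts. -/
theorem analyticAt_radialIntegral {n : ℕ} (κ : ℂ) {a : ℂ} (ha : a ∈ Complex.integerComplement)
    {b : Fin n → ℝ} (hb : ∀ i, 0 < b i) {y : ℂ × (Fin n → ℂ)} (h0 : 0 < y.1.re)
    (hy : ∀ i, 0 ≤ (y.2 i).re) : AnalyticAt ℂ (radialIntegral κ a b) y := by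
  have hprob := isProbabilityMeasure_betaProd hb
  let K := Icc (0 : Fin n → ℝ) 1
  let T : Fin n → C(K, ℂ) := fun i => ⟨fun t => ((t : Fin n → ℝ) i : ℂ),
    Complex.continuous_ofReal.comp ((continuous_apply i).comp continuous_subtype_val)⟩
  let Y : ℂ × (Fin n → ℂ) →L[ℂ] C(K, ℂ) :=
    (ContinuousLinearMap.fst ℂ ℂ (Fin n → ℂ)).smulRight 1 +
      ∑ i, ((ContinuousLinearMap.proj (R := ℂ) (φ := fun _ : Fin n => ℂ) i).comp
        (ContinuousLinearMap.snd ℂ ℂ (Fin n → ℂ))).smulRight (T i)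
  have hY : ∀ y t, Y y t = y.1 + ∑ i, (((t : Fin n → ℝ) i : ℝ) : ℂ) * y.2 i := fun y t => by
    simp [Y, T, mul_comm]
  have hre : ∀ t, 0 < (Y y t).re := fun t => by
    rw [hY, Complex.add_re, Complex.re_sum]
    refine add_pos_of_pos_of_nonneg h0 (Finset.sum_nonneg fun i _ => ?_)
    rw [Complex.re_ofReal_mul]
    exact mul_nonneg (t.2.1 i) (hy i)
  have hfin : IsFiniteMeasure ((betaProd b).comap (Subtype.val : K → _)) := by
    refine ⟨?_⟩
    rw [comap_subtype_coe_apply measurableSet_Icc]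
    exact measure_lt_top _ _
  have h1 := (analyticAt_integral_radialSol ((betaProd b).comap (Subtype.val : K → _)) κ ha
    hre).comp (Y.analyticAt y)
  refine h1.congr (Eventually.of_forall fun y => ?_)
  simp only [Function.comp_apply, radialIntegral, hY]
  rw [integral_subtype_comap measurableSet_Icc
    (f := fun t : Fin n → ℝ => radialSol κ a (y.1 + ∑ i, (t i : ℂ) * y.2 i)),
    restrict_Icc_betaProd hb]

/-! ### The analytic continuation -/

theorem eulerIntegral_eq_radialIntegral {n : ℕ} (a : ℂ) (b : Fin n → ℝ) (ξ : Fin n → ℂ) (η : ℂ) :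
    eulerIntegral a b ξ η =
      (Complex.Gamma a)⁻¹ * radialIntegral η a b (1, fun i => -ξ i) := by
  simp only [eulerIntegral, radialIntegral, radialSol, mul_neg, Finset.sum_neg_distrib,
    sub_eq_add_neg]

/-- Since ξ ≤ 0, the real part of 1 - z ∑ tᵢ ξᵢ is at least 1 for z in [0, 1], so the Euler integral
is holomorphic near the whole segment. Near z = 0 it is the sum of the series. -/
theorem isHAContinuation_eulerIntegral {n p : ℕ} {a : ℂ} (ha : a ∈ Complex.integerComplement)
    {b : Fin n → ℝ} (hb : ∀ i, 0 < b i) {ξ : Fin n → ℝ} (hξ : ∀ i, ξ i ≤ 0) (η : Fin p → ℂ) :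
    IsHAContinuation a (fun i => (b i : ℂ)) (fun i => ((2 * b i : ℝ) : ℂ)) (fun i => (ξ i : ℂ)) η
      (fun z => eulerIntegral a b (fun i => z * ξ i) (∑ j, η j)) := by
  constructor
  · rintro _ ⟨s, hs, rfl⟩
    simp only [eulerIntegral_eq_radialIntegral]
    refine analyticAt_const.mul ?_
    refine AnalyticAt.fun_comp (g := radialIntegral (∑ j, η j) a b)
      (f := fun z : ℂ => ((1 : ℂ), fun i => -(z * (ξ i : ℂ)))) ?_ ?_
    · refine analyticAt_radialIntegral _ ha hb (by simp) fun i => ?_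
      simp only [Complex.neg_re, Complex.re_ofReal_mul, Complex.ofReal_re, Left.nonneg_neg_iff]
      exact mul_nonpos_of_nonneg_of_nonpos hs.1 (hξ i)
    · refine analyticAt_const.prod ?_
      rw [analyticAt_pi_iff]
      intro i
      fun_prop
  · have hcont : Continuous fun z : ℂ => ∑ i, ‖z * (ξ i : ℂ)‖ := by fun_prop
    have h := hcont.tendsto 0
    simp only [zero_mul, norm_zero, Finset.sum_const_zero] at h
    filter_upwards [h.eventually_lt_const one_pos] with z hz
    exact ((hasSum_HATerm ha hb hz η).tsum_eq).symm

/-- Used to pull r² out of ρ: a power of r comes out in front, and κ turns into κ r², the sum of the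
ηₗ. -/
theorem radialSol_ofReal_mul (κ a : ℂ) {s z : ℝ} (hs : 0 ≤ s) (hz : 0 ≤ z) :
    radialSol κ a ((s * z : ℝ) : ℂ) = (s : ℂ) ^ (-a) * radialSol (κ * s) a z := by
  rw [radialSol, radialSol, Complex.ofReal_mul, Complex.mul_cpow_ofReal_nonneg hs hz, mul_assoc,
    mul_assoc κ]

/-! ### Calculus in coordinates -/

/-- The extension by zero of a family indexed by the first `n` coordinates. -/
def extendZero {n m : ℕ} (hnm : n ≤ m) (c : Fin n → ℝ) (i : Fin m) : ℝ :=
  ∑ j, if Fin.castLE hnm j = i then c j else 0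

section Coordinates

variable {n m : ℕ} (hnm : n ≤ m)

theorem extendZero_castLE (c : Fin n → ℝ) (j : Fin n) :
    extendZero hnm c (Fin.castLE hnm j) = c j := by
  simp [extendZero, (Fin.castLE_injective hnm).eq_iff]

theorem extendZero_eq_zero (c : Fin n → ℝ) {i : Fin m} (hi : ∀ j, Fin.castLE hnm j ≠ i) :
    extendZero hnm c i = 0 :=
  Finset.sum_eq_zero fun j _ => if_neg (hi j)

theorem sum_extendZero_mul {R : Type*} [CommRing R] [Algebra ℝ R] (c : Fin n → ℝ)
    (f : Fin m → R) :
    ∑ i, algebraMap ℝ R (extendZero hnm c i) * f i =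
      ∑ j, algebraMap ℝ R (c j) * f (Fin.castLE hnm j) := by
  simp only [extendZero, map_sum, Finset.sum_mul]
  rw [Finset.sum_comm]
  refine Finset.sum_congr rfl fun j _ => ?_
  rw [Finset.sum_eq_single (Fin.castLE hnm j)]
  · simp
  · intro i _ hi
    rw [if_neg (Ne.symm hi)]
    simp
  · simp

theorem continuous_extendZero {T : Type*} [TopologicalSpace T] {c : T → Fin n → ℝ}
    (hc : Continuous c) (i : Fin m) : Continuous fun t => extendZero hnm (c t) i := by
  refine continuous_finsetSum _ fun j _ => ?_
  split_ifs
  · fun_prop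
  · exact continuous_const

theorem isOpen_posDomain : IsOpen (posDomain hnm) := by
  simp only [posDomain, ofPred_forall]
  refine isOpen_iInter_of_finite fun j => isOpen_lt continuous_const ?_
  fun_prop

end Coordinates

/-- The measure is carried by the compact set K, so on a closed ball times K the derivative is
bounded by a constant, which is integrable and dominates. -/
theorem hasFDerivAt_integral_of_continuousOn {H T : Type*} [NormedAddCommGroup H]
    [NormedSpace ℝ H] [FiniteDimensional ℝ H] [TopologicalSpace T] [MeasurableSpace T]
    [OpensMeasurableSpace T] [T2Space T]
    [SecondCountableTopology T] {ν : Measure T} [IsFiniteMeasure ν] {K : Set T} (hK : IsCompact K)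
    (hν : ν.restrict K = ν) {U : Set H} (hU : IsOpen U) {F : H → T → ℂ} {F' : H → T → H →L[ℝ] ℂ}
    (hF : ContinuousOn (Function.uncurry F) (U ×ˢ K))
    (hF' : ContinuousOn (Function.uncurry F') (U ×ˢ K))
    (hd : ∀ x ∈ U, ∀ t ∈ K, HasFDerivAt (F · t) (F' x t) x) {x : H} (hx : x ∈ U) :
    HasFDerivAt (fun x => ∫ t, F x t ∂ν) (∫ t, F' x t ∂ν) x := by
  have : ProperSpace H := FiniteDimensional.proper ℝ H
  obtain ⟨r, hr, hrU⟩ := Metric.nhds_basis_closedBall.mem_iff.1 (hU.mem_nhds hx)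
  have hKm : MeasurableSet K := hK.isClosed.measurableSet
  obtain ⟨C, hC⟩ := ((isCompact_closedBall x r).prod hK).exists_bound_of_continuousOn
    (hF'.mono (prod_mono_left hrU))
  have hae : ∀ᵐ t ∂ν, t ∈ K := by
    rw [← hν]
    exact ae_restrict_mem hKm
  have hFc : ∀ y ∈ U, ContinuousOn (F y) K := fun y hy =>
    hF.comp (f := fun t => (y, t)) (by fun_prop) fun t ht => ⟨hy, ht⟩
  have hFc' : ContinuousOn (F' x) K :=
    hF'.comp (f := fun t => (x, t)) (by fun_prop) fun t ht => ⟨hx, ht⟩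
  refine hasFDerivAt_integral_of_dominated_of_fderiv_le (𝕜 := ℝ) (F := F) (F' := F')
    (bound := fun _ => C) (Metric.closedBall_mem_nhds x hr) ?_ ?_ ?_ ?_ (integrable_const C) ?_
  · filter_upwards [hU.mem_nhds hx] with y hy
    rw [← hν]
    exact (hFc y hy).aestronglyMeasurable hKm
  · rw [← hν]
    exact (hFc x hx).integrableOn_compact hK
  · rw [← hν]
    exact hFc'.aestronglyMeasurable hKm
  · filter_upwards [hae] with t ht y hy using hC (y, t) ⟨hy, ht⟩
  · filter_upwards [hae] with t ht y hy using hd y (hrU hy) t ht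

/-! ### Derivatives of the integral of a radial solution -/

section Rho

variable {n m : ℕ} (hnm : n ≤ m) (x₀ : EuclideanSpace ℝ (Fin m))

/-- The quadratic polynomial `r² + ∑ⱼ 4 tⱼ xⱼ x₀ⱼ = (1 - ∑ⱼ tⱼ) r² + ∑ⱼ tⱼ rⱼ²`. -/
def rho (x : EuclideanSpace ℝ (Fin m)) (t : Fin n → ℝ) : ℝ :=
  rSq x₀ x + ∑ j, t j * (4 * x (Fin.castLE hnm j) * x₀ (Fin.castLE hnm j))

/-- The derivative of `rho` in the direction of the `i`-th coordinate. -/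
def rhoDeriv (x : EuclideanSpace ℝ (Fin m)) (t : Fin n → ℝ) (i : Fin m) : ℝ :=
  2 * (x i - x₀ i) + extendZero hnm (fun j => 4 * t j * x₀ (Fin.castLE hnm j)) i

theorem rho_eq_sum (x : EuclideanSpace ℝ (Fin m)) (t : Fin n → ℝ) :
    rho hnm x₀ x t =
      ∑ i, ((x i - x₀ i) ^ 2 + extendZero hnm (fun j => 4 * t j * x₀ (Fin.castLE hnm j)) i * x i) := by
  rw [rho, Finset.sum_add_distrib, rSq]
  congr 1
  have := sum_extendZero_mul hnm (fun j => 4 * t j * x₀ (Fin.castLE hnm j)) (fun i => x i)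
  simp only [Algebra.algebraMap_self, RingHom.id_apply] at this
  rw [this]
  exact Finset.sum_congr rfl fun j _ => by ring

theorem hasFDerivAt_rho (x : EuclideanSpace ℝ (Fin m)) (t : Fin n → ℝ) :
    HasFDerivAt (fun x => rho hnm x₀ x t)
      (∑ i, rhoDeriv hnm x₀ x t i • EuclideanSpace.proj (𝕜 := ℝ) i) x := by
  simp only [rho_eq_sum]
  refine HasFDerivAt.fun_sum fun i _ => ?_
  have h1 : HasFDerivAt (fun x : EuclideanSpace ℝ (Fin m) => x i)
      (EuclideanSpace.proj (𝕜 := ℝ) i) x := (EuclideanSpace.proj (𝕜 := ℝ) i).hasFDerivAt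
  have h2 := ((h1.sub_const (x₀ i)).pow 2).add
    (h1.const_mul (extendZero hnm (fun j => 4 * t j * x₀ (Fin.castLE hnm j)) i))
  refine h2.congr_fderiv ?_
  ext v
  simp [rhoDeriv]
  ring

theorem continuous_rho : Continuous fun q : EuclideanSpace ℝ (Fin m) × (Fin n → ℝ) =>
    rho hnm x₀ q.1 q.2 := by
  unfold rho rSq
  fun_prop

theorem continuous_rSq : Continuous (rSq x₀) := by
  unfold rSq
  fun_prop

theorem continuous_rhoDeriv (i : Fin m) :
    Continuous fun q : EuclideanSpace ℝ (Fin m) × (Fin n → ℝ) => rhoDeriv hnm x₀ q.1 q.2 i := by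
  refine Continuous.add (by fun_prop) (continuous_extendZero hnm ?_ i)
  fun_prop

theorem rSq_nonneg (x : EuclideanSpace ℝ (Fin m)) : 0 ≤ rSq x₀ x :=
  Finset.sum_nonneg fun _ _ => sq_nonneg _

theorem rSq_eq_norm_sq (x : EuclideanSpace ℝ (Fin m)) : rSq x₀ x = ‖x - x₀‖ ^ 2 := by
  simp [EuclideanSpace.norm_sq_eq, rSq]

theorem rSq_pos {x : EuclideanSpace ℝ (Fin m)} (hx : x ≠ x₀) : 0 < rSq x₀ x := by
  rw [rSq_eq_norm_sq]
  have := norm_pos_iff.2 (sub_ne_zero.2 hx)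
  positivity

variable {x₀}

theorem rSq_le_rho (hx₀ : x₀ ∈ posDomain hnm) {x : EuclideanSpace ℝ (Fin m)}
    (hx : x ∈ posDomain hnm) {t : Fin n → ℝ} (ht : t ∈ Icc (0 : Fin n → ℝ) 1) :
    rSq x₀ x ≤ rho hnm x₀ x t := by
  refine le_add_of_nonneg_right (Finset.sum_nonneg fun j _ => ?_)
  have := hx j
  have := hx₀ j
  have := ht.1 j
  simp only [Pi.zero_apply] at this
  positivity

/-- The part of the domain where `r² + ε` does not vanish. -/
def regDomain (x₀ : EuclideanSpace ℝ (Fin m)) (ε : ℝ) : Set (EuclideanSpace ℝ (Fin m)) :=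
  {x | x ∈ posDomain hnm ∧ 0 < rSq x₀ x + ε}

theorem isOpen_regDomain (ε : ℝ) : IsOpen (regDomain hnm x₀ ε) :=
  (isOpen_posDomain hnm).inter
    (isOpen_lt continuous_const ((continuous_rSq x₀).add continuous_const))

theorem rho_add_pos (hx₀ : x₀ ∈ posDomain hnm) {ε : ℝ} {x : EuclideanSpace ℝ (Fin m)}
    (hx : x ∈ regDomain hnm x₀ ε) {t : Fin n → ℝ} (ht : t ∈ Icc (0 : Fin n → ℝ) 1) :
    0 < rho hnm x₀ x t + ε := by
  linarith [rSq_le_rho hnm hx₀ hx.1 ht, hx.2]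

theorem continuousOn_radialSol_rho (hx₀ : x₀ ∈ posDomain hnm) (ε : ℝ) (κ : ℂ) {c : ℂ}
    (hc : c ∈ Complex.integerComplement) :
    ContinuousOn (fun q : EuclideanSpace ℝ (Fin m) × (Fin n → ℝ) =>
      radialSol κ c ((rho hnm x₀ q.1 q.2 + ε : ℝ) : ℂ)) (regDomain hnm x₀ ε ×ˢ Icc 0 1) := by
  intro q hq
  have h1 : ContinuousAt (radialSol κ c) ((rho hnm x₀ q.1 q.2 + ε : ℝ) : ℂ) :=
    (hasDerivAt_radialSol κ hc
      (Complex.ofReal_mem_slitPlane.2 (rho_add_pos hnm hx₀ hq.1 hq.2))).continuousAt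
  refine (ContinuousAt.comp (f := fun q : EuclideanSpace ℝ (Fin m) × (Fin n → ℝ) =>
    ((rho hnm x₀ q.1 q.2 + ε : ℝ) : ℂ)) h1 (Continuous.continuousAt ?_)).continuousWithinAt
  exact Complex.continuous_ofReal.comp ((continuous_rho hnm x₀).add continuous_const)

theorem hasFDerivAt_radialSol_rho (hx₀ : x₀ ∈ posDomain hnm) {ε : ℝ} (κ : ℂ) {c : ℂ}
    (hc : c ∈ Complex.integerComplement) {x : EuclideanSpace ℝ (Fin m)}
    (hx : x ∈ regDomain hnm x₀ ε) {t : Fin n → ℝ} (ht : t ∈ Icc (0 : Fin n → ℝ) 1) :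
    HasFDerivAt (fun x => radialSol κ c ((rho hnm x₀ x t + ε : ℝ) : ℂ))
      (-radialSol κ (c + 1) ((rho hnm x₀ x t + ε : ℝ) : ℂ) •
        (Complex.ofRealCLM.comp (∑ i, rhoDeriv hnm x₀ x t i • EuclideanSpace.proj (𝕜 := ℝ) i)))
      x := by
  have h1 := (hasDerivAt_radialSol κ hc
    (Complex.ofReal_mem_slitPlane.2 (rho_add_pos hnm hx₀ hx ht))).complexToReal_fderiv'
  have h2 := Complex.ofRealCLM.hasFDerivAt.comp x ((hasFDerivAt_rho hnm x₀ x t).add_const ε)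
  have h3 := HasFDerivAt.comp x h1 h2
  refine h3.congr_fderiv ?_
  ext v
  simp [Finset.mul_sum, mul_comm, mul_left_comm]

/-- The integral of a radial solution at `ρ + ε`. -/
def rhoIntegral (x₀ : EuclideanSpace ℝ (Fin m)) (ε : ℝ) (κ c : ℂ) (b : Fin n → ℝ)
    (x : EuclideanSpace ℝ (Fin m)) : ℂ :=
  ∫ t, radialSol κ c ((rho hnm x₀ x t + ε : ℝ) : ℂ) ∂(betaProd b)

end Rho

theorem HasFDerivAt.pd_eq {m : ℕ} {f : EuclideanSpace ℝ (Fin m) → ℂ}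
    {f' : EuclideanSpace ℝ (Fin m) →L[ℝ] ℂ} {x : EuclideanSpace ℝ (Fin m)}
    (h : HasFDerivAt f f' x) (i : Fin m) : pd i f x = f' (EuclideanSpace.single i 1) := by
  rw [pd, h.fderiv]

theorem pd_integral_betaProd {n m : ℕ} {b : Fin n → ℝ} (hb : ∀ i, 0 < b i)
    {U : Set (EuclideanSpace ℝ (Fin m))} (hU : IsOpen U)
    {F : EuclideanSpace ℝ (Fin m) → (Fin n → ℝ) → ℂ}
    {F' : EuclideanSpace ℝ (Fin m) → (Fin n → ℝ) → EuclideanSpace ℝ (Fin m) →L[ℝ] ℂ}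
    (hF : ContinuousOn (Function.uncurry F) (U ×ˢ Icc 0 1))
    (hF' : ContinuousOn (Function.uncurry F') (U ×ˢ Icc 0 1))
    (hd : ∀ x ∈ U, ∀ t ∈ Icc (0 : Fin n → ℝ) 1, HasFDerivAt (F · t) (F' x t) x)
    {x : EuclideanSpace ℝ (Fin m)} (hx : x ∈ U) (i : Fin m) :
    pd i (fun x => ∫ t, F x t ∂(betaProd b)) x =
      ∫ t, F' x t (EuclideanSpace.single i 1) ∂(betaProd b) := by
  have := isProbabilityMeasure_betaProd hb
  have h := hasFDerivAt_integral_of_continuousOn isCompact_Icc (restrict_Icc_betaProd hb) hU hF hF'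
    hd hx
  rw [h.pd_eq, ContinuousLinearMap.integral_apply]
  refine integrable_betaProd_of_continuousOn hb ?_
  exact hF'.comp (f := fun t => (x, t)) (by fun_prop) fun t ht => ⟨hx, ht⟩

theorem sum_smul_proj_single {m : ℕ} (c : Fin m → ℝ) (i : Fin m) :
    (∑ k, c k • EuclideanSpace.proj (𝕜 := ℝ) k : EuclideanSpace ℝ (Fin m) →L[ℝ] ℝ)
      (EuclideanSpace.single i 1) = c i := by
  simp

theorem proj_single_self {m : ℕ} (i : Fin m) :
    (EuclideanSpace.proj (𝕜 := ℝ) i : EuclideanSpace ℝ (Fin m) →L[ℝ] ℝ)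
      (EuclideanSpace.single i 1) = 1 := by
  simp

theorem add_one_mem_integerComplement {b : ℂ} (hb : b ∈ Complex.integerComplement) :
    b + 1 ∈ Complex.integerComplement := by
  simpa using (Complex.add_intCast_mem_integerComplement (x := b) 1).2 hb

section Rho

variable {n m : ℕ} (hnm : n ≤ m) {x₀ : EuclideanSpace ℝ (Fin m)}

theorem continuous_rhoFDeriv : Continuous fun q : EuclideanSpace ℝ (Fin m) × (Fin n → ℝ) =>
    Complex.ofRealCLM.comp (∑ i, rhoDeriv hnm x₀ q.1 q.2 i •
      (EuclideanSpace.proj (𝕜 := ℝ) i : EuclideanSpace ℝ (Fin m) →L[ℝ] ℝ)) := by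
  refine continuous_const.clm_comp (continuous_finsetSum _ fun i _ => ?_)
  exact (continuous_rhoDeriv hnm x₀ i).smul continuous_const

theorem pd_rhoIntegral (hx₀ : x₀ ∈ posDomain hnm) {ε : ℝ} (κ : ℂ) {c : ℂ}
    (hc : c ∈ Complex.integerComplement) {b : Fin n → ℝ} (hb : ∀ i, 0 < b i)
    {x : EuclideanSpace ℝ (Fin m)} (hx : x ∈ regDomain hnm x₀ ε) (i : Fin m) :
    pd i (rhoIntegral hnm x₀ ε κ c b) x =
      ∫ t, -radialSol κ (c + 1) ((rho hnm x₀ x t + ε : ℝ) : ℂ) * (rhoDeriv hnm x₀ x t i : ℂ)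
        ∂(betaProd b) := by
  have h := pd_integral_betaProd hb (isOpen_regDomain hnm ε)
    (F := fun x t => radialSol κ c ((rho hnm x₀ x t + ε : ℝ) : ℂ))
    (F' := fun x t => -radialSol κ (c + 1) ((rho hnm x₀ x t + ε : ℝ) : ℂ) •
        (Complex.ofRealCLM.comp (∑ i, rhoDeriv hnm x₀ x t i • EuclideanSpace.proj (𝕜 := ℝ) i)))
    (continuousOn_radialSol_rho hnm hx₀ ε κ hc)
    (((continuousOn_radialSol_rho hnm hx₀ ε κ (add_one_mem_integerComplement hc)).neg).smul
      (continuous_rhoFDeriv hnm (x₀ := x₀)).continuousOn)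
    (fun x hx t ht => hasFDerivAt_radialSol_rho hnm hx₀ κ hc hx ht) hx i
  refine h.trans (integral_congr_ae (ae_of_all _ fun t => ?_))
  simp only [smul_apply, ContinuousLinearMap.comp_apply, sum_smul_proj_single,
    smul_eq_mul, Complex.ofRealCLM_apply]

theorem hasFDerivAt_rhoDeriv (x : EuclideanSpace ℝ (Fin m)) (t : Fin n → ℝ) (i : Fin m) :
    HasFDerivAt (fun x => rhoDeriv hnm x₀ x t i)
      ((2 : ℝ) • EuclideanSpace.proj (𝕜 := ℝ) i) x := by
  have h1 : HasFDerivAt (fun x : EuclideanSpace ℝ (Fin m) => x i)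
      (EuclideanSpace.proj (𝕜 := ℝ) i) x := (EuclideanSpace.proj (𝕜 := ℝ) i).hasFDerivAt
  exact ((h1.sub_const (x₀ i)).const_mul 2).add_const _

theorem pd_pd_rhoIntegral (hx₀ : x₀ ∈ posDomain hnm) {ε : ℝ} (κ : ℂ) {c : ℂ}
    (hc : c ∈ Complex.integerComplement) {b : Fin n → ℝ} (hb : ∀ i, 0 < b i)
    {x : EuclideanSpace ℝ (Fin m)} (hx : x ∈ regDomain hnm x₀ ε) (i : Fin m) :
    pd i (pd i (rhoIntegral hnm x₀ ε κ c b)) x =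
      ∫ t, (radialSol κ (c + 1 + 1) ((rho hnm x₀ x t + ε : ℝ) : ℂ) * (rhoDeriv hnm x₀ x t i : ℂ) ^ 2
        - 2 * radialSol κ (c + 1) ((rho hnm x₀ x t + ε : ℝ) : ℂ)) ∂(betaProd b) := by
  have hc1 := add_one_mem_integerComplement hc
  have hc2 := add_one_mem_integerComplement hc1
  have hev : pd i (rhoIntegral hnm x₀ ε κ c b) =ᶠ[𝓝 x] fun x =>
      ∫ t, -radialSol κ (c + 1) ((rho hnm x₀ x t + ε : ℝ) : ℂ) * (rhoDeriv hnm x₀ x t i : ℂ)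
        ∂(betaProd b) := by
    filter_upwards [(isOpen_regDomain hnm ε).mem_nhds hx] with y hy
    exact pd_rhoIntegral hnm hx₀ κ hc hb hy i
  rw [pd, hev.fderiv_eq, ← pd]
  have hdc : Continuous fun q : EuclideanSpace ℝ (Fin m) × (Fin n → ℝ) =>
      (rhoDeriv hnm x₀ q.1 q.2 i : ℂ) :=
    Complex.continuous_ofReal.comp (continuous_rhoDeriv hnm x₀ i)
  have hc1c := continuousOn_radialSol_rho hnm hx₀ ε κ hc1
  have h := pd_integral_betaProd hb (isOpen_regDomain hnm ε)
    (F := fun x t => -radialSol κ (c + 1) ((rho hnm x₀ x t + ε : ℝ) : ℂ) *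
      (rhoDeriv hnm x₀ x t i : ℂ))
    (F' := fun x t => -radialSol κ (c + 1) ((rho hnm x₀ x t + ε : ℝ) : ℂ) •
        (Complex.ofRealCLM.comp ((2 : ℝ) • EuclideanSpace.proj (𝕜 := ℝ) i)) +
      (rhoDeriv hnm x₀ x t i : ℂ) •
        -(-radialSol κ (c + 1 + 1) ((rho hnm x₀ x t + ε : ℝ) : ℂ) •
        (Complex.ofRealCLM.comp (∑ i, rhoDeriv hnm x₀ x t i • EuclideanSpace.proj (𝕜 := ℝ) i))))
    (hc1c.neg.mul hdc.continuousOn)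
    ((hc1c.neg.smul continuousOn_const).add (hdc.continuousOn.smul
      (((continuousOn_radialSol_rho hnm hx₀ ε κ hc2).neg).smul
        (continuous_rhoFDeriv hnm (x₀ := x₀)).continuousOn).neg))
    (fun x hx t ht => (hasFDerivAt_radialSol_rho hnm hx₀ κ hc1 hx ht).neg.mul
      (Complex.ofRealCLM.hasFDerivAt.comp x (hasFDerivAt_rhoDeriv hnm x t i))) hx i
  refine h.trans (integral_congr_ae (ae_of_all _ fun t => ?_))
  simp only [add_apply, neg_apply,
    smul_apply, ContinuousLinearMap.comp_apply,
    sum_smul_proj_single, smul_eq_mul, Complex.ofRealCLM_apply, proj_single_self]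
  push_cast
  ring

theorem continuousOn_radialSol_rho_right (hx₀ : x₀ ∈ posDomain hnm) {ε : ℝ} (κ : ℂ) {c : ℂ}
    (hc : c ∈ Complex.integerComplement) {x : EuclideanSpace ℝ (Fin m)}
    (hx : x ∈ regDomain hnm x₀ ε) :
    ContinuousOn (fun t : Fin n → ℝ => radialSol κ c ((rho hnm x₀ x t + ε : ℝ) : ℂ)) (Icc 0 1) :=
  (continuousOn_radialSol_rho hnm hx₀ ε κ hc).comp (f := fun t => (x, t)) (by fun_prop)
    fun _ ht => ⟨hx, ht⟩

/-- Integration by parts in tⱼ against the beta weight, applied to -F_c(ρ + ε); ρ is affine in tⱼ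
with slope 4 xⱼ x₀ⱼ. -/
theorem integral_rho_divergence (hx₀ : x₀ ∈ posDomain hnm) {ε : ℝ} (κ : ℂ) {c : ℂ}
    (hc : c ∈ Complex.integerComplement) {b : Fin n → ℝ} (hb : ∀ i, 0 < b i)
    {x : EuclideanSpace ℝ (Fin m)} (hx : x ∈ regDomain hnm x₀ ε) (j : Fin n) :
    ∫ t, ((t j * (1 - t j) : ℝ) *
        (radialSol κ (c + 1) ((rho hnm x₀ x t + ε : ℝ) : ℂ) *
          ((4 * x (Fin.castLE hnm j) * x₀ (Fin.castLE hnm j) : ℝ) : ℂ)) +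
      (b j * (1 - 2 * t j) : ℝ) * -radialSol κ c ((rho hnm x₀ x t + ε : ℝ) : ℂ)) ∂(betaProd b) =
        0 := by
  refine integral_betaProd_deriv_eq_zero hb j
    (continuousOn_radialSol_rho_right hnm hx₀ κ hc hx).neg
    ((continuousOn_radialSol_rho_right hnm hx₀ κ (add_one_mem_integerComplement hc) hx).mul
      continuousOn_const) fun t ht => ?_
  set y : ℝ := 4 * x (Fin.castLE hnm j) * x₀ (Fin.castLE hnm j) with hy
  have hupd : ∀ s : ℝ, rho hnm x₀ x (Function.update t j s) = rho hnm x₀ x t + (s - t j) * y := by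
    intro s
    simp only [rho]
    rw [add_assoc, ← Finset.add_sum_erase _ _ (Finset.mem_univ j),
      ← Finset.add_sum_erase _ (fun j => t j * _) (Finset.mem_univ j), Function.update_self,
      Finset.sum_congr rfl fun i hi => by
        rw [Function.update_of_ne (Finset.ne_of_mem_erase hi)]]
    ring
  have h1 : HasDerivAt (fun s : ℝ => rho hnm x₀ x (Function.update t j s) + ε) y (t j) := by
    simp only [hupd]
    have := ((((hasDerivAt_id (t j)).sub_const (t j)).mul_const y).const_add
      (rho hnm x₀ x t)).add_const ε
    simpa using this
  have h2 := (hasDerivAt_radialSol κ hc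
    (Complex.ofReal_mem_slitPlane.2 (rho_add_pos hnm hx₀ hx ht)))
  have h3 := HasDerivAt.comp (t j) (h₂ := radialSol κ c)
    (h := fun s : ℝ => ((rho hnm x₀ x (Function.update t j s) + ε : ℝ) : ℂ))
    (by simpa using h2) h1.ofReal_comp
  refine h3.neg.congr_deriv ?_
  simp

/-- The operator in terms of sums over all coordinates. -/
theorem helmholtzOp_eq {p : ℕ} (α : Fin n → ℝ) (lam : Fin p → ℂ)
    (u : EuclideanSpace ℝ (Fin m) → ℂ) (x : EuclideanSpace ℝ (Fin m)) :
    helmholtzOp hnm α lam u x = ∑ i, (pd i (pd i u) x +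
      ((2 * extendZero hnm α i / x i : ℝ) : ℂ) * pd i u x) - (∑ k, lam k ^ 2) * u x := by
  rw [helmholtzOp, Finset.sum_add_distrib]
  congr 2
  have := sum_extendZero_mul hnm α (R := ℂ) (fun i => ((2 / x i : ℝ) : ℂ) * pd i u x)
  simp only [Complex.coe_algebraMap, ← mul_assoc, ← Complex.ofReal_mul] at this
  convert this.symm using 5 <;> ring

end Rho

/-! ### The equation for the regularised integral -/

section Rho

variable {n m : ℕ} (hnm : n ≤ m) {x₀ : EuclideanSpace ℝ (Fin m)}

theorem sum_extendZero_mul_real (c : Fin n → ℝ) (f : Fin m → ℝ) :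
    ∑ i, extendZero hnm c i * f i = ∑ j, c j * f (Fin.castLE hnm j) := by
  simpa using sum_extendZero_mul hnm c f

/-- In the coordinate j the square (2(xⱼ - x₀ⱼ) + 4tⱼx₀ⱼ)² is 4(xⱼ - x₀ⱼ)² + 16tⱼxⱼx₀ⱼ - 16tⱼ(1 -
tⱼ)x₀ⱼ². The defect has the factor tⱼ(1 - tⱼ) of the divergence identity. -/
theorem sum_rhoDeriv_sq (x : EuclideanSpace ℝ (Fin m)) (t : Fin n → ℝ) :
    ∑ i, rhoDeriv hnm x₀ x t i ^ 2 = 4 * rho hnm x₀ x t -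
      ∑ j, 16 * (t j * (1 - t j)) * x₀ (Fin.castLE hnm j) ^ 2 := by
  have h1 : ∀ i, rhoDeriv hnm x₀ x t i ^ 2 = 4 * (x i - x₀ i) ^ 2 +
      extendZero hnm (fun j => 4 * t j * x₀ (Fin.castLE hnm j)) i *
        (4 * (x i - x₀ i) + extendZero hnm (fun j => 4 * t j * x₀ (Fin.castLE hnm j)) i) :=
    fun i => by rw [rhoDeriv]; ring
  simp only [h1]
  rw [Finset.sum_add_distrib, sum_extendZero_mul_real hnm _ (fun i => 4 * (x i - x₀ i) +
    extendZero hnm (fun j => 4 * t j * x₀ (Fin.castLE hnm j)) i), ← Finset.mul_sum, rho, mul_add,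
    add_sub_assoc, Finset.mul_sum Finset.univ (fun j => t j * _), ← Finset.sum_sub_distrib]
  congr 1
  refine Finset.sum_congr rfl fun j _ => ?_
  simp only [extendZero_castLE]
  ring

/-- The part that is singular in xⱼ has the factor bⱼ(1 - 2tⱼ), the other half of the divergence
identity; it pairs with the defect in |∇ρ|². -/
theorem sum_extendZero_div_mul_rhoDeriv {x : EuclideanSpace ℝ (Fin m)} (hx : x ∈ posDomain hnm)
    (t b : Fin n → ℝ) :
    ∑ i, 2 * extendZero hnm b i / x i * rhoDeriv hnm x₀ x t i = 4 * ∑ j, b j -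
      ∑ j, 4 * x₀ (Fin.castLE hnm j) / x (Fin.castLE hnm j) * (b j * (1 - 2 * t j)) := by
  have h1 : ∀ i, 2 * extendZero hnm b i / x i * rhoDeriv hnm x₀ x t i =
      extendZero hnm b i * (2 / x i * rhoDeriv hnm x₀ x t i) := fun i => by ring
  simp only [h1]
  rw [sum_extendZero_mul_real hnm b (fun i => 2 / x i * rhoDeriv hnm x₀ x t i), Finset.mul_sum,
    ← Finset.sum_sub_distrib]
  refine Finset.sum_congr rfl fun j _ => ?_
  have hxj : x (Fin.castLE hnm j) ≠ 0 := (hx j).ne'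
  simp only [rhoDeriv, extendZero_castLE]
  field_simp
  ring

/-- Modulo the t-divergences the operator yields 4ρ F_{a+2} - (2m + 4 ∑ bⱼ) F_{a+1} + 4κ F_a. The
value of a makes the middle coefficient 4(a + 1), so the recurrence at ρ + ε cancels everything
except -4ε F_{a+2}. -/
theorem helmholtzOp_rhoIntegral {p : ℕ} (hx₀ : x₀ ∈ posDomain hnm) {ε : ℝ} {κ a : ℂ}
    (ha : a ∈ Complex.integerComplement) {b : Fin n → ℝ} (hb : ∀ i, 0 < b i)
    (hab : a = ((m / 2 - 1 + ∑ j, b j : ℝ) : ℂ)) {lam : Fin p → ℂ}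
    (hκ : ∑ k, lam k ^ 2 = -4 * κ)
    {x : EuclideanSpace ℝ (Fin m)} (hx : x ∈ regDomain hnm x₀ ε) :
    helmholtzOp hnm b lam (rhoIntegral hnm x₀ ε κ a b) x =
      -4 * ε * rhoIntegral hnm x₀ ε κ (a + 1 + 1) b x := by
  have ha1 := add_one_mem_integerComplement ha
  have ha2 := add_one_mem_integerComplement ha1
  set Ψ : ℂ → (Fin n → ℝ) → ℂ := fun c t => radialSol κ c ((rho hnm x₀ x t + ε : ℝ) : ℂ) with hΨ
  have hc : ∀ {c}, c ∈ Complex.integerComplement → ContinuousOn (Ψ c) (Icc 0 1) := fun hc =>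
    continuousOn_radialSol_rho_right hnm hx₀ κ hc hx
  have hI := fun {f : (Fin n → ℝ) → ℂ} => integrable_betaProd_of_continuousOn (f := f) hb
  have hd : ∀ i, Continuous fun t : Fin n → ℝ => (rhoDeriv hnm x₀ x t i : ℂ) := fun i =>
    Complex.continuous_ofReal.comp ((continuous_rhoDeriv hnm x₀ i).comp
      (continuous_const.prodMk continuous_id))
  have h1 := hc ha1
  have h2 := hc ha2
  have hA : ∀ i, ContinuousOn (fun t => Ψ (a + 1 + 1) t * (rhoDeriv hnm x₀ x t i : ℂ) ^ 2
        - 2 * Ψ (a + 1) t) (Icc 0 1) := fun i =>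
    (h2.mul ((hd i).pow 2).continuousOn).sub (continuousOn_const.mul h1)
  have hB : ∀ i, ContinuousOn (fun t => ((2 * extendZero hnm b i / x i : ℝ) : ℂ) *
      (-Ψ (a + 1) t * (rhoDeriv hnm x₀ x t i : ℂ))) (Icc 0 1) := fun i =>
    continuousOn_const.mul (h1.neg.mul (hd i).continuousOn)
  rw [helmholtzOp_eq]
  simp only [pd_pd_rhoIntegral hnm hx₀ κ ha hb hx, pd_rhoIntegral hnm hx₀ κ ha hb hx]
  rw [rhoIntegral, rhoIntegral]
  change ∑ i, ((∫ t, (Ψ (a + 1 + 1) t * (rhoDeriv hnm x₀ x t i : ℂ) ^ 2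
        - 2 * Ψ (a + 1) t) ∂(betaProd b)) + ((2 * extendZero hnm b i / x i : ℝ) : ℂ) *
        ∫ t, -Ψ (a + 1) t * (rhoDeriv hnm x₀ x t i : ℂ) ∂(betaProd b)) -
        (∑ k, lam k ^ 2) * ∫ t, Ψ a t ∂(betaProd b) = -4 * ε * ∫ t, Ψ (a + 1 + 1) t ∂(betaProd b)
  -- The factor 4x₀ⱼ/xⱼ turns the slope 4xⱼx₀ⱼ into 16x₀ⱼ², the coefficient of the defect in |∇ρ|².
  have hdiv : ∀ j, ∫ t, ((4 * x₀ (Fin.castLE hnm j) / x (Fin.castLE hnm j) : ℝ) : ℂ) *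
      ((t j * (1 - t j) : ℝ) * (Ψ (a + 1 + 1) t *
          ((4 * x (Fin.castLE hnm j) * x₀ (Fin.castLE hnm j) : ℝ) : ℂ)) +
      (b j * (1 - 2 * t j) : ℝ) * -Ψ (a + 1) t) ∂(betaProd b) = 0 := fun j => by
    rw [integral_const_mul]
    exact mul_eq_zero_of_right _ (integral_rho_divergence hnm hx₀ κ ha1 hb hx j)
  have hD : ∀ j, ContinuousOn (fun t : Fin n → ℝ =>
      ((4 * x₀ (Fin.castLE hnm j) / x (Fin.castLE hnm j) : ℝ) : ℂ) *
      ((t j * (1 - t j) : ℝ) * (Ψ (a + 1 + 1) t *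
          ((4 * x (Fin.castLE hnm j) * x₀ (Fin.castLE hnm j) : ℝ) : ℂ)) +
      (b j * (1 - 2 * t j) : ℝ) * -Ψ (a + 1) t)) (Icc 0 1) := fun j => by
    refine continuousOn_const.mul (ContinuousOn.add (ContinuousOn.mul ?_
      (h2.mul continuousOn_const)) (ContinuousOn.mul ?_ h1.neg)) <;>
    exact (Complex.continuous_ofReal.comp (by fun_prop)).continuousOn
  have hAB : ∀ i, ContinuousOn (fun t => Ψ (a + 1 + 1) t * (rhoDeriv hnm x₀ x t i : ℂ) ^ 2
        - 2 * Ψ (a + 1) t + ((2 * extendZero hnm b i / x i : ℝ) : ℂ) *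
        (-Ψ (a + 1) t * (rhoDeriv hnm x₀ x t i : ℂ))) (Icc 0 1) := fun i => (hA i).add (hB i)
  simp only [← integral_const_mul]
  have e1 : ∀ i, (∫ t, (Ψ (a + 1 + 1) t * (rhoDeriv hnm x₀ x t i : ℂ) ^ 2
        - 2 * Ψ (a + 1) t) ∂(betaProd b)) + ∫ t, ((2 * extendZero hnm b i / x i : ℝ) : ℂ) *
        (-Ψ (a + 1) t * (rhoDeriv hnm x₀ x t i : ℂ)) ∂(betaProd b) =
      ∫ t, (Ψ (a + 1 + 1) t * (rhoDeriv hnm x₀ x t i : ℂ) ^ 2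
        - 2 * Ψ (a + 1) t + ((2 * extendZero hnm b i / x i : ℝ) : ℂ) *
        (-Ψ (a + 1) t * (rhoDeriv hnm x₀ x t i : ℂ))) ∂(betaProd b) := fun i =>
    (integral_add (hI (hA i)) (hI (hB i))).symm
  simp only [e1]
  rw [← integral_finsetSum _ fun i _ => hI (hAB i),
    ← integral_sub (integrable_finsetSum _ fun i _ => hI (hAB i))
      ((hI (hc ha)).const_mul _)]
  -- Divergences of integral zero are subtracted on the right, after which the two integrands agree
  -- pointwise in t.
  have e2 : ∫ t, -4 * (ε : ℂ) * Ψ (a + 1 + 1) t ∂(betaProd b) =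
      ∫ t, (-4 * (ε : ℂ) * Ψ (a + 1 + 1) t - ∑ j,
      ((4 * x₀ (Fin.castLE hnm j) / x (Fin.castLE hnm j) : ℝ) : ℂ) *
      ((t j * (1 - t j) : ℝ) * (Ψ (a + 1 + 1) t *
          ((4 * x (Fin.castLE hnm j) * x₀ (Fin.castLE hnm j) : ℝ) : ℂ)) +
      (b j * (1 - 2 * t j) : ℝ) * -Ψ (a + 1) t)) ∂(betaProd b) := by
    rw [integral_sub ((hI h2).const_mul _) (integrable_finsetSum _ fun j _ => hI (hD j)),
      integral_finsetSum _ fun j _ => hI (hD j)]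
    simp only [hdiv, Finset.sum_const_zero, sub_zero]
  rw [e2]
  refine integral_congr_ae ?_
  filter_upwards [ae_betaProd_mem_Icc hb] with t ht
  have hpos := rho_add_pos hnm hx₀ hx ht
  have hrec := radialSol_add_two κ ha (z := ((rho hnm x₀ x t + ε : ℝ) : ℂ))
    (Complex.ofReal_ne_zero.2 hpos.ne')
  have hrec' : ((rho hnm x₀ x t + ε : ℝ) : ℂ) * Ψ (a + 1 + 1) t =
      (a + 1) * Ψ (a + 1) t - κ * Ψ a t := by
    rw [show a + 2 = a + 1 + 1 by ring] at hrec
    exact hrec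
  have s1 : ∑ i, (rhoDeriv hnm x₀ x t i : ℂ) ^ 2 = ((4 * rho hnm x₀ x t -
      ∑ j, 16 * (t j * (1 - t j)) * x₀ (Fin.castLE hnm j) ^ 2 : ℝ) : ℂ) := by
    rw [← sum_rhoDeriv_sq]
    push_cast
    rfl
  have s2 : ∑ i, ((2 * extendZero hnm b i / x i : ℝ) : ℂ) * (rhoDeriv hnm x₀ x t i : ℂ) =
      ((4 * ∑ j, b j - ∑ j, 4 * x₀ (Fin.castLE hnm j) / x (Fin.castLE hnm j) *
        (b j * (1 - 2 * t j)) : ℝ) : ℂ) := by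
    rw [← sum_extendZero_div_mul_rhoDeriv hnm hx.1]
    push_cast
    rfl
  have s3 : ∑ i, (Ψ (a + 1 + 1) t * (rhoDeriv hnm x₀ x t i : ℂ) ^ 2
        - 2 * Ψ (a + 1) t + ((2 * extendZero hnm b i / x i : ℝ) : ℂ) *
        (-Ψ (a + 1) t * (rhoDeriv hnm x₀ x t i : ℂ))) =
      Ψ (a + 1 + 1) t * ∑ i, (rhoDeriv hnm x₀ x t i : ℂ) ^ 2 - 2 * m * Ψ (a + 1) t -
        Ψ (a + 1) t *
          ∑ i, ((2 * extendZero hnm b i / x i : ℝ) : ℂ) * (rhoDeriv hnm x₀ x t i : ℂ) := by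
    have : ∀ i, Ψ (a + 1 + 1) t * (rhoDeriv hnm x₀ x t i : ℂ) ^ 2
        - 2 * Ψ (a + 1) t + ((2 * extendZero hnm b i / x i : ℝ) : ℂ) *
        (-Ψ (a + 1) t * (rhoDeriv hnm x₀ x t i : ℂ)) =
        Ψ (a + 1 + 1) t * (rhoDeriv hnm x₀ x t i : ℂ) ^ 2 - 2 * Ψ (a + 1) t -
        Ψ (a + 1) t * (((2 * extendZero hnm b i / x i : ℝ) : ℂ) * (rhoDeriv hnm x₀ x t i : ℂ)) :=
      fun i => by ring
    simp only [this, Finset.sum_sub_distrib, ← Finset.mul_sum, Finset.sum_const, Finset.card_univ,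
      Fintype.card_fin, nsmul_eq_mul]
    ring
  have s4 : ∑ j, ((4 * x₀ (Fin.castLE hnm j) / x (Fin.castLE hnm j) : ℝ) : ℂ) *
      ((t j * (1 - t j) : ℝ) * (Ψ (a + 1 + 1) t *
          ((4 * x (Fin.castLE hnm j) * x₀ (Fin.castLE hnm j) : ℝ) : ℂ)) +
      (b j * (1 - 2 * t j) : ℝ) * -Ψ (a + 1) t) =
      Ψ (a + 1 + 1) t * ((∑ j, 16 * (t j * (1 - t j)) * x₀ (Fin.castLE hnm j) ^ 2 : ℝ) : ℂ) -
      Ψ (a + 1) t * ((∑ j, 4 * x₀ (Fin.castLE hnm j) / x (Fin.castLE hnm j) *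
        (b j * (1 - 2 * t j)) : ℝ) : ℂ) := by
    rw [Complex.ofReal_sum, Complex.ofReal_sum, Finset.mul_sum, Finset.mul_sum,
      ← Finset.sum_sub_distrib]
    refine Finset.sum_congr rfl fun j _ => ?_
    have hxj : ((x (Fin.castLE hnm j) : ℝ) : ℂ) ≠ 0 := Complex.ofReal_ne_zero.2 (hx.1 j).ne'
    push_cast
    field_simp
    ring
  simp only [s3, s1, s2, s4, hκ]
  push_cast at hrec' hab ⊢
  linear_combination 4 * hrec' + 4 * Ψ (a + 1) t * hab

end Rho

/-! ### Conjugation by powers of the coordinates -/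

section Conjugation

variable {n m : ℕ} (hnm : n ≤ m)

/-- The weight `∏ⱼ xⱼ ^ eⱼ`. -/
def powWeight (e : Fin n → ℝ) (x : EuclideanSpace ℝ (Fin m)) : ℝ :=
  ∏ j, x (Fin.castLE hnm j) ^ e j

theorem powWeight_eq_exp (e : Fin n → ℝ) {x : EuclideanSpace ℝ (Fin m)} (hx : x ∈ posDomain hnm) :
    powWeight hnm e x = Real.exp (∑ j, e j * Real.log (x (Fin.castLE hnm j))) := by
  rw [powWeight, Real.exp_sum]
  refine Finset.prod_congr rfl fun j _ => ?_
  rw [Real.rpow_def_of_pos (hx j), mul_comm]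

theorem hasFDerivAt_powWeight (e : Fin n → ℝ) {x : EuclideanSpace ℝ (Fin m)}
    (hx : x ∈ posDomain hnm) :
    HasFDerivAt (powWeight hnm e)
      (powWeight hnm e x • ∑ i, (extendZero hnm e i / x i) • EuclideanSpace.proj (𝕜 := ℝ) i) x := by
  have hev : powWeight hnm e =ᶠ[𝓝 x]
      fun x => Real.exp (∑ j, e j * Real.log (x (Fin.castLE hnm j))) := by
    filter_upwards [(isOpen_posDomain hnm).mem_nhds hx] with y hy using powWeight_eq_exp hnm e hy
  refine HasFDerivAt.congr_of_eventuallyEq ?_ hev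
  have h1 : ∀ j, HasFDerivAt (fun x : EuclideanSpace ℝ (Fin m) =>
      e j * Real.log (x (Fin.castLE hnm j)))
      (e j • (x (Fin.castLE hnm j))⁻¹ • (EuclideanSpace.proj (𝕜 := ℝ) (Fin.castLE hnm j) :
        EuclideanSpace ℝ (Fin m) →L[ℝ] ℝ)) x := fun j =>
    (HasFDerivAt.log ((EuclideanSpace.proj (𝕜 := ℝ) (Fin.castLE hnm j)).hasFDerivAt)
      (hx j).ne').const_mul (e j)
  refine (HasFDerivAt.exp (HasFDerivAt.fun_sum fun j _ => h1 j)).congr_fderiv ?_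
  rw [powWeight_eq_exp hnm e hx]
  congr 1
  ext v
  have := sum_extendZero_mul_real hnm e (fun i => (x i)⁻¹ * v i)
  simp only [sum_apply, smul_apply, smul_eq_mul, PiLp.proj_apply, div_eq_mul_inv, mul_assoc]
  exact this.symm

theorem fderiv_single_eq_pd (i : Fin m) (f : EuclideanSpace ℝ (Fin m) → ℂ)
    (x : EuclideanSpace ℝ (Fin m)) :
    fderiv ℝ f x (EuclideanSpace.single i 1) = pd i f x := rfl

theorem pd_powWeight_mul (e : Fin n → ℝ) {v : EuclideanSpace ℝ (Fin m) → ℂ}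
    {x : EuclideanSpace ℝ (Fin m)} (hx : x ∈ posDomain hnm) (hv : DifferentiableAt ℝ v x)
    (i : Fin m) :
    pd i (fun x => (powWeight hnm e x : ℂ) * v x) x =
      (powWeight hnm e x : ℂ) * (((extendZero hnm e i / x i : ℝ) : ℂ) * v x + pd i v x) := by
  have h1 := (Complex.ofRealCLM.hasFDerivAt.comp x (hasFDerivAt_powWeight hnm e hx)).mul
    hv.hasFDerivAt
  refine (h1.pd_eq i).trans ?_
  simp only [add_apply, smul_apply, ContinuousLinearMap.comp_apply, sum_smul_proj_single,
    smul_eq_mul, Complex.ofRealCLM_apply, Function.comp_apply, fderiv_single_eq_pd]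
  push_cast
  ring

theorem AnalyticOnNhd.pd {U : Set (EuclideanSpace ℝ (Fin m))}
    {v : EuclideanSpace ℝ (Fin m) → ℂ} (hv : AnalyticOnNhd ℝ v U) (i : Fin m) :
    AnalyticOnNhd ℝ (pd i v) U := fun x hx =>
  ((ContinuousLinearMap.apply ℝ ℂ (EuclideanSpace.single i (1 : ℝ))).analyticAt _).comp
    (hv.fderiv x hx)

theorem pd_congr {u v : EuclideanSpace ℝ (Fin m) → ℂ} {x : EuclideanSpace ℝ (Fin m)}
    (h : u =ᶠ[𝓝 x] v) (i : Fin m) : pd i u x = pd i v x := by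
  rw [pd, h.fderiv_eq, ← pd]

theorem pd_congr_nhds {u v : EuclideanSpace ℝ (Fin m) → ℂ} {x : EuclideanSpace ℝ (Fin m)}
    (h : u =ᶠ[𝓝 x] v) (i : Fin m) : pd i u =ᶠ[𝓝 x] pd i v := by
  filter_upwards [h.eventuallyEq_nhds] with y hy using pd_congr hy i

theorem helmholtzOp_congr {p : ℕ} (α : Fin n → ℝ) (lam : Fin p → ℂ)
    {u v : EuclideanSpace ℝ (Fin m) → ℂ} {x : EuclideanSpace ℝ (Fin m)} (h : u =ᶠ[𝓝 x] v) :
    helmholtzOp hnm α lam u x = helmholtzOp hnm α lam v x := by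
  simp only [helmholtzOp, pd_congr h, pd_congr (pd_congr_nhds h _), h.eq_of_nhds]

theorem extendZero_mul_sub_one_add {e α : Fin n → ℝ} (he : ∀ j, e j * (e j - 1 + 2 * α j) = 0)
    (i : Fin m) :
    extendZero hnm e i * (extendZero hnm e i - 1 + 2 * extendZero hnm α i) = 0 := by
  by_cases h : ∃ j, Fin.castLE hnm j = i
  · obtain ⟨j, rfl⟩ := h
    simp only [extendZero_castLE, he]
  · push Not at h
    rw [extendZero_eq_zero hnm e h, zero_mul]

theorem extendZero_add (e α : Fin n → ℝ) (i : Fin m) :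
    extendZero hnm (fun j => α j + e j) i = extendZero hnm α i + extendZero hnm e i := by
  simp only [extendZero, ← Finset.sum_add_distrib]
  refine Finset.sum_congr rfl fun j _ => ?_
  split_ifs <;> simp

theorem hasFDerivAt_extendZero_div (e : Fin n → ℝ) {x : EuclideanSpace ℝ (Fin m)}
    (hx : x ∈ posDomain hnm) (i : Fin m) :
    HasFDerivAt (fun x : EuclideanSpace ℝ (Fin m) => extendZero hnm e i / x i)
      ((-extendZero hnm e i / x i ^ 2) • EuclideanSpace.proj (𝕜 := ℝ) i) x := by
  by_cases h : ∃ j, Fin.castLE hnm j = i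
  · obtain ⟨j, rfl⟩ := h
    have hxj : x (Fin.castLE hnm j) ≠ 0 := (hx j).ne'
    have h1 : HasFDerivAt (fun x : EuclideanSpace ℝ (Fin m) => x (Fin.castLE hnm j))
      (EuclideanSpace.proj (𝕜 := ℝ) (Fin.castLE hnm j)) x :=
      (EuclideanSpace.proj (𝕜 := ℝ) (Fin.castLE hnm j)).hasFDerivAt
    have h2 := ((hasDerivAt_inv hxj).comp_hasFDerivAt x h1).const_mul
      (extendZero hnm e (Fin.castLE hnm j))
    simp only [Function.comp_def, ← div_eq_mul_inv] at h2
    refine h2.congr_fderiv ?_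
    rw [smul_smul]
    congr 1
    ring
  · push Not at h
    simp only [extendZero_eq_zero hnm e h, zero_div, neg_zero, zero_smul]
    exact hasFDerivAt_const _ _

/-- After division by the weight, v / xⱼ² has the coefficient eⱼ(eⱼ - 1 + 2αⱼ) = 0, and the cross
term 2eⱼ/xⱼ · ∂ⱼv adds eⱼ to αⱼ. -/
theorem helmholtzOp_powWeight_mul {p : ℕ} {e α : Fin n → ℝ}
    (he : ∀ j, e j * (e j - 1 + 2 * α j) = 0) (lam : Fin p → ℂ)
    {U : Set (EuclideanSpace ℝ (Fin m))} (hU : IsOpen U) (hUp : U ⊆ posDomain hnm)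
    {v : EuclideanSpace ℝ (Fin m) → ℂ} (hv : AnalyticOnNhd ℝ v U)
    {x : EuclideanSpace ℝ (Fin m)} (hx : x ∈ U) :
    helmholtzOp hnm α lam (fun x => (powWeight hnm e x : ℂ) * v x) x =
      powWeight hnm e x * helmholtzOp hnm (fun j => α j + e j) lam v x := by
  have hd : ∀ y ∈ U, ∀ i, pd i (fun x => (powWeight hnm e x : ℂ) * v x) y =
      (powWeight hnm e y : ℂ) * (((extendZero hnm e i / y i : ℝ) : ℂ) * v y + pd i v y) :=
    fun y hy i => pd_powWeight_mul hnm e (hUp hy) (hv y hy).differentiableAt i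
  have hdd : ∀ i, pd i (pd i (fun x => (powWeight hnm e x : ℂ) * v x)) x =
      (powWeight hnm e x : ℂ) * (((extendZero hnm e i / x i : ℝ) : ℂ) *
        (((extendZero hnm e i / x i : ℝ) : ℂ) * v x + pd i v x) +
        (((-extendZero hnm e i / x i ^ 2 : ℝ) : ℂ) * v x +
          ((extendZero hnm e i / x i : ℝ) : ℂ) * pd i v x + pd i (pd i v) x)) := by
    intro i
    have h1 := Complex.ofRealCLM.hasFDerivAt.comp x (hasFDerivAt_extendZero_div hnm e (hUp hx) i)
    have h2 := (h1.mul (hv x hx).differentiableAt.hasFDerivAt).add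
      (hv.pd i x hx).differentiableAt.hasFDerivAt
    have h3 := h2.differentiableAt
    have hev : pd i (fun x => (powWeight hnm e x : ℂ) * v x) =ᶠ[𝓝 x] fun y =>
        (powWeight hnm e y : ℂ) * (((extendZero hnm e i / y i : ℝ) : ℂ) * v y + pd i v y) := by
      filter_upwards [hU.mem_nhds hx] with y hy using hd y hy i
    rw [pd_congr hev i]
    refine (pd_powWeight_mul hnm e (hUp hx) h3 i).trans ?_
    rw [h2.pd_eq i]
    simp only [add_apply, smul_apply, ContinuousLinearMap.comp_apply, proj_single_self,
      smul_eq_mul, Complex.ofRealCLM_apply, Function.comp_apply, fderiv_single_eq_pd]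
    simp only [Pi.add_apply, Pi.mul_apply, Function.comp_apply, Complex.ofRealCLM_apply]
    push_cast
    ring
  rw [helmholtzOp_eq, helmholtzOp_eq, mul_sub, Finset.mul_sum]
  congr 1
  · refine Finset.sum_congr rfl fun i _ => ?_
    rw [hdd, hd x hx]
    have h0 := extendZero_mul_sub_one_add hnm he i
    have h0' : (extendZero hnm e i : ℂ) * (extendZero hnm e i - 1 + 2 * extendZero hnm α i) = 0 := by
      exact_mod_cast h0
    rw [extendZero_add]
    push_cast
    linear_combination (powWeight hnm e x : ℂ) * v x / (x i : ℂ) ^ 2 * h0'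
  · ring

end Conjugation

/-! ### Integration by parts against test functions -/

/-- Smooth functions with compact support in `U`. -/
structure IsTestFunction {m : ℕ} (U : Set (EuclideanSpace ℝ (Fin m)))
    (g : EuclideanSpace ℝ (Fin m) → ℂ) : Prop where
  contDiff : ContDiff ℝ (⊤ : ℕ∞) g
  hasCompactSupport : HasCompactSupport g
  tsupport_subset : tsupport g ⊆ U

section TestFunction

variable {n m : ℕ} {U : Set (EuclideanSpace ℝ (Fin m))} {g : EuclideanSpace ℝ (Fin m) → ℂ}

theorem tsupport_pd_subset (g : EuclideanSpace ℝ (Fin m) → ℂ) (i : Fin m) :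
    tsupport (pd i g) ⊆ tsupport g := by
  refine (closure_mono ?_).trans (tsupport_fderiv_subset ℝ (f := g))
  intro x hx h0
  exact hx (by rw [pd, h0]; rfl)

theorem IsTestFunction.pd (hg : IsTestFunction U g) (i : Fin m) : IsTestFunction U (pd i g) where
  contDiff := (hg.contDiff.fderiv_right (m := (⊤ : ℕ∞)) (by simp)).clm_apply contDiff_const
  hasCompactSupport := hg.hasCompactSupport.of_isClosed_subset (isClosed_tsupport _)
    (tsupport_pd_subset g i)
  tsupport_subset := (tsupport_pd_subset g i).trans hg.tsupport_subset

theorem IsTestFunction.mul_left (hg : IsTestFunction U g) {f : EuclideanSpace ℝ (Fin m) → ℂ}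
    (hU : IsOpen U) (hf : ContDiffOn ℝ (⊤ : ℕ∞) f U) : IsTestFunction U fun x => f x * g x where
  contDiff := by
    rw [contDiff_iff_contDiffAt]
    intro x
    by_cases hx : x ∈ tsupport g
    · exact (hf.contDiffAt (hU.mem_nhds (hg.tsupport_subset hx))).mul hg.contDiff.contDiffAt
    · have : (fun x => f x * g x) =ᶠ[𝓝 x] fun _ => 0 := by
        filter_upwards [(notMem_tsupport_iff_eventuallyEq.1 hx)] with y hy
        rw [hy]; simp
      exact contDiffAt_const.congr_of_eventuallyEq this
  hasCompactSupport := hg.hasCompactSupport.mul_left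
  tsupport_subset := (tsupport_mul_subset_right).trans hg.tsupport_subset

theorem IsTestFunction.integrable_mul (hg : IsTestFunction U g)
    {u : EuclideanSpace ℝ (Fin m) → ℂ} (hu : ContinuousOn u U) :
    Integrable fun x => u x * g x := by
  rw [← integrableOn_iff_integrable_of_support_subset (s := tsupport g)
    ((Function.support_mul_subset_right _ _).trans (subset_tsupport g))]
  exact ((hu.mono hg.tsupport_subset).mul hg.contDiff.continuous.continuousOn).integrableOn_compact
    hg.hasCompactSupport

theorem IsTestFunction.integral_mul_pd (hg : IsTestFunction U g)
    {u : EuclideanSpace ℝ (Fin m) → ℂ} (hu : AnalyticOnNhd ℝ u U) (i : Fin m) :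
    ∫ x, u x * _root_.pd i g x = -∫ x, _root_.pd i u x * g x :=
  integral_mul_fderiv_eq_neg_fderiv_mul_of_integrable
    (hg.integrable_mul (hu.pd i).continuousOn) ((hg.pd i).integrable_mul hu.continuousOn)
    (hg.integrable_mul hu.continuousOn)
    (fun x hx => (hu x (hg.tsupport_subset hx)).differentiableAt)
    (fun x _ => (hg.contDiff.differentiable (by simp)) x)

variable (hnm : n ≤ m)

theorem IsTestFunction.div_coord (hg : IsTestFunction U g) (hU : IsOpen U)
    (hUp : U ⊆ posDomain hnm) (α : Fin n → ℝ) (j : Fin n) : IsTestFunction U fun y =>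
      ((2 * α j / y (Fin.castLE hnm j) : ℝ) : ℂ) * g y := by
  refine hg.mul_left hU ?_
  refine Complex.ofRealCLM.contDiff.comp_contDiffOn ?_
  exact contDiffOn_const.div (by fun_prop) fun y hy => (hUp hy j).ne'

/-- Both g and 2αⱼ g / xⱼ are test functions in U, so there are no boundary terms and u has to be
regular on U only. -/
theorem IsTestFunction.integral_mul_helmholtzAdjoint {p : ℕ} (hg : IsTestFunction U g)
    (hU : IsOpen U) (hUp : U ⊆ posDomain hnm) (α : Fin n → ℝ) (lam : Fin p → ℂ)
    {u : EuclideanSpace ℝ (Fin m) → ℂ} (hu : AnalyticOnNhd ℝ u U) :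
    ∫ x, u x * helmholtzAdjoint hnm α lam g x = ∫ x, helmholtzOp hnm α lam u x * g x := by
  have hψ := hg.div_coord hnm hU hUp α
  have i1 : ∀ i, Integrable fun x => u x * _root_.pd i (_root_.pd i g) x := fun i =>
    ((hg.pd i).pd i).integrable_mul hu.continuousOn
  have i2 : ∀ j, Integrable fun x => u x * _root_.pd (Fin.castLE hnm j)
      (fun y => ((2 * α j / y (Fin.castLE hnm j) : ℝ) : ℂ) * g y) x := fun j =>
    ((hψ j).pd _).integrable_mul hu.continuousOn
  have i3 := hg.integrable_mul hu.continuousOn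
  have i4 : ∀ i, Integrable fun x => _root_.pd i (_root_.pd i u) x * g x := fun i =>
    hg.integrable_mul ((hu.pd i).pd i).continuousOn
  have i5 : ∀ j, Integrable fun x => _root_.pd (Fin.castLE hnm j) u x *
      (((2 * α j / x (Fin.castLE hnm j) : ℝ) : ℂ) * g x) := fun j =>
    (hψ j).integrable_mul (hu.pd _).continuousOn
  have e1 : ∀ x, u x * helmholtzAdjoint hnm α lam g x =
      ((∑ i, u x * _root_.pd i (_root_.pd i g) x) - ∑ j, u x * _root_.pd (Fin.castLE hnm j)
      (fun y => ((2 * α j / y (Fin.castLE hnm j) : ℝ) : ℂ) * g y) x) -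
      (∑ k, lam k ^ 2) * (u x * g x) := fun x => by
    rw [helmholtzAdjoint, ← Finset.mul_sum, ← Finset.mul_sum]
    ring
  have e2 : ∀ x, helmholtzOp hnm α lam u x * g x =
      ((∑ i, _root_.pd i (_root_.pd i u) x * g x) + ∑ j, _root_.pd (Fin.castLE hnm j) u x *
      (((2 * α j / x (Fin.castLE hnm j) : ℝ) : ℂ) * g x)) -
      (∑ k, lam k ^ 2) * (u x * g x) := fun x => by
    have : ∑ j, _root_.pd (Fin.castLE hnm j) u x *
        (((2 * α j / x (Fin.castLE hnm j) : ℝ) : ℂ) * g x) =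
        (∑ j, ((2 * α j / x (Fin.castLE hnm j) : ℝ) : ℂ) * _root_.pd (Fin.castLE hnm j) u x) *
          g x := by
      rw [Finset.sum_mul]
      exact Finset.sum_congr rfl fun j _ => by ring
    rw [helmholtzOp, this, ← Finset.sum_mul]
    ring
  have i12 : Integrable fun x => (∑ i, u x * _root_.pd i (_root_.pd i g) x) -
      ∑ j, u x * _root_.pd (Fin.castLE hnm j)
      (fun y => ((2 * α j / y (Fin.castLE hnm j) : ℝ) : ℂ) * g y) x :=
    (integrable_finsetSum _ fun i _ => i1 i).sub (integrable_finsetSum _ fun j _ => i2 j)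
  have i45 : Integrable fun x => (∑ i, _root_.pd i (_root_.pd i u) x * g x) +
      ∑ j, _root_.pd (Fin.castLE hnm j) u x *
      (((2 * α j / x (Fin.castLE hnm j) : ℝ) : ℂ) * g x) :=
    (integrable_finsetSum _ fun i _ => i4 i).add (integrable_finsetSum _ fun j _ => i5 j)
  simp only [e1, e2]
  rw [integral_sub i12 (i3.const_mul _),
    integral_sub (integrable_finsetSum _ fun i _ => i1 i) (integrable_finsetSum _ fun j _ => i2 j),
    integral_finsetSum _ fun i _ => i1 i, integral_finsetSum _ fun j _ => i2 j,
    integral_sub i45 (i3.const_mul _),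
    integral_add (integrable_finsetSum _ fun i _ => i4 i) (integrable_finsetSum _ fun j _ => i5 j),
    integral_finsetSum _ fun i _ => i4 i, integral_finsetSum _ fun j _ => i5 j]
  have s1 : ∀ i, ∫ x, u x * _root_.pd i (_root_.pd i g) x =
      ∫ x, _root_.pd i (_root_.pd i u) x * g x := fun i => by
    rw [(hg.pd i).integral_mul_pd hu, hg.integral_mul_pd (hu.pd i), neg_neg]
  simp only [s1, fun j => (hψ j).integral_mul_pd hu (Fin.castLE hnm j), Finset.sum_neg_distrib,
    sub_neg_eq_add]

end TestFunction

/-! ### Averages of powers -/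

section Averages

variable {n : ℕ} {b : Fin n → ℝ}

/-- The product of the Laplace transforms of the beta distributions. -/
def betaLaplacePi (b v : Fin n → ℝ) : ℝ := ∏ j, betaLaplace (b j) (v j)

/-- The average of `(R + ∑ⱼ tⱼ wⱼ) ^ (-c)` with respect to the product of beta distributions. -/
def betaPower (b : Fin n → ℝ) (c R : ℝ) (w : Fin n → ℝ) : ℝ :=
  ∫ t, (R + ∑ j, t j * w j) ^ (-c) ∂(betaProd b)

theorem integral_exp_betaProd (hb : ∀ j, 0 < b j) (v : Fin n → ℝ) :
    ∫ t, Real.exp (-∑ j, t j * v j) ∂(betaProd b) = betaLaplacePi b v := by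
  have := fun i => ProbabilityTheory.isProbabilityMeasureBeta (hb i) (hb i)
  unfold betaLaplacePi betaLaplace betaProd
  rw [← integral_fintype_prod_eq_prod (𝕜 := ℝ)
    (f := fun j t => Real.exp (-(v j * t))) (μ := fun j => betaMeasure (b j) (b j))]
  congr 1 with t
  rw [← Real.exp_sum, ← Finset.sum_neg_distrib]
  simp only [mul_comm]

theorem betaLaplacePi_nonneg (b v : Fin n → ℝ) : 0 ≤ betaLaplacePi b v :=
  Finset.prod_nonneg fun _ _ => betaLaplace_nonneg _ _

theorem betaLaplacePi_le_one (hb : ∀ j, 0 < b j) {v : Fin n → ℝ} (hv : ∀ j, 0 ≤ v j) :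
    betaLaplacePi b v ≤ 1 :=
  Finset.prod_le_one (fun _ _ => betaLaplace_nonneg _ _) fun j _ => betaLaplace_le_one (hb j) (hv j)

theorem measurable_betaLaplacePi (hb : ∀ j, 0 < b j) : Measurable (betaLaplacePi b) :=
  Finset.measurable_fun_prod _ fun j _ => (measurable_betaLaplace (hb j)).comp (measurable_pi_apply j)

/-- The constant depends on the weights only through their lower bound c₀, which is what allows
uniformity over compact sets of x. -/
theorem exists_rpow_mul_betaLaplacePi_le (hb : ∀ j, 0 < b j) (hb1 : ∀ j, b j ≤ 1) {c₀ : ℝ}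
    (hc₀ : 0 < c₀) : ∃ C : ℝ, 0 < C ∧ ∀ w : Fin n → ℝ, (∀ j, c₀ ≤ w j) → ∀ s : ℝ, 0 < s →
      s ^ (∑ j, b j) * betaLaplacePi b (fun j => s * w j) ≤ C := by
  choose D hD0 hD using fun j => exists_rpow_mul_betaLaplace_le (hb j) (hb1 j)
  refine ⟨∏ j, (D j * c₀ ^ (-b j)), Finset.prod_pos fun j _ => by have := hD0 j; positivity,
    fun w hw s hs => ?_⟩
  rw [Real.rpow_sum_of_pos hs, betaLaplacePi, ← Finset.prod_mul_distrib]
  refine Finset.prod_le_prod (fun j _ => mul_nonneg (by positivity) (betaLaplace_nonneg _ _))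
    fun j _ => ?_
  have hwj : 0 < w j := hc₀.trans_le (hw j)
  have h := hD j (s * w j) (by positivity)
  rw [Real.mul_rpow hs.le hwj.le] at h
  have e : s ^ b j * betaLaplace (b j) (s * w j) =
      (s ^ b j * w j ^ b j * betaLaplace (b j) (s * w j)) * w j ^ (-b j) := by
    rw [Real.rpow_neg hwj.le]
    field_simp
  rw [e]
  have h2 : w j ^ (-b j) ≤ c₀ ^ (-b j) :=
    Real.rpow_le_rpow_of_nonpos hc₀ (hw j) (by linarith [hb j])
  have := hD0 j
  gcongr

/-- The limit of `s ^ (∑ⱼ bⱼ)` times the Laplace transform as `s → ∞`. -/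
def betaLimit (b w : Fin n → ℝ) : ℝ :=
  ∏ j, (Real.Gamma (2 * b j) / Real.Gamma (b j) * w j ^ (-b j))

theorem tendsto_rpow_mul_betaLaplacePi (hb : ∀ j, 0 < b j) (hb1 : ∀ j, b j ≤ 1) {ι : Type*}
    {l : Filter ι} {s : ι → ℝ} {w : ι → Fin n → ℝ} {w₀ : Fin n → ℝ} (hw₀ : ∀ j, 0 < w₀ j)
    (hs : Tendsto s l atTop) (hw : Tendsto w l (𝓝 w₀)) :
    Tendsto (fun i => s i ^ (∑ j, b j) * betaLaplacePi b (fun j => s i * w i j)) l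
      (𝓝 (betaLimit b w₀)) := by
  have hwj : ∀ j, Tendsto (fun i => w i j) l (𝓝 (w₀ j)) := fun j => (tendsto_pi_nhds.1 hw) j
  have h : Tendsto (fun i => ∏ j, (((s i * w i j) ^ b j * betaLaplace (b j) (s i * w i j)) *
      w i j ^ (-b j))) l (𝓝 (betaLimit b w₀)) := by
    refine tendsto_finsetProd _ fun j _ => ?_
    refine Tendsto.mul ((tendsto_rpow_mul_betaLaplace (hb j) (hb1 j)).comp
      (hs.atTop_mul_pos (hw₀ j) (hwj j))) ?_
    exact (hwj j).rpow_const (Or.inl (hw₀ j).ne')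
  refine h.congr' ?_
  have hpos : ∀ᶠ i in l, ∀ j, 0 < w i j := eventually_all.2 fun j => (hwj j).eventually_const_lt (hw₀ j)
  filter_upwards [hs.eventually_gt_atTop 0, hpos] with i hi hp
  rw [Real.rpow_sum_of_pos hi, betaLaplacePi, ← Finset.prod_mul_distrib]
  refine Finset.prod_congr rfl fun j _ => ?_
  have := hp j
  rw [Real.mul_rpow hi.le this.le, Real.rpow_neg this.le]
  field_simp

theorem integrableOn_rpow_mul_exp_neg {c R : ℝ} (hc : 0 < c) (hR : 0 < R) :
    IntegrableOn (fun s : ℝ => s ^ (c - 1) * Real.exp (-(R * s))) (Ioi 0) := by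
  have := integrableOn_rpow_mul_exp_neg_mul_rpow (p := 1) (s := c - 1) (b := R) (by linarith)
    one_pos hR
  simpa using this

theorem integrableOn_rpow_mul_betaLaplacePi (hb : ∀ j, 0 < b j) {c R : ℝ} (hc : 0 < c)
    (hR : 0 < R) {w : Fin n → ℝ} (hw : ∀ j, 0 ≤ w j) :
    IntegrableOn (fun s : ℝ => s ^ (c - 1) * Real.exp (-(R * s)) *
      betaLaplacePi b (fun j => s * w j)) (Ioi 0) := by
  refine Integrable.mono' (integrableOn_rpow_mul_exp_neg hc hR) ?_ ?_
  · refine AEStronglyMeasurable.mul (by fun_prop) ?_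
    exact ((measurable_betaLaplacePi hb).comp (by fun_prop)).aestronglyMeasurable
  · filter_upwards [ae_restrict_mem measurableSet_Ioi] with s hs
    have hs : 0 < s := hs
    rw [Real.norm_of_nonneg (mul_nonneg (by positivity) (betaLaplacePi_nonneg _ _))]
    exact mul_le_of_le_one_right (by positivity)
      (betaLaplacePi_le_one hb fun j => mul_nonneg hs.le (hw j))

/-- Writing the power as a Gamma integral over s and exchanging the integrals makes the average over
t factor into one-dimensional Laplace transforms. -/
theorem Gamma_mul_betaPower (hb : ∀ j, 0 < b j) {c R : ℝ} (hc : 0 < c) (hR : 0 < R)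
    {w : Fin n → ℝ} (hw : ∀ j, 0 ≤ w j) :
    Real.Gamma c * betaPower b c R w = ∫ s in Ioi (0 : ℝ),
      s ^ (c - 1) * Real.exp (-(R * s)) * betaLaplacePi b (fun j => s * w j) := by
  have := isProbabilityMeasure_betaProd hb
  have hpos : ∀ᵐ t ∂(betaProd b), 0 < R + ∑ j, t j * w j := by
    filter_upwards [ae_betaProd_mem_Ioo hb] with t ht
    have := Finset.sum_nonneg fun j (_ : j ∈ Finset.univ) => mul_nonneg (ht j).1.le (hw j)
    linarith
  have hle : ∀ᵐ t ∂(betaProd b), R ≤ R + ∑ j, t j * w j := by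
    filter_upwards [ae_betaProd_mem_Ioo hb] with t ht
    have := Finset.sum_nonneg fun j (_ : j ∈ Finset.univ) => mul_nonneg (ht j).1.le (hw j)
    linarith
  have h1 : Real.Gamma c * betaPower b c R w =
      ∫ t, (∫ s in Ioi (0 : ℝ), s ^ (c - 1) * Real.exp (-((R + ∑ j, t j * w j) * s)))
        ∂(betaProd b) := by
    rw [betaPower, ← integral_const_mul]
    refine integral_congr_ae ?_
    filter_upwards [hpos] with t ht
    rw [Real.integral_rpow_mul_exp_neg_mul_Ioi hc ht, one_div, Real.inv_rpow ht.le,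
      Real.rpow_neg ht.le, mul_comm]
  rw [h1, integral_integral_swap]
  · refine setIntegral_congr_fun measurableSet_Ioi fun s hs => ?_
    have e : ∀ t : Fin n → ℝ, s ^ (c - 1) * Real.exp (-((R + ∑ j, t j * w j) * s)) =
        s ^ (c - 1) * Real.exp (-(R * s)) * Real.exp (-∑ j, t j * (s * w j)) := fun t => by
      rw [mul_assoc, ← Real.exp_add, add_mul, Finset.sum_mul, neg_add]
      simp only [mul_assoc, mul_comm s]
    simp only [e]
    rw [integral_const_mul, integral_exp_betaProd hb]
  · have hmeas : AEStronglyMeasurable (Function.uncurry fun (t : Fin n → ℝ) (s : ℝ) =>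
        s ^ (c - 1) * Real.exp (-((R + ∑ j, t j * w j) * s)))
        ((betaProd b).prod (volume.restrict (Ioi 0))) := by
      refine Measurable.aestronglyMeasurable ?_
      unfold Function.uncurry
      fun_prop
    have hdom : Integrable (Function.uncurry fun (t : Fin n → ℝ) (s : ℝ) =>
        (1 : ℝ) * (s ^ (c - 1) * Real.exp (-(R * s))))
        ((betaProd b).prod (volume.restrict (Ioi 0))) :=
      (integrable_const (1 : ℝ)).mul_prod (integrableOn_rpow_mul_exp_neg hc hR)
    refine hdom.mono' hmeas ?_
    have hs : ∀ᵐ z ∂((betaProd b).prod (volume.restrict (Ioi (0 : ℝ)))), z.2 ∈ Ioi (0 : ℝ) :=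
      Measure.quasiMeasurePreserving_snd.ae (ae_restrict_mem measurableSet_Ioi)
    have ht : ∀ᵐ z ∂((betaProd b).prod (volume.restrict (Ioi (0 : ℝ)))),
        R ≤ R + ∑ j, z.1 j * w j := Measure.quasiMeasurePreserving_fst.ae hle
    filter_upwards [hs, ht] with z hz hz'
    have hz : 0 < z.2 := hz
    simp only [Function.uncurry, one_mul]
    rw [Real.norm_of_nonneg (by positivity)]
    gcongr

theorem betaPower_nonneg (hb : ∀ j, 0 < b j) {R : ℝ} (c : ℝ) (hR : 0 ≤ R)
    {w : Fin n → ℝ} (hw : ∀ j, 0 ≤ w j) : 0 ≤ betaPower b c R w := by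
  refine integral_nonneg_of_ae ?_
  filter_upwards [ae_betaProd_mem_Ioo hb] with t ht
  have := Finset.sum_nonneg fun j (_ : j ∈ Finset.univ) => mul_nonneg (ht j).1.le (hw j)
  exact Real.rpow_nonneg (by linarith) _

/-- Averaging gains up to ∑ bⱼ powers of R, and θ is the part of the gain that is claimed. The
product of Laplace transforms is O(s^{-θ}) for all s > 0: it is at most 1 for s ≤ 1 and decays like
s^{-∑ bⱼ} for s ≥ 1. The condition θ < c makes the resulting Gamma integral converge. -/
theorem exists_betaPower_le (hb : ∀ j, 0 < b j) (hb1 : ∀ j, b j ≤ 1) {c₀ : ℝ} (hc₀ : 0 < c₀)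
    {c θ : ℝ} (hθ : 0 ≤ θ) (hθb : θ ≤ ∑ j, b j) (hθc : θ < c) :
    ∃ C : ℝ, 0 < C ∧ ∀ w : Fin n → ℝ, (∀ j, c₀ ≤ w j) → ∀ R : ℝ, 0 < R →
      betaPower b c R w ≤ C * R ^ (-(c - θ)) := by
  obtain ⟨D, hD0, hD⟩ := exists_rpow_mul_betaLaplacePi_le hb hb1 hc₀
  have hc : 0 < c := hθ.trans_lt hθc
  have hG := Real.Gamma_pos_of_pos hc
  have hG' := Real.Gamma_pos_of_pos (sub_pos.2 hθc)
  refine ⟨max 1 D * Real.Gamma (c - θ) / Real.Gamma c, by positivity, fun w hw R hR => ?_⟩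
  have hw0 : ∀ j, 0 ≤ w j := fun j => hc₀.le.trans (hw j)
  have hL : ∀ s : ℝ, 0 < s → betaLaplacePi b (fun j => s * w j) ≤ max 1 D * s ^ (-θ) := by
    intro s hs
    rcases le_total s 1 with h1 | h1
    · have := betaLaplacePi_le_one hb (v := fun j => s * w j) fun j => mul_nonneg hs.le (hw0 j)
      have h2 : 1 ≤ s ^ (-θ) := Real.one_le_rpow_of_pos_of_le_one_of_nonpos hs h1 (by linarith)
      nlinarith [le_max_left 1 D]
    · have h3 := hD w hw s hs
      have h4 : s ^ θ ≤ s ^ (∑ j, b j) := Real.rpow_le_rpow_of_exponent_le h1 hθb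
      have h5 : s ^ θ * betaLaplacePi b (fun j => s * w j) ≤ D :=
        (mul_le_mul_of_nonneg_right h4 (betaLaplacePi_nonneg _ _)).trans h3
      rw [Real.rpow_neg hs.le, ← div_eq_mul_inv, le_div_iff₀ (by positivity), mul_comm]
      exact h5.trans (le_max_right _ _)
  have key : Real.Gamma c * betaPower b c R w ≤ max 1 D * Real.Gamma (c - θ) * R ^ (-(c - θ)) := by
    rw [Gamma_mul_betaPower hb hc hR hw0]
    have hI := Real.integral_rpow_mul_exp_neg_mul_Ioi (sub_pos.2 hθc) hR
    have e : max 1 D * Real.Gamma (c - θ) * R ^ (-(c - θ)) =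
        ∫ s in Ioi (0 : ℝ), max 1 D * (s ^ (c - θ - 1) * Real.exp (-(R * s))) := by
      rw [integral_const_mul, hI, one_div, Real.inv_rpow hR.le, Real.rpow_neg hR.le]
      ring
    rw [e]
    refine setIntegral_mono_on (integrableOn_rpow_mul_betaLaplacePi hb hc hR hw0)
      ((integrableOn_rpow_mul_exp_neg (sub_pos.2 hθc) hR).const_mul _) measurableSet_Ioi
      fun s hs => ?_
    have hs : 0 < s := hs
    have e2 : s ^ (c - θ - 1) = s ^ (c - 1) * s ^ (-θ) := by
      rw [← Real.rpow_add hs]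
      congr 1
      ring
    rw [e2]
    calc _ ≤ s ^ (c - 1) * Real.exp (-(R * s)) * (max 1 D * s ^ (-θ)) := by
          gcongr
          exact hL s hs
      _ = _ := by ring
  rw [div_mul_eq_mul_div, le_div_iff₀ hG, mul_comm]
  exact key

/-- With s = σ / R the Laplace factors are evaluated near infinity and contribute (R / σ)^B times
their limit, where B = ∑ bⱼ. What is left is the Gamma integral with exponent c - B. -/
theorem tendsto_rpow_mul_betaPower (hb : ∀ j, 0 < b j) (hb1 : ∀ j, b j ≤ 1) {c : ℝ}
    (hc : ∑ j, b j < c) {ι : Type*} {l : Filter ι} [l.IsCountablyGenerated] {R : ι → ℝ}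
    {w : ι → Fin n → ℝ} {w₀ : Fin n → ℝ} (hw₀ : ∀ j, 0 < w₀ j)
    (hR : Tendsto R l (𝓝[>] 0)) (hw : Tendsto w l (𝓝 w₀)) :
    Tendsto (fun i => R i ^ (c - ∑ j, b j) * (Real.Gamma c * betaPower b c (R i) (w i))) l
      (𝓝 (Real.Gamma (c - ∑ j, b j) * betaLimit b w₀)) := by
  set B := ∑ j, b j with hB
  have hB0 : 0 ≤ B := Finset.sum_nonneg fun j _ => (hb j).le
  have hc0 : 0 < c := hB0.trans_lt hc
  have hcB : 0 < c - B := sub_pos.2 hc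
  have hwj : ∀ j, Tendsto (fun i => w i j) l (𝓝 (w₀ j)) := fun j => (tendsto_pi_nhds.1 hw) j
  obtain ⟨c₀, hc₀, hlt⟩ : ∃ c₀ > 0, ∀ j, c₀ < w₀ j := by
    have : ∀ᶠ c₀ in 𝓝[>] (0 : ℝ), ∀ j, c₀ < w₀ j := eventually_all.2 fun j =>
      (tendsto_id.mono_left nhdsWithin_le_nhds).eventually_lt_const (hw₀ j)
    obtain ⟨c₀, h1, h2⟩ := (this.and self_mem_nhdsWithin).exists
    exact ⟨c₀, h2, h1⟩
  have hwl : ∀ᶠ i in l, ∀ j, c₀ ≤ w i j :=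
    eventually_all.2 fun j => ((hwj j).eventually_const_lt (hlt j)).mono fun _ h => h.le
  have hRp : ∀ᶠ i in l, 0 < R i := hR.eventually self_mem_nhdsWithin
  obtain ⟨D, hD0, hD⟩ := exists_rpow_mul_betaLaplacePi_le hb hb1 hc₀
  have hconv : Tendsto (fun i => ∫ σ in Ioi (0 : ℝ), σ ^ (c - B - 1) * Real.exp (-(1 * σ)) *
      ((σ / R i) ^ B * betaLaplacePi b (fun j => σ / R i * w i j))) l
      (𝓝 (∫ σ in Ioi (0 : ℝ), σ ^ (c - B - 1) * Real.exp (-(1 * σ)) * betaLimit b w₀)) := by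
    refine tendsto_integral_filter_of_dominated_convergence
      (fun σ => σ ^ (c - B - 1) * Real.exp (-(1 * σ)) * D) ?_ ?_ ?_ ?_
    · refine Eventually.of_forall fun i => Measurable.aestronglyMeasurable ?_
      refine Measurable.mul (by fun_prop) (Measurable.mul (by fun_prop) ?_)
      exact (measurable_betaLaplacePi hb).comp (by fun_prop)
    · filter_upwards [hwl, hRp] with i hi hRi
      filter_upwards [ae_restrict_mem measurableSet_Ioi] with σ hσ
      have hσ : 0 < σ := hσ
      rw [Real.norm_of_nonneg (mul_nonneg (by positivity)
        (mul_nonneg (by positivity) (betaLaplacePi_nonneg _ _)))]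
      gcongr
      exact hD (w i) hi (σ / R i) (by positivity)
    · exact (integrableOn_rpow_mul_exp_neg hcB one_pos).mul_const D
    · filter_upwards [ae_restrict_mem measurableSet_Ioi] with σ hσ
      have hσ : 0 < σ := hσ
      refine Tendsto.const_mul _ (tendsto_rpow_mul_betaLaplacePi hb hb1 hw₀ ?_ hw)
      simp only [div_eq_mul_inv]
      exact (tendsto_inv_nhdsGT_zero.comp hR).const_mul_atTop hσ
  rw [integral_mul_const, Real.integral_rpow_mul_exp_neg_mul_Ioi hcB one_pos] at hconv
  simp only [div_one, Real.one_rpow, one_mul] at hconv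
  refine hconv.congr' ?_
  filter_upwards [hwl, hRp] with i hi hRi
  have hw0 : ∀ j, 0 ≤ w i j := fun j => hc₀.le.trans (hi j)
  rw [Gamma_mul_betaPower hb hc0 hRi hw0]
  have hsub := integral_comp_mul_left_Ioi (fun s : ℝ => s ^ (c - 1) * Real.exp (-(R i * s)) *
    betaLaplacePi b (fun j => s * w i j)) 0 (inv_pos.2 hRi)
  rw [mul_zero, inv_inv, smul_eq_mul] at hsub
  have e : R i ^ (c - B) * ∫ s in Ioi (0 : ℝ), s ^ (c - 1) * Real.exp (-(R i * s)) *
      betaLaplacePi b (fun j => s * w i j) = R i ^ (c - B - 1) * (R i * ∫ s in Ioi (0 : ℝ),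
        s ^ (c - 1) * Real.exp (-(R i * s)) * betaLaplacePi b (fun j => s * w i j)) := by
    rw [Real.rpow_sub_one hRi.ne']
    field_simp
  rw [e, ← hsub, ← integral_const_mul]
  refine setIntegral_congr_fun measurableSet_Ioi fun σ hσ => ?_
  have hσ : 0 < σ := hσ
  have e1 : R i * ((R i)⁻¹ * σ) = σ := by field_simp
  have e2 : (R i)⁻¹ * σ = σ / R i := by ring
  simp only [e1]
  rw [e2, Real.div_rpow hσ.le hRi.le, Real.div_rpow hσ.le hRi.le]
  have e3 : σ ^ (c - B - 1) = σ ^ (c - 1) / σ ^ B := by rw [← Real.rpow_sub hσ]; congr 1; ring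
  have e4 : R i ^ (c - B - 1) = R i ^ (c - 1) / R i ^ B := by
    rw [← Real.rpow_sub hRi]; congr 1; ring
  rw [e3, e4]
  field_simp

end Averages

/-! ### Size of the integrals of radial solutions -/

section RhoBounds

variable {n m : ℕ} (hnm : n ≤ m) {x₀ : EuclideanSpace ℝ (Fin m)} {b : Fin n → ℝ}

/-- The numbers `rⱼ² - r² = 4 xⱼ x₀ⱼ`. -/
def poleWeight (x₀ x : EuclideanSpace ℝ (Fin m)) (j : Fin n) : ℝ :=
  4 * x (Fin.castLE hnm j) * x₀ (Fin.castLE hnm j)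

theorem poleWeight_pos (hx₀ : x₀ ∈ posDomain hnm) {x : EuclideanSpace ℝ (Fin m)}
    (hx : x ∈ posDomain hnm) (j : Fin n) : 0 < poleWeight hnm x₀ x j := by
  have := hx j
  have := hx₀ j
  unfold poleWeight
  positivity

theorem continuous_poleWeight (x₀ : EuclideanSpace ℝ (Fin m)) :
    Continuous (poleWeight hnm x₀) := by
  unfold poleWeight
  fun_prop

theorem rho_add_eq (ε : ℝ) (x : EuclideanSpace ℝ (Fin m)) (t : Fin n → ℝ) :
    rho hnm x₀ x t + ε = rSq x₀ x + ε + ∑ j, t j * poleWeight hnm x₀ x j := by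
  rw [rho, add_right_comm]
  rfl

theorem betaPower_poleWeight (c ε : ℝ) (x : EuclideanSpace ℝ (Fin m)) :
    betaPower b c (rSq x₀ x + ε) (poleWeight hnm x₀ x) =
      ∫ t, (rho hnm x₀ x t + ε) ^ (-c) ∂(betaProd b) := by
  simp only [rho_add_eq]
  rfl

/-- The pencil has coefficients polynomial in x, so real-analyticity follows by composition with the
complex-analytic integral. -/
theorem analyticOnNhd_rhoIntegral (hx₀ : x₀ ∈ posDomain hnm) (hb : ∀ j, 0 < b j) (ε : ℝ) (κ : ℂ)
    {c : ℂ} (hc : c ∈ Complex.integerComplement) :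
    AnalyticOnNhd ℝ (rhoIntegral hnm x₀ ε κ c b) (regDomain hnm x₀ ε) := by
  intro x hx
  have he : rhoIntegral hnm x₀ ε κ c b = radialIntegral κ c b ∘
      fun x => (((rSq x₀ x + ε : ℝ) : ℂ), fun j => ((poleWeight hnm x₀ x j : ℝ) : ℂ)) := by
    ext x
    simp only [rhoIntegral, radialIntegral, Function.comp_apply, rho_add_eq]
    push_cast
    rfl
  rw [he]
  have hcoord : ∀ i : Fin m, AnalyticAt ℝ (fun x : EuclideanSpace ℝ (Fin m) => x i) x := fun i =>
    (EuclideanSpace.proj (𝕜 := ℝ) i).analyticAt x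
  have h1 : AnalyticAt ℝ (fun x : EuclideanSpace ℝ (Fin m) => ((rSq x₀ x + ε : ℝ) : ℂ)) x := by
    refine (Complex.ofRealCLM.analyticAt _).comp (g := fun y : ℝ => (y : ℂ)) ?_
    refine AnalyticAt.add ?_ analyticAt_const
    exact Finset.analyticAt_fun_sum _ fun i _ => ((hcoord i).sub analyticAt_const).pow 2
  have h2 : AnalyticAt ℝ (fun (x : EuclideanSpace ℝ (Fin m)) (j : Fin n) =>
      ((poleWeight hnm x₀ x j : ℝ) : ℂ)) x := by
    refine analyticAt_pi_iff.2 fun j => ?_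
    refine (Complex.ofRealCLM.analyticAt _).comp (g := fun y : ℝ => (y : ℂ)) ?_
    exact (analyticAt_const.mul (hcoord _)).mul analyticAt_const
  refine AnalyticAt.comp ?_ (h1.prod h2)
  refine (analyticAt_radialIntegral κ hc hb ?_ ?_).restrictScalars
  · simpa using hx.2
  · intro j
    simpa using (poleWeight_pos hnm hx₀ hx.1 j).le

theorem exists_le_poleWeight (hx₀ : x₀ ∈ posDomain hnm) {K : Set (EuclideanSpace ℝ (Fin m))}
    (hK : IsCompact K) (hKp : K ⊆ posDomain hnm) :
    ∃ c₀ : ℝ, 0 < c₀ ∧ ∀ x ∈ K, ∀ j, c₀ ≤ poleWeight hnm x₀ x j := by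
  have h : ∀ j, ∃ a, 0 < a ∧ ∀ x ∈ K, a ≤ poleWeight hnm x₀ x j := fun j =>
    hK.exists_forall_le' (f := fun x => poleWeight hnm x₀ x j)
      (((continuous_apply j).comp (continuous_poleWeight hnm x₀)).continuousOn)
      fun x hx => poleWeight_pos hnm hx₀ (hKp hx) j
  choose a ha0 ha using h
  have hev : ∀ᶠ c₀ in 𝓝[>] (0 : ℝ), ∀ j, c₀ < a j := eventually_all.2 fun j =>
    (tendsto_id.mono_left nhdsWithin_le_nhds).eventually_lt_const (ha0 j)
  obtain ⟨c₀, h1, h2⟩ := (hev.and self_mem_nhdsWithin).exists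
  exact ⟨c₀, h2, fun x hx j => (h1 j).le.trans (ha j x hx)⟩

theorem exists_rho_le (x₀ : EuclideanSpace ℝ (Fin m)) {K : Set (EuclideanSpace ℝ (Fin m))}
    (hK : IsCompact K) : ∃ R : ℝ, ∀ x ∈ K, ∀ t ∈ Icc (0 : Fin n → ℝ) 1, rho hnm x₀ x t ≤ R := by
  obtain ⟨R, hR⟩ := (hK.prod (isCompact_Icc (a := (0 : Fin n → ℝ)) (b := 1))).exists_bound_of_continuousOn
    (continuous_rho hnm x₀).continuousOn
  exact ⟨R, fun x hx t ht => (le_abs_self _).trans (hR (x, t) ⟨hx, ht⟩)⟩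

theorem integrable_rho_rpow (hx₀ : x₀ ∈ posDomain hnm) (hb : ∀ j, 0 < b j) {ε : ℝ}
    {x : EuclideanSpace ℝ (Fin m)} (hx : x ∈ regDomain hnm x₀ ε) (c : ℝ) :
    Integrable (fun t => (rho hnm x₀ x t + ε) ^ (-c)) (betaProd b) := by
  refine integrable_betaProd_of_continuousOn hb ?_
  refine ContinuousOn.rpow_const ?_ fun t ht => Or.inl (rho_add_pos hnm hx₀ hx ht).ne'
  exact (((continuous_rho hnm x₀).comp (by fun_prop : Continuous fun t : Fin n → ℝ => (x, t))).add
    continuous_const).continuousOn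

theorem exists_norm_rhoIntegral_le (hx₀ : x₀ ∈ posDomain hnm) (hb : ∀ j, 0 < b j) (κ : ℂ) {c : ℝ}
    (hc : (c : ℂ) ∈ Complex.integerComplement) {K : Set (EuclideanSpace ℝ (Fin m))}
    (hK : IsCompact K) (hKp : K ⊆ posDomain hnm) :
    ∃ C : ℝ, 0 ≤ C ∧ ∀ x ∈ K, ∀ ε : ℝ, ε ≤ 1 → 0 < rSq x₀ x + ε →
      ‖rhoIntegral hnm x₀ ε κ c b x‖ ≤
        C * betaPower b c (rSq x₀ x + ε) (poleWeight hnm x₀ x) := by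
  obtain ⟨R, hR⟩ := exists_rho_le hnm x₀ hK
  obtain ⟨C, hC0, hC⟩ := exists_norm_radialSol_le κ hc (R + 1)
  refine ⟨C, hC0, fun x hx ε hε hpos => ?_⟩
  have hreg : x ∈ regDomain hnm x₀ ε := ⟨hKp hx, hpos⟩
  rw [betaPower_poleWeight, ← integral_const_mul]
  refine norm_integral_le_of_norm_le ((integrable_rho_rpow hnm hx₀ hb hreg c).const_mul C) ?_
  filter_upwards [ae_betaProd_mem_Icc hb] with t ht
  exact hC _ (rho_add_pos hnm hx₀ hreg ht) (by linarith [hR x hx t ht])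

/-- Averages the pointwise expansion of the radial solution at zero. The constant is uniform in x ∈
K and in ε ≤ 1 because ρ + ε stays bounded. -/
theorem exists_norm_rhoIntegral_sub_le (hx₀ : x₀ ∈ posDomain hnm) (hb : ∀ j, 0 < b j) (κ : ℂ)
    {c : ℝ} (hc : (c : ℂ) ∈ Complex.integerComplement) {K : Set (EuclideanSpace ℝ (Fin m))}
    (hK : IsCompact K) (hKp : K ⊆ posDomain hnm) :
    ∃ C : ℝ, 0 ≤ C ∧ ∀ x ∈ K, ∀ ε : ℝ, ε ≤ 1 → 0 < rSq x₀ x + ε →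
      ‖rhoIntegral hnm x₀ ε κ c b x -
        ((Real.Gamma c * betaPower b c (rSq x₀ x + ε) (poleWeight hnm x₀ x) : ℝ) : ℂ)‖ ≤
        C * betaPower b (c - 1) (rSq x₀ x + ε) (poleWeight hnm x₀ x) := by
  obtain ⟨R, hR⟩ := exists_rho_le hnm x₀ hK
  obtain ⟨C, hC0, hC⟩ := exists_norm_radialSol_sub_le κ hc (R + 1)
  refine ⟨C, hC0, fun x hx ε hε hpos => ?_⟩
  have hreg : x ∈ regDomain hnm x₀ ε := ⟨hKp hx, hpos⟩
  rw [betaPower_poleWeight, betaPower_poleWeight, ← integral_const_mul, ← integral_const_mul,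
    ← integral_complex_ofReal, rhoIntegral, ← integral_sub]
  · refine norm_integral_le_of_norm_le
      ((integrable_rho_rpow hnm hx₀ hb hreg (c - 1)).const_mul C) ?_
    filter_upwards [ae_betaProd_mem_Icc hb] with t ht
    have hp := rho_add_pos hnm hx₀ hreg ht
    refine (hC _ hp (by linarith [hR x hx t ht])).trans_eq ?_
    rw [← Real.rpow_one_add' hp.le]
    · congr 2
      ring
    -- The exponent 1 - c is non-zero because c is not an integer.
    · intro h
      have : c = 1 := by linarith
      subst this
      exact hc ⟨1, by simp⟩
  · exact integrable_betaProd_of_continuousOn hb (continuousOn_radialSol_rho_right hnm hx₀ κ hc hreg)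
  · exact ((integrable_rho_rpow hnm hx₀ hb hreg c).const_mul _).ofReal

theorem tendsto_rhoIntegral (hx₀ : x₀ ∈ posDomain hnm) (hb : ∀ j, 0 < b j) (κ : ℂ) {c : ℝ}
    (hc0 : 0 < c) (hc : (c : ℂ) ∈ Complex.integerComplement) {x : EuclideanSpace ℝ (Fin m)}
    (hx : x ∈ regDomain hnm x₀ 0) :
    Tendsto (fun ε => rhoIntegral hnm x₀ ε κ c b x) (𝓝[>] 0) (𝓝 (rhoIntegral hnm x₀ 0 κ c b x)) := by
  obtain ⟨R, hR⟩ := exists_rho_le hnm x₀ (isCompact_singleton (x := x))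
  obtain ⟨C, hC0, hC⟩ := exists_norm_radialSol_le κ hc (R + 1)
  have hreg : ∀ ε : ℝ, 0 ≤ ε → x ∈ regDomain hnm x₀ ε := fun ε hε => ⟨hx.1, by linarith [hx.2]⟩
  have hε0 : ∀ᶠ ε : ℝ in 𝓝[>] 0, 0 < ε := self_mem_nhdsWithin
  have hε1 : ∀ᶠ ε : ℝ in 𝓝[>] 0, ε < 1 :=
    (tendsto_id.mono_left nhdsWithin_le_nhds).eventually_lt_const one_pos
  refine tendsto_integral_filter_of_dominated_convergence
    (fun t => C * (rho hnm x₀ x t + 0) ^ (-c)) ?_ ?_ ?_ ?_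
  · filter_upwards [hε0] with ε hε
    exact (integrable_betaProd_of_continuousOn hb
      (continuousOn_radialSol_rho_right hnm hx₀ κ hc (hreg ε hε.le))).aestronglyMeasurable
  · filter_upwards [hε0, hε1] with ε hε hε'
    filter_upwards [ae_betaProd_mem_Icc hb] with t ht
    refine (hC _ (rho_add_pos hnm hx₀ (hreg ε hε.le) ht)
      (by linarith [hR x rfl t ht])).trans ?_
    gcongr ?_ * ?_
    exact Real.rpow_le_rpow_of_nonpos (rho_add_pos hnm hx₀ hx ht) (by linarith) (by linarith)
  · exact (integrable_rho_rpow hnm hx₀ hb hx c).const_mul C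
  · filter_upwards [ae_betaProd_mem_Icc hb] with t ht
    have h1 : ContinuousAt (radialSol κ c) ((rho hnm x₀ x t + 0 : ℝ) : ℂ) :=
      (hasDerivAt_radialSol κ hc
        (Complex.ofReal_mem_slitPlane.2 (rho_add_pos hnm hx₀ hx ht))).continuousAt
    refine h1.tendsto.comp ?_
    refine (Complex.continuous_ofReal.tendsto _).comp ?_
    exact tendsto_const_nhds.add (tendsto_id.mono_left nhdsWithin_le_nhds)

theorem integrableOn_rSq_rpow (hm : 0 < m) (x₀ : EuclideanSpace ℝ (Fin m))
    {K : Set (EuclideanSpace ℝ (Fin m))} (hK : IsCompact K) {q : ℝ} (hq : 2 * q < m) :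
    IntegrableOn (fun x => rSq x₀ x ^ (-q)) K := by
  obtain ⟨r, hr⟩ := hK.isBounded.subset_ball x₀
  refine IntegrableOn.mono_set ?_ hr
  have : NeZero m := ⟨hm.ne'⟩
  have h1 : IntegrableOn (fun x : EuclideanSpace ℝ (Fin m) => (‖x‖ ^ 2) ^ (-q))
      (Metric.ball 0 r) := by
    refine (integrableOn_fun_norm_addHaar volume (f := fun y : ℝ => (y ^ 2) ^ (-q))).2 ?_
    rw [finrank_euclideanSpace_fin]
    rcases le_or_gt r 0 with h | h
    · simp [Ioo_eq_empty (not_lt.2 h)]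
    have h2 := intervalIntegral.intervalIntegrable_rpow' (a := 0) (b := r) (r := (m : ℝ) - 1 - 2 * q)
      (by linarith)
    rw [intervalIntegrable_iff_integrableOn_Ioo_of_le h.le] at h2
    refine h2.congr_fun (fun y hy => ?_) measurableSet_Ioo
    have hy : 0 < y := hy.1
    simp only [smul_eq_mul]
    rw [← Real.rpow_natCast, ← Real.rpow_natCast, ← Real.rpow_mul hy.le, ← Real.rpow_add hy,
      Nat.cast_sub hm]
    congr 1
    push_cast
    ring
  have h3 := (measurePreserving_sub_right (volume : Measure (EuclideanSpace ℝ (Fin m))) x₀)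
    |>.integrableOn_comp_preimage (MeasurableEquiv.subRight x₀).measurableEmbedding |>.2 h1
  have e : (fun x => x - x₀) ⁻¹' Metric.ball 0 r = Metric.ball x₀ r := by
    ext x
    simp [dist_eq_norm]
  rw [e] at h3
  refine h3.congr_fun (fun x _ => ?_) Metric.isOpen_ball.measurableSet
  simp [rSq_eq_norm_sq]

end RhoBounds

/-! ### The singularity as a distribution -/

/-- A Gamma integral over s turns the power into the Gaussian integral (π/s)^{m/2}. The exponent m/2
+ 1 is the one for which the powers of s cancel and only e^{-s} remains. -/
theorem integral_one_add_norm_sq_rpow (m : ℕ) :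
    Real.Gamma ((m : ℝ) / 2 + 1) *
      ∫ y : EuclideanSpace ℝ (Fin m), (1 + ‖y‖ ^ 2) ^ (-((m : ℝ) / 2 + 1)) =
        Real.pi ^ ((m : ℝ) / 2) := by
  have hc : 0 < (m : ℝ) / 2 + 1 := by positivity
  have h1 : Real.Gamma ((m : ℝ) / 2 + 1) *
      ∫ y : EuclideanSpace ℝ (Fin m), (1 + ‖y‖ ^ 2) ^ (-((m : ℝ) / 2 + 1)) =
      ∫ y : EuclideanSpace ℝ (Fin m), ∫ s in Ioi (0 : ℝ),
        s ^ ((m : ℝ) / 2 + 1 - 1) * Real.exp (-((1 + ‖y‖ ^ 2) * s)) := by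
    rw [← integral_const_mul]
    congr 1 with y
    have hy : 0 < 1 + ‖y‖ ^ 2 := by positivity
    rw [Real.integral_rpow_mul_exp_neg_mul_Ioi hc hy, one_div, Real.inv_rpow hy.le,
      Real.rpow_neg hy.le, mul_comm]
  have hinner : ∀ s : ℝ, 0 < s → ∫ y : EuclideanSpace ℝ (Fin m),
      s ^ ((m : ℝ) / 2 + 1 - 1) * Real.exp (-((1 + ‖y‖ ^ 2) * s)) =
      Real.pi ^ ((m : ℝ) / 2) * Real.exp (-s) := by
    intro s hs
    have e : ∀ y : EuclideanSpace ℝ (Fin m), s ^ ((m : ℝ) / 2 + 1 - 1) *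
        Real.exp (-((1 + ‖y‖ ^ 2) * s)) =
        s ^ ((m : ℝ) / 2) * Real.exp (-s) * Real.exp (-s * ‖y‖ ^ 2) := fun y => by
      rw [mul_assoc, ← Real.exp_add, add_sub_cancel_right]
      congr 2
      ring
    simp only [e]
    rw [integral_const_mul, GaussianFourier.integral_rexp_neg_mul_sq_norm hs,
      finrank_euclideanSpace_fin, Real.div_rpow Real.pi_pos.le hs.le]
    field_simp
  have hint : Integrable (Function.uncurry fun (y : EuclideanSpace ℝ (Fin m)) (s : ℝ) =>
      s ^ ((m : ℝ) / 2 + 1 - 1) * Real.exp (-((1 + ‖y‖ ^ 2) * s)))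
      (volume.prod (volume.restrict (Ioi 0))) := by
    have hmeas : Measurable (Function.uncurry fun (y : EuclideanSpace ℝ (Fin m)) (s : ℝ) =>
        s ^ ((m : ℝ) / 2 + 1 - 1) * Real.exp (-((1 + ‖y‖ ^ 2) * s))) := by
      unfold Function.uncurry
      fun_prop
    refine (integrable_prod_iff' hmeas.aestronglyMeasurable).2 ⟨?_, ?_⟩
    · filter_upwards [ae_restrict_mem measurableSet_Ioi] with s hs
      have hs : 0 < s := hs
      -- The Bochner integral of a non-integrable function is 0 by convention, so the non-zero
      -- Gaussian value already proves integrability.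
      refine Integrable.of_integral_ne_zero ?_
      simp only [Function.uncurry]
      rw [hinner s hs]
      positivity
    · have h2 : IntegrableOn (fun s : ℝ => Real.pi ^ ((m : ℝ) / 2) * Real.exp (-s)) (Ioi 0) :=
        (integrableOn_exp_neg_Ioi 0).const_mul _
      refine h2.congr_fun (fun s hs => ?_) measurableSet_Ioi
      have hs : 0 < s := hs
      simp only [Function.uncurry]
      rw [← hinner s hs]
      congr 1 with y
      rw [Real.norm_of_nonneg (by positivity)]
  rw [h1, integral_integral_swap hint, setIntegral_congr_fun measurableSet_Ioi fun s hs => hinner s hs,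
    integral_const_mul, integral_exp_neg_Ioi_zero, mul_one]

theorem radialSol_zero_left {c : ℂ} (hc : c ∈ Complex.integerComplement) (z : ℂ) :
    radialSol 0 c z = Complex.Gamma c * z ^ (-c) := by
  rw [radialSol, zero_mul, gammaSeries_zero hc, mul_comm]

section TestFunctions

variable {n m : ℕ} {U : Set (EuclideanSpace ℝ (Fin m))} {f g : EuclideanSpace ℝ (Fin m) → ℂ}

theorem IsTestFunction.of_support (hg : IsTestFunction U g) (hf : ContDiff ℝ (⊤ : ℕ∞) f)
    (h : ∀ x ∉ tsupport g, f x = 0) : IsTestFunction U f := by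
  have hs : tsupport f ⊆ tsupport g := by
    refine closure_minimal (fun x hx => ?_) (isClosed_tsupport g)
    by_contra hxg
    exact hx (h x hxg)
  exact ⟨hf, hg.hasCompactSupport.of_isClosed_subset (isClosed_tsupport f) hs,
    hs.trans hg.tsupport_subset⟩

theorem IsTestFunction.helmholtzAdjoint (hnm : n ≤ m) (hg : IsTestFunction U g) (hU : IsOpen U)
    (hUp : U ⊆ posDomain hnm) {p : ℕ} (α : Fin n → ℝ) (lam : Fin p → ℂ) :
    IsTestFunction U (helmholtzAdjoint hnm α lam g) := by
  have hψ := hg.div_coord hnm hU hUp α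
  refine hg.of_support ?_ fun x hx => ?_
  · refine ((ContDiff.sum fun i _ => ((hg.pd i).pd i).contDiff).sub
      (ContDiff.sum fun j _ => ((hψ j).pd _).contDiff)).sub (contDiff_const.mul hg.contDiff)
  · have h0 : g x = 0 := image_eq_zero_of_notMem_tsupport hx
    have h1 : ∀ i, _root_.pd i (_root_.pd i g) x = 0 := fun i =>
      image_eq_zero_of_notMem_tsupport fun h =>
        hx (tsupport_pd_subset g i (tsupport_pd_subset _ i h))
    have h2 : ∀ j, _root_.pd (Fin.castLE hnm j)
        (fun y => ((2 * α j / y (Fin.castLE hnm j) : ℝ) : ℂ) * g y) x = 0 := fun j =>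
      image_eq_zero_of_notMem_tsupport fun h =>
        hx (tsupport_mul_subset_right (tsupport_pd_subset _ _ h))
    rw [_root_.helmholtzAdjoint, Finset.sum_congr rfl fun i _ => h1 i,
      Finset.sum_congr rfl fun j _ => h2 j]
    simp [h0]

end TestFunctions

section Distribution

variable {n m : ℕ} (hnm : n ≤ m) {x₀ : EuclideanSpace ℝ (Fin m)} {b : Fin n → ℝ}

theorem rhoIntegral_zero_kappa (hx₀ : x₀ ∈ posDomain hnm) (hb : ∀ j, 0 < b j) {ε : ℝ} {c : ℝ}
    (hcc : (c : ℂ) ∈ Complex.integerComplement) {x : EuclideanSpace ℝ (Fin m)} (hx : x ∈ regDomain hnm x₀ ε) :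
    rhoIntegral hnm x₀ ε 0 c b x =
      ((Real.Gamma c * betaPower b c (rSq x₀ x + ε) (poleWeight hnm x₀ x) : ℝ) : ℂ) := by
  rw [betaPower_poleWeight, ← integral_const_mul, ← integral_complex_ofReal, rhoIntegral]
  refine integral_congr_ae ?_
  filter_upwards [ae_betaProd_mem_Icc hb] with t ht
  have hp := rho_add_pos hnm hx₀ hx ht
  rw [radialSol_zero_left hcc, Complex.ofReal_mul, Complex.Gamma_ofReal, Complex.ofReal_cpow hp.le]
  push_cast
  rfl

/-- Supplies one locally integrable majorant r^{-2q} that works for all m ≥ 2, including the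
logarithmic case. The shift d also covers the regularised kernels. -/
theorem exists_betaPower_le_near_pole (hm : 2 ≤ m) (hb : ∀ j, 0 < b j) (hb1 : ∀ j, b j ≤ 1)
    (hB : 0 < ∑ j, b j) {c₀ : ℝ} (hc₀ : 0 < c₀) {a : ℝ} (ha : a = (m : ℝ) / 2 - 1 + ∑ j, b j) :
    ∃ q : ℝ, 0 ≤ q ∧ 2 * q < m ∧ ∀ d : ℝ, 0 ≤ d → ∃ C : ℝ, 0 < C ∧ ∀ w : Fin n → ℝ,
      (∀ j, c₀ ≤ w j) → ∀ R : ℝ, 0 < R → betaPower b (a + d) R w ≤ C * R ^ (-(q + d)) := by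
  have hm' : (2 : ℝ) ≤ m := by exact_mod_cast hm
  set B := ∑ j, b j
  -- The gain stays strictly below B because for m = 2 and d = 0 the exponent a equals B. Losing at
  -- most 1/2 still leaves 2q ≤ m - 1.
  set θ := max 0 (B - 1 / 2) with hθ
  have h1 : 0 ≤ θ := le_max_left _ _
  have h2 : θ < B := max_lt hB (by linarith)
  have h3 : B - 1 / 2 ≤ θ := le_max_right _ _
  refine ⟨a - θ, by linarith, by linarith, fun d hd => ?_⟩
  obtain ⟨C, hC0, hC⟩ := exists_betaPower_le hb hb1 hc₀ (c := a + d) h1 h2.le (by linarith)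
  refine ⟨C, hC0, fun w hw R hR => (hC w hw R hR).trans_eq ?_⟩
  congr 2
  ring

theorem regDomain_of_pos {ε : ℝ} (hε : 0 < ε) (x₀ : EuclideanSpace ℝ (Fin m)) :
    regDomain hnm x₀ ε = posDomain hnm := by
  ext x
  exact ⟨fun h => h.1, fun h => ⟨h, by linarith [rSq_nonneg x₀ x]⟩⟩

theorem regDomain_zero (x₀ : EuclideanSpace ℝ (Fin m)) :
    regDomain hnm x₀ 0 = posDomain hnm \ {x₀} := by
  ext x
  refine ⟨fun h => ⟨h.1, ?_⟩, fun h => ⟨h.1, by linarith [rSq_pos x₀ h.2]⟩⟩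
  rintro rfl
  have := h.2
  simp [rSq] at this

theorem integrableOn_rhoIntegral (hm : 2 ≤ m) (hx₀ : x₀ ∈ posDomain hnm) (hb : ∀ j, 0 < b j)
    (hb1 : ∀ j, b j ≤ 1) (hB : 0 < ∑ j, b j) (κ : ℂ) {a : ℝ}
    (ha : a = (m : ℝ) / 2 - 1 + ∑ j, b j) (hac : (a : ℂ) ∈ Complex.integerComplement)
    {K : Set (EuclideanSpace ℝ (Fin m))} (hK : IsCompact K) (hKp : K ⊆ posDomain hnm) :
    IntegrableOn (rhoIntegral hnm x₀ 0 κ a b) K := by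
  have : NeZero m := ⟨by omega⟩
  obtain ⟨c₀, hc₀, hw⟩ := exists_le_poleWeight hnm hx₀ hK hKp
  obtain ⟨q, hq0, hq, hd⟩ := exists_betaPower_le_near_pole hm hb hb1 hB hc₀ ha
  obtain ⟨C₁, hC₁0, hC₁⟩ := hd 0 le_rfl
  obtain ⟨C₂, hC₂0, hC₂⟩ := exists_norm_rhoIntegral_le hnm hx₀ hb κ hac hK hKp
  have hI : IntegrableOn (fun x => C₂ * C₁ * rSq x₀ x ^ (-q)) K :=
    (integrableOn_rSq_rpow (by omega) x₀ hK hq).const_mul (C₂ * C₁)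
  have hKm : MeasurableSet K := hK.isClosed.measurableSet
  have hset : (K \ {x₀} : Set _) =ᵐ[volume] K := sdiff_null_ae_eq_self (measure_singleton x₀)
  refine IntegrableOn.congr_set_ae ?_ hset.symm
  have hsub : K \ {x₀} ⊆ regDomain hnm x₀ 0 := by
    rw [regDomain_zero]
    exact sdiff_le_sdiff_right hKp
  refine Integrable.mono' (hI.mono_set sdiff_subset) ?_ ?_
  · exact ((analyticOnNhd_rhoIntegral hnm hx₀ hb 0 κ hac).continuousOn.mono hsub).aestronglyMeasurable
      (hKm.diff (measurableSet_singleton _))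
  · filter_upwards [ae_restrict_mem (hKm.diff (measurableSet_singleton x₀))] with x hx
    have hp := (hsub hx).2
    refine (hC₂ x hx.1 0 zero_le_one hp).trans ?_
    have := hC₁ _ (hw x hx.1) _ hp
    simp only [add_zero] at this ⊢
    rw [mul_assoc]
    gcongr

theorem tendsto_integral_rhoIntegral_mul (hm : 2 ≤ m) (hx₀ : x₀ ∈ posDomain hnm)
    (hb : ∀ j, 0 < b j) (hb1 : ∀ j, b j ≤ 1) (hB : 0 < ∑ j, b j) (κ : ℂ) {a : ℝ}
    (ha : a = (m : ℝ) / 2 - 1 + ∑ j, b j) (hac : (a : ℂ) ∈ Complex.integerComplement)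
    {g : EuclideanSpace ℝ (Fin m) → ℂ} (hg : IsTestFunction (posDomain hnm) g) :
    Tendsto (fun ε => ∫ x, rhoIntegral hnm x₀ ε κ a b x * g x) (𝓝[>] 0)
      (𝓝 (∫ x, rhoIntegral hnm x₀ 0 κ a b x * g x)) := by
  have : NeZero m := ⟨by omega⟩
  have hm' : (2 : ℝ) ≤ m := by exact_mod_cast hm
  set K := tsupport g
  have hK : IsCompact K := hg.hasCompactSupport
  have hKp : K ⊆ posDomain hnm := hg.tsupport_subset
  obtain ⟨c₀, hc₀, hw⟩ := exists_le_poleWeight hnm hx₀ hK hKp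
  obtain ⟨q, hq0, hq, hd⟩ := exists_betaPower_le_near_pole hm hb hb1 hB hc₀ ha
  obtain ⟨C₁, hC₁0, hC₁⟩ := hd 0 le_rfl
  obtain ⟨C₂, hC₂0, hC₂⟩ := exists_norm_rhoIntegral_le hnm hx₀ hb κ hac hK hKp
  obtain ⟨M, hM⟩ := hg.contDiff.continuous.bounded_above_of_compact_support hg.hasCompactSupport
  have hM0 : 0 ≤ M := (norm_nonneg _).trans (hM x₀)
  have hI := (integrableOn_rSq_rpow (by omega) x₀ hK hq).const_mul (C₂ * C₁ * M)
  have hKm : MeasurableSet K := hK.isClosed.measurableSet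
  have hε0 : ∀ᶠ ε : ℝ in 𝓝[>] 0, 0 < ε := self_mem_nhdsWithin
  have hε1 : ∀ᶠ ε : ℝ in 𝓝[>] 0, ε < 1 :=
    (tendsto_id.mono_left nhdsWithin_le_nhds).eventually_lt_const one_pos
  have hne : ∀ᵐ x : EuclideanSpace ℝ (Fin m), x ≠ x₀ := by
    rw [ae_iff]
    simp
  refine tendsto_integral_filter_of_dominated_convergence
    (K.indicator fun x => C₂ * C₁ * M * rSq x₀ x ^ (-q)) ?_ ?_ ((integrable_indicator_iff hKm).2 hI) ?_
  · filter_upwards [hε0] with ε hε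
    refine (hg.integrable_mul ?_).aestronglyMeasurable
    rw [← regDomain_of_pos hnm hε x₀]
    exact (analyticOnNhd_rhoIntegral hnm hx₀ hb ε κ hac).continuousOn
  · filter_upwards [hε0, hε1] with ε hε hε'
    filter_upwards [hne] with x hx
    by_cases hxK : x ∈ K
    · have hp : 0 < rSq x₀ x := rSq_pos x₀ hx
      rw [indicator_of_mem hxK, norm_mul]
      have h1 := hC₂ x hxK ε hε'.le (by linarith)
      have h2 := hC₁ _ (hw x hxK) (rSq x₀ x + ε) (by linarith)
      have h3 : (rSq x₀ x + ε) ^ (-q) ≤ rSq x₀ x ^ (-q) :=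
        Real.rpow_le_rpow_of_nonpos hp (by linarith) (by linarith)
      simp only [add_zero] at h2
      calc _ ≤ (C₂ * (C₁ * rSq x₀ x ^ (-q))) * M :=
            mul_le_mul (h1.trans (by gcongr; exact h2.trans (by gcongr))) (hM x) (norm_nonneg _)
              (by positivity)
        _ = _ := by ring
    · rw [indicator_of_notMem hxK, image_eq_zero_of_notMem_tsupport hxK, mul_zero, norm_zero]
  · filter_upwards [hne] with x hx
    by_cases hxK : x ∈ K
    · refine (tendsto_rhoIntegral hnm hx₀ hb κ (by linarith) hac ?_).mul_const _
      rw [regDomain_zero]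
      exact ⟨hKp hxK, hx⟩
    · simp only [image_eq_zero_of_notMem_tsupport hxK, mul_zero]
      exact tendsto_const_nhds

/-- An approximate identity: with x = x₀ + √ε y one has r² + ε = ε(1 + |y|²), and the Jacobian
together with the factor ε gives ε^{m/2+1}, the inverse of the size of the average. The limit
profile (1 + |y|²)^{-(m/2+1)} has mass π^{m/2} / Γ(m/2 + 1), and the Gamma factor cancels. -/
theorem tendsto_integral_betaPower_mul (hx₀ : x₀ ∈ posDomain hnm)
    (hb : ∀ j, 0 < b j) (hb1 : ∀ j, b j ≤ 1) {c : ℝ} (hc : c = (m : ℝ) / 2 + 1 + ∑ j, b j)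
    (hcc : (c : ℂ) ∈ Complex.integerComplement)
    {g : EuclideanSpace ℝ (Fin m) → ℂ} (hg : IsTestFunction (posDomain hnm) g) :
    Tendsto (fun ε : ℝ => ∫ x, ((ε : ℂ) * rhoIntegral hnm x₀ ε 0 c b x) * g x) (𝓝[>] 0)
      (𝓝 (((Real.pi ^ ((m : ℝ) / 2) * betaLimit b (poleWeight hnm x₀ x₀) : ℝ) : ℂ) * g x₀)) := by
  set K := tsupport g
  have hK : IsCompact K := hg.hasCompactSupport
  have hKp : K ⊆ posDomain hnm := hg.tsupport_subset
  obtain ⟨c₀, hc₀, hw⟩ := exists_le_poleWeight hnm hx₀ hK hKp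
  obtain ⟨M, hM⟩ := hg.contDiff.continuous.bounded_above_of_compact_support hg.hasCompactSupport
  have hM0 : 0 ≤ M := (norm_nonneg _).trans (hM x₀)
  have hB0 : 0 ≤ ∑ j, b j := Finset.sum_nonneg fun j _ => (hb j).le
  have hcB : c - ∑ j, b j = (m : ℝ) / 2 + 1 := by rw [hc]; ring
  have hc0 : 0 < c := by rw [hc]; positivity
  obtain ⟨C, hC0, hC⟩ := exists_betaPower_le hb hb1 hc₀ (c := c) hB0 le_rfl (by rw [hc]; linarith [(Nat.cast_nonneg m : (0 : ℝ) ≤ m)])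
  rw [hcB] at hC
  have hG := Real.Gamma_pos_of_pos hc0
  have hε0 : ∀ᶠ ε : ℝ in 𝓝[>] 0, 0 < ε := self_mem_nhdsWithin
  let P : EuclideanSpace ℝ (Fin m) → ℝ := fun y => (1 + ‖y‖ ^ 2) ^ (-((m : ℝ) / 2 + 1))
  -- The average normalised by its expected size: bounded uniformly in y and ε where the test
  -- function does not vanish, and convergent as ε → 0.
  let G : ℝ → EuclideanSpace ℝ (Fin m) → ℝ := fun ε y =>
    (ε * (1 + ‖y‖ ^ 2)) ^ ((m : ℝ) / 2 + 1) * (Real.Gamma c *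
      betaPower b c (ε * (1 + ‖y‖ ^ 2)) (poleWeight hnm x₀ (x₀ + √ε • y)))
  have hPI : Integrable P := by
    have := integrable_rpow_neg_one_add_norm_sq (E := EuclideanSpace ℝ (Fin m)) (μ := volume)
      (r := (m : ℝ) + 2) (by simp)
    refine this.congr (ae_of_all _ fun y => ?_)
    simp only [P]
    congr 1
    ring
  have hGP : ∀ y, P y * (1 + ‖y‖ ^ 2) ^ ((m : ℝ) / 2 + 1) = 1 := fun y => by
    have : 0 < 1 + ‖y‖ ^ 2 := by positivity
    simp only [P]
    rw [← Real.rpow_add this, neg_add_cancel, Real.rpow_zero]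
  have hzero : ∀ y : EuclideanSpace ℝ (Fin m), Tendsto (fun ε : ℝ => x₀ + √ε • y) (𝓝[>] 0) (𝓝 x₀) := by
    intro y
    have h : Continuous fun ε : ℝ => x₀ + √ε • y := by fun_prop
    have := h.tendsto 0
    simp only [Real.sqrt_zero, zero_smul, add_zero] at this
    exact this.mono_left nhdsWithin_le_nhds
  have hr : ∀ ε : ℝ, 0 < ε → ∀ y, rSq x₀ (x₀ + √ε • y) + ε = ε * (1 + ‖y‖ ^ 2) := fun ε hε y => by
    rw [rSq_eq_norm_sq, add_sub_cancel_left, norm_smul, mul_pow, Real.norm_of_nonneg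
      (Real.sqrt_nonneg _), Real.sq_sqrt hε.le]
    ring
  have hpt : ∀ ε : ℝ, 0 < ε → ∀ y, ((√ε ^ m : ℝ) : ℂ) *
      (((ε : ℂ) * rhoIntegral hnm x₀ ε 0 c b (x₀ + √ε • y)) * g (x₀ + √ε • y)) =
      ((P y * G ε y : ℝ) : ℂ) * g (x₀ + √ε • y) := by
    intro ε hε y
    by_cases hxK : x₀ + √ε • y ∈ K
    · have hreg : x₀ + √ε • y ∈ regDomain hnm x₀ ε := by
        rw [regDomain_of_pos hnm hε]
        exact hKp hxK
      rw [rhoIntegral_zero_kappa hnm hx₀ hb hcc hreg, hr ε hε y, ← mul_assoc, ← Complex.ofReal_mul,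
        ← Complex.ofReal_mul]
      congr 2
      simp only [G]
      have e1 : √ε ^ m * ε = ε ^ ((m : ℝ) / 2 + 1) := by
        rw [Real.rpow_add_one hε.ne', Real.sqrt_eq_rpow, ← Real.rpow_natCast, ← Real.rpow_mul hε.le]
        congr 2
        ring
      rw [← mul_assoc, e1, Real.mul_rpow hε.le (by positivity)]
      linear_combination (-(ε ^ ((m : ℝ) / 2 + 1) * (Real.Gamma c * betaPower b c
        (ε * (1 + ‖y‖ ^ 2)) (poleWeight hnm x₀ (x₀ + √ε • y))))) * hGP y
    · rw [image_eq_zero_of_notMem_tsupport hxK]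
      simp
  have hsub : ∀ ε : ℝ, 0 < ε → ∫ x, ((ε : ℂ) * rhoIntegral hnm x₀ ε 0 c b x) * g x =
      ∫ y, ((P y * G ε y : ℝ) : ℂ) * g (x₀ + √ε • y) := by
    intro ε hε
    simp only [← hpt ε hε]
    rw [integral_const_mul]
    have h1 := Measure.integral_comp_smul (volume : Measure (EuclideanSpace ℝ (Fin m)))
      (fun y => ((ε : ℂ) * rhoIntegral hnm x₀ ε 0 c b (x₀ + y)) * g (x₀ + y)) √ε
    have h2 := integral_add_left_eq_self (μ := (volume : Measure (EuclideanSpace ℝ (Fin m))))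
      (fun x => ((ε : ℂ) * rhoIntegral hnm x₀ ε 0 c b x) * g x) x₀
    have hs : 0 < √ε := Real.sqrt_pos.2 hε
    rw [h1, h2, finrank_euclideanSpace_fin, abs_of_pos (by positivity), Complex.real_smul,
      ← mul_assoc, ← Complex.ofReal_mul, mul_inv_cancel₀ (by positivity), Complex.ofReal_one, one_mul]
  have hlim : Tendsto (fun ε => ∫ y, ((P y * G ε y : ℝ) : ℂ) * g (x₀ + √ε • y)) (𝓝[>] 0)
      (𝓝 (∫ y, ((P y * (Real.Gamma ((m : ℝ) / 2 + 1) *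
        betaLimit b (poleWeight hnm x₀ x₀)) : ℝ) : ℂ) * g x₀)) := by
    refine tendsto_integral_filter_of_dominated_convergence
      (fun y => Real.Gamma c * C * M * P y) ?_ ?_ (hPI.const_mul _) ?_
    · filter_upwards [hε0] with ε hε
      simp only [← hpt ε hε]
      refine AEStronglyMeasurable.const_mul ?_ _
      have hcs : Continuous fun x => (ε : ℂ) * (rhoIntegral hnm x₀ ε 0 c b x * g x) := by
        refine continuous_const.mul (IsTestFunction.contDiff
          (hg.mul_left (isOpen_posDomain hnm) ?_)).continuous
        rw [← regDomain_of_pos hnm hε x₀]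
        exact (analyticOnNhd_rhoIntegral hnm hx₀ hb ε 0 hcc).contDiffOn
          (isOpen_regDomain hnm ε).uniqueDiffOn
      simp only [mul_assoc]
      exact (hcs.comp (by fun_prop : Continuous fun y => x₀ + √ε • y)).aestronglyMeasurable
    · filter_upwards [hε0] with ε hε
      refine ae_of_all _ fun y => ?_
      have hP0 : 0 ≤ P y := by positivity
      by_cases hxK : x₀ + √ε • y ∈ K
      · have hR : 0 < ε * (1 + ‖y‖ ^ 2) := by positivity
        have hbp := hC _ (hw _ hxK) _ hR
        have hw0 : ∀ j, 0 ≤ poleWeight hnm x₀ (x₀ + √ε • y) j := fun j => hc₀.le.trans (hw _ hxK j)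
        have hbn := betaPower_nonneg hb c hR.le hw0
        have hG0 : 0 ≤ G ε y := by
          have := betaPower_nonneg hb c hR.le hw0
          simp only [G]
          positivity
        have hGC : G ε y ≤ Real.Gamma c * C := by
          calc G ε y ≤ (ε * (1 + ‖y‖ ^ 2)) ^ ((m : ℝ) / 2 + 1) * (Real.Gamma c *
                (C * (ε * (1 + ‖y‖ ^ 2)) ^ (-((m : ℝ) / 2 + 1)))) := by
                simp only [G]
                gcongr
            _ = Real.Gamma c * C * ((ε * (1 + ‖y‖ ^ 2)) ^ ((m : ℝ) / 2 + 1) *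
                (ε * (1 + ‖y‖ ^ 2)) ^ (-((m : ℝ) / 2 + 1))) := by ring
            _ = _ := by rw [← Real.rpow_add hR, add_neg_cancel, Real.rpow_zero, mul_one]
        rw [norm_mul, Complex.norm_real, Real.norm_of_nonneg (mul_nonneg hP0 hG0)]
        calc _ ≤ P y * (Real.Gamma c * C) * M :=
              mul_le_mul (by gcongr) (hM _) (norm_nonneg _) (by positivity)
          _ = _ := by ring
      · rw [image_eq_zero_of_notMem_tsupport hxK, mul_zero, norm_zero]
        positivity
    · refine ae_of_all _ fun y => ?_
      refine Tendsto.mul ?_ ((hg.contDiff.continuous.tendsto x₀).comp (hzero y))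
      refine (Complex.continuous_ofReal.tendsto _).comp (Tendsto.const_mul _ ?_)
      have h := tendsto_rpow_mul_betaPower hb hb1 (c := c) (by rw [hc]; linarith [(Nat.cast_nonneg m : (0 : ℝ) ≤ m)]) (l := 𝓝[>] (0 : ℝ))
        (R := fun ε => ε * (1 + ‖y‖ ^ 2)) (w := fun ε => poleWeight hnm x₀ (x₀ + √ε • y))
        (w₀ := poleWeight hnm x₀ x₀) (fun j => poleWeight_pos hnm hx₀ hx₀ j) ?_
        (((continuous_poleWeight hnm x₀).tendsto x₀).comp (hzero y))
      · rw [hcB] at h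
        exact h
      · refine tendsto_nhdsWithin_iff.2 ⟨?_, ?_⟩
        · have h : Continuous fun ε : ℝ => ε * (1 + ‖y‖ ^ 2) := by fun_prop
          have := h.tendsto 0
          rw [zero_mul] at this
          exact this.mono_left nhdsWithin_le_nhds
        · filter_upwards [hε0] with ε hε
          have : 0 < ε * (1 + ‖y‖ ^ 2) := by positivity
          exact this
  refine (hlim.congr' ?_).trans_eq ?_
  · filter_upwards [hε0] with ε hε using (hsub ε hε).symm
  · congr 1
    rw [integral_mul_const, integral_complex_ofReal, integral_mul_const,
      ← integral_one_add_norm_sq_rpow m]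
    congr 2
    ring

end Distribution

/-! ### The distributional equation as the limit ε → 0 -/

section DistributionLimit

variable {n m : ℕ} (hnm : n ≤ m) {x₀ : EuclideanSpace ℝ (Fin m)} {b : Fin n → ℝ}

theorem analyticOnNhd_powWeight (e : Fin n → ℝ) :
    AnalyticOnNhd ℝ (fun x => (powWeight hnm e x : ℂ)) (posDomain hnm) := by
  intro x hx
  refine (Complex.ofRealCLM.analyticAt _).comp (g := fun y : ℝ => (y : ℂ)) ?_
  have h : ∀ j : Fin n, AnalyticAt ℝ (fun y : EuclideanSpace ℝ (Fin m) =>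
      e j * Real.log (y (Fin.castLE hnm j))) x := fun j => by
    refine analyticAt_const.mul (AnalyticAt.fun_comp (analyticAt_log (hx j)) ?_)
    exact (EuclideanSpace.proj (𝕜 := ℝ) (Fin.castLE hnm j)).analyticAt x
  refine (Finset.analyticAt_fun_sum Finset.univ fun j _ => h j).rexp'.congr ?_
  filter_upwards [(isOpen_posDomain hnm).mem_nhds hx] with y hy using (powWeight_eq_exp hnm e hy).symm

/-- Replacing κ by 0 costs O((r² + ε)^{-(q+1)}). The factor ε absorbs one power, which leaves the
integrable majorant r^{-2q}, while for fixed x ≠ x₀ the product tends to 0. -/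
theorem tendsto_integral_rhoIntegral_sub_mul (hm : 2 ≤ m) (hx₀ : x₀ ∈ posDomain hnm)
    (hb : ∀ j, 0 < b j) (hb1 : ∀ j, b j ≤ 1) (hB : 0 < ∑ j, b j) (κ : ℂ) {a : ℝ}
    (ha : a = (m : ℝ) / 2 - 1 + ∑ j, b j) (hac : ((a + 2 : ℝ) : ℂ) ∈ Complex.integerComplement)
    {g : EuclideanSpace ℝ (Fin m) → ℂ} (hg : IsTestFunction (posDomain hnm) g) :
    Tendsto (fun ε : ℝ => ∫ x, ((ε : ℂ) * (rhoIntegral hnm x₀ ε κ (a + 2 : ℝ) b x -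
      rhoIntegral hnm x₀ ε 0 (a + 2 : ℝ) b x)) * g x) (𝓝[>] 0) (𝓝 0) := by
  have : NeZero m := ⟨by omega⟩
  set K := tsupport g
  have hK : IsCompact K := hg.hasCompactSupport
  have hKp : K ⊆ posDomain hnm := hg.tsupport_subset
  obtain ⟨c₀, hc₀, hw⟩ := exists_le_poleWeight hnm hx₀ hK hKp
  obtain ⟨q, hq0, hq, hd⟩ := exists_betaPower_le_near_pole hm hb hb1 hB hc₀ ha
  obtain ⟨C₁, hC₁0, hC₁⟩ := hd 1 zero_le_one
  obtain ⟨C₂, hC₂0, hC₂⟩ := exists_norm_rhoIntegral_sub_le hnm hx₀ hb κ hac hK hKp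
  obtain ⟨M, hM⟩ := hg.contDiff.continuous.bounded_above_of_compact_support hg.hasCompactSupport
  have hM0 : 0 ≤ M := (norm_nonneg _).trans (hM x₀)
  have hI := (integrableOn_rSq_rpow (by omega) x₀ hK hq).const_mul (C₂ * C₁ * M)
  have hKm : MeasurableSet K := hK.isClosed.measurableSet
  have hε0 : ∀ᶠ ε : ℝ in 𝓝[>] 0, 0 < ε := self_mem_nhdsWithin
  have hε1 : ∀ᶠ ε : ℝ in 𝓝[>] 0, ε < 1 :=
    (tendsto_id.mono_left nhdsWithin_le_nhds).eventually_lt_const one_pos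
  have hne : ∀ᵐ x : EuclideanSpace ℝ (Fin m), x ≠ x₀ := by
    rw [ae_iff]
    simp
  have hbound : ∀ ε : ℝ, 0 < ε → ε < 1 → ∀ x ∈ K, x ≠ x₀ →
      ‖((ε : ℂ) * (rhoIntegral hnm x₀ ε κ (a + 2 : ℝ) b x -
        rhoIntegral hnm x₀ ε 0 (a + 2 : ℝ) b x)) * g x‖ ≤
        C₂ * C₁ * M * (ε * (rSq x₀ x + ε) ^ (-(q + 1))) := by
    intro ε hε hε' x hxK hx
    have hp : 0 < rSq x₀ x + ε := by linarith [rSq_pos x₀ hx]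
    rw [rhoIntegral_zero_kappa hnm hx₀ hb hac ⟨hKp hxK, hp⟩, norm_mul, norm_mul,
      Complex.norm_real, Real.norm_of_nonneg hε.le]
    have h1 := hC₂ x hxK ε hε'.le hp
    have h2 := hC₁ _ (hw x hxK) (rSq x₀ x + ε) hp
    have e : a + 2 - 1 = a + 1 := by ring
    rw [e] at h1
    calc _ ≤ ε * (C₂ * (C₁ * (rSq x₀ x + ε) ^ (-(q + 1)))) * M := by
          gcongr
          · exact h1.trans (by gcongr)
          · exact hM x
      _ = _ := by ring
  have h0 : 𝓝 (0 : ℂ) = 𝓝 (∫ _ : EuclideanSpace ℝ (Fin m), (0 : ℂ)) := by simp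
  rw [h0]
  refine tendsto_integral_filter_of_dominated_convergence
    (K.indicator fun x => C₂ * C₁ * M * rSq x₀ x ^ (-q)) ?_ ?_ ((integrable_indicator_iff hKm).2 hI) ?_
  · filter_upwards [hε0] with ε hε
    refine (hg.integrable_mul (continuousOn_const.mul (ContinuousOn.sub ?_ ?_))).aestronglyMeasurable
    all_goals
      rw [← regDomain_of_pos hnm hε x₀]
      exact (analyticOnNhd_rhoIntegral hnm hx₀ hb ε _ hac).continuousOn
  · filter_upwards [hε0, hε1] with ε hε hε'
    filter_upwards [hne] with x hx
    by_cases hxK : x ∈ K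
    · have hp : 0 < rSq x₀ x := rSq_pos x₀ hx
      rw [indicator_of_mem hxK]
      refine (hbound ε hε hε' x hxK hx).trans ?_
      gcongr
      have hpe : 0 < rSq x₀ x + ε := by linarith
      calc ε * (rSq x₀ x + ε) ^ (-(q + 1)) ≤ (rSq x₀ x + ε) * (rSq x₀ x + ε) ^ (-(q + 1)) := by
            gcongr
            linarith
        _ = (rSq x₀ x + ε) ^ (-q) := by
            rw [neg_add, ← sub_eq_add_neg, Real.rpow_sub_one hpe.ne']
            field_simp
        _ ≤ _ := Real.rpow_le_rpow_of_nonpos hp (by linarith) (by linarith)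
    · rw [indicator_of_notMem hxK, image_eq_zero_of_notMem_tsupport hxK, mul_zero, norm_zero]
  · filter_upwards [hne] with x hx
    by_cases hxK : x ∈ K
    · have hp : 0 < rSq x₀ x := rSq_pos x₀ hx
      refine squeeze_zero_norm' (a := fun ε => C₂ * C₁ * M * (ε * rSq x₀ x ^ (-(q + 1)))) ?_ ?_
      · filter_upwards [hε0, hε1] with ε hε hε'
        refine (hbound ε hε hε' x hxK hx).trans ?_
        gcongr ?_ * (?_ * ?_)
        exact Real.rpow_le_rpow_of_nonpos hp (by linarith) (by linarith)
      · have h : Continuous fun ε : ℝ => C₂ * C₁ * M * (ε * rSq x₀ x ^ (-(q + 1))) := by fun_prop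
        have := h.tendsto 0
        simp only [zero_mul, mul_zero] at this
        exact this.mono_left nhdsWithin_le_nhds
    · simp only [image_eq_zero_of_notMem_tsupport hxK, mul_zero]
      exact tendsto_const_nhds

/-- For ε > 0 the function is analytic on the whole domain, so the adjoint can be moved onto it
exactly, which leaves -4ε times the kernel with parameter a + 2. Both sides have limits as ε → 0,
and the right-hand one is a multiple of point evaluation at x₀. -/
theorem integral_rhoIntegral_mul_helmholtzAdjoint {p : ℕ} (hm : 2 ≤ m) (hx₀ : x₀ ∈ posDomain hnm)
    {α e : Fin n → ℝ} (he : ∀ j, e j * (e j - 1 + 2 * α j) = 0)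
    (hbe : ∀ j, b j = α j + e j) (hb : ∀ j, 0 < b j) (hb1 : ∀ j, b j ≤ 1) (hB : 0 < ∑ j, b j)
    {a : ℝ} (ha : a = (m : ℝ) / 2 - 1 + ∑ j, b j) (hac : (a : ℂ) ∈ Complex.integerComplement)
    {κ : ℂ} {lam : Fin p → ℂ} (hκ : ∑ l, lam l ^ 2 = -4 * κ)
    {φ : EuclideanSpace ℝ (Fin m) → ℂ} (hφ : IsTestFunction (posDomain hnm) φ) :
    ∫ x, ((powWeight hnm e x : ℂ) * rhoIntegral hnm x₀ 0 κ a b x) *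
        helmholtzAdjoint hnm α lam φ x =
      -4 * (((Real.pi ^ ((m : ℝ) / 2) * betaLimit b (poleWeight hnm x₀ x₀) : ℝ) : ℂ) *
        ((powWeight hnm e x₀ : ℂ) * φ x₀)) := by
  have hU := isOpen_posDomain hnm
  have hac2 : ((a + 2 : ℝ) : ℂ) ∈ Complex.integerComplement := by
    have := add_one_mem_integerComplement (add_one_mem_integerComplement hac)
    convert this using 1
    push_cast
    ring
  have hW : AnalyticOnNhd ℝ (fun x => (powWeight hnm e x : ℂ)) (posDomain hnm) :=
    analyticOnNhd_powWeight hnm e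
  have hWs : ContDiffOn ℝ (⊤ : ℕ∞) (fun x => (powWeight hnm e x : ℂ)) (posDomain hnm) :=
    hW.contDiffOn hU.uniqueDiffOn
  have hψ : IsTestFunction (posDomain hnm) fun x => (powWeight hnm e x : ℂ) * φ x :=
    hφ.mul_left hU hWs
  have hL := (hφ.helmholtzAdjoint hnm hU subset_rfl α lam).mul_left hU hWs
  have hε0 : ∀ᶠ ε : ℝ in 𝓝[>] 0, 0 < ε := self_mem_nhdsWithin
  have t1 := tendsto_integral_rhoIntegral_mul hnm hm hx₀ hb hb1 hB κ ha hac hL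
  have t2 := (tendsto_integral_rhoIntegral_sub_mul hnm hm hx₀ hb hb1 hB κ ha hac2 hψ).add
    (tendsto_integral_betaPower_mul hnm hx₀ hb hb1 (c := a + 2) (by rw [ha]; ring) hac2 hψ)
  rw [zero_add] at t2
  have key : ∀ ε : ℝ, 0 < ε → ∫ x, rhoIntegral hnm x₀ ε κ a b x *
      ((powWeight hnm e x : ℂ) * helmholtzAdjoint hnm α lam φ x) =
      -4 * ((∫ x, ((ε : ℂ) * (rhoIntegral hnm x₀ ε κ (a + 2 : ℝ) b x -
        rhoIntegral hnm x₀ ε 0 (a + 2 : ℝ) b x)) * ((powWeight hnm e x : ℂ) * φ x)) +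
      ∫ x, ((ε : ℂ) * rhoIntegral hnm x₀ ε 0 (a + 2 : ℝ) b x) *
        ((powWeight hnm e x : ℂ) * φ x)) := by
    intro ε hε
    have hreg := regDomain_of_pos hnm hε x₀
    have hA : ∀ (κ : ℂ) {c : ℂ}, c ∈ Complex.integerComplement →
        AnalyticOnNhd ℝ (rhoIntegral hnm x₀ ε κ c b) (posDomain hnm) := fun κ c hc => by
      rw [← hreg]
      exact analyticOnNhd_rhoIntegral hnm hx₀ hb ε κ hc
    have h1 := hφ.integral_mul_helmholtzAdjoint hnm hU subset_rfl α lam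
      (u := fun x => (powWeight hnm e x : ℂ) * rhoIntegral hnm x₀ ε κ a b x)
      (hW.mul (hA κ hac))
    rw [← integral_add, ← integral_const_mul]
    · calc _ = ∫ x, ((powWeight hnm e x : ℂ) * rhoIntegral hnm x₀ ε κ a b x) *
            helmholtzAdjoint hnm α lam φ x := by
            congr 1 with x
            ring
        _ = _ := by
            rw [h1]
            refine integral_congr_ae (ae_of_all _ fun x => ?_)
            by_cases hx : x ∈ tsupport φ
            · have hxp := hφ.tsupport_subset hx
              have h2 := helmholtzOp_powWeight_mul hnm he lam hU subset_rfl (hA κ hac) hxp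
              have h3 := helmholtzOp_rhoIntegral hnm hx₀ hac hb (by rw [ha]) hκ
                (x := x) (ε := ε) (by rw [hreg]; exact hxp)
              have hbe' : (fun j => α j + e j) = b := funext fun j => (hbe j).symm
              rw [hbe'] at h2
              have e2 : ((a + 2 : ℝ) : ℂ) = (a : ℂ) + 1 + 1 := by
                push_cast
                ring
              simp only
              rw [h2, h3, e2]
              ring
            · simp [image_eq_zero_of_notMem_tsupport hx]
    · exact hψ.integrable_mul
        (continuousOn_const.mul ((hA κ hac2).continuousOn.sub (hA 0 hac2).continuousOn))
    · exact hψ.integrable_mul (continuousOn_const.mul (hA 0 hac2).continuousOn)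
  have t3 := (t2.const_mul (-4)).congr' (by filter_upwards [hε0] with ε hε using (key ε hε).symm)
  rw [← tendsto_nhds_unique t1 t3]
  congr 1 with x
  ring

end DistributionLimit

/-! ### Behaviour near the pole -/

theorem integrable_exp_neg_mul_abs {β : ℝ} (hβ : 0 < β) :
    Integrable fun θ : ℝ => Real.exp (-(β * |θ|)) := by
  rw [← integrableOn_univ, ← Iic_union_Ioi (a := (0 : ℝ))]
  refine IntegrableOn.union ?_ ?_
  · refine (integrableOn_exp_mul_Iic hβ 0).congr_fun (fun θ hθ => ?_) measurableSet_Iic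
    simp [abs_of_nonpos (show θ ≤ 0 from hθ)]
  · refine (integrableOn_exp_mul_Ioi (neg_neg_of_pos hβ) 0).congr_fun (fun θ hθ => ?_)
      measurableSet_Ioi
    simp [abs_of_pos (show 0 < θ from hθ)]

/-! ### The logarithmic case: averages with the critical exponent c = B -/

section Logarithm

variable {n : ℕ} {b : Fin n → ℝ}

/-- The substitution s = e^{Lθ} with R = e^{-L} maps 1 < s < 1/R, the range responsible for the
logarithm, to 0 < θ < 1 and produces the factor L. -/
theorem Gamma_mul_betaPower_eq_integral_exp (hb : ∀ j, 0 < b j) {c L : ℝ} (hc : 0 < c)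
    (hL : 0 < L) {w : Fin n → ℝ} (hw : ∀ j, 0 ≤ w j) :
    Real.Gamma c * betaPower b c (Real.exp (-L)) w =
      L * ∫ θ : ℝ, Real.exp (-Real.exp (L * (θ - 1))) *
        (Real.exp (L * θ) ^ c * betaLaplacePi b (fun j => Real.exp (L * θ) * w j)) := by
  rw [Gamma_mul_betaPower hb hc (Real.exp_pos _) hw, ← integral_const_mul]
  have himg : (fun θ : ℝ => Real.exp (L * θ)) '' univ = Ioi 0 := by
    rw [image_univ]
    ext s
    constructor
    · rintro ⟨θ, rfl⟩
      exact Real.exp_pos _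
    · intro hs
      refine ⟨Real.log s / L, ?_⟩
      simp only
      rw [mul_div_cancel₀ _ hL.ne', Real.exp_log hs]
  have h := integral_image_eq_integral_abs_deriv_smul (s := univ)
    (f := fun θ : ℝ => Real.exp (L * θ)) (f' := fun θ => Real.exp (L * θ) * L)
    MeasurableSet.univ (fun θ _ => by
      have h : HasDerivAt (fun θ => Real.exp (L * θ)) (Real.exp (L * θ) * L) θ := by
        simpa using ((hasDerivAt_id θ).const_mul L).exp
      exact h.hasDerivWithinAt) (fun x _ y _ hxy => by
      have := Real.exp_injective hxy
      exact mul_left_cancel₀ hL.ne' this)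
    (fun s : ℝ => s ^ (c - 1) * Real.exp (-(Real.exp (-L) * s)) *
      betaLaplacePi b (fun j => s * w j))
  rw [himg, setIntegral_univ] at h
  rw [h]
  congr 1 with θ
  have hpos := Real.exp_pos (L * θ)
  rw [abs_of_pos (by positivity), smul_eq_mul, Real.rpow_sub_one hpos.ne', ← Real.exp_add]
  have e : -L + L * θ = L * (θ - 1) := by ring
  rw [e]
  field_simp

/-- With s = e^{Lθ} and L = log(1/R) → ∞, the integrand tends to the constant `betaLimit b w₀` on
(0, 1) and to 0 elsewhere: for θ < 0 the power s^B dies, for θ > 1 the cutoff e^{-Rs} does. -/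
theorem tendsto_betaPower_div_log (hb : ∀ j, 0 < b j) (hb1 : ∀ j, b j ≤ 1) (hB : 0 < ∑ j, b j)
    {ι : Type*} {l : Filter ι} [l.IsCountablyGenerated] {R : ι → ℝ} {w : ι → Fin n → ℝ}
    {w₀ : Fin n → ℝ} (hw₀ : ∀ j, 0 < w₀ j)
    (hR : Tendsto R l (𝓝[>] 0)) (hw : Tendsto w l (𝓝 w₀)) :
    Tendsto (fun i => (Real.log (1 / R i))⁻¹ *
      (Real.Gamma (∑ j, b j) * betaPower b (∑ j, b j) (R i) (w i))) l
      (𝓝 (betaLimit b w₀)) := by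
  set B := ∑ j, b j
  have hwj : ∀ j, Tendsto (fun i => w i j) l (𝓝 (w₀ j)) := fun j => (tendsto_pi_nhds.1 hw) j
  obtain ⟨c₀, hc₀, hlt⟩ : ∃ c₀ > 0, ∀ j, c₀ < w₀ j := by
    have : ∀ᶠ c₀ in 𝓝[>] (0 : ℝ), ∀ j, c₀ < w₀ j := eventually_all.2 fun j =>
      (tendsto_id.mono_left nhdsWithin_le_nhds).eventually_lt_const (hw₀ j)
    obtain ⟨c₀, h1, h2⟩ := (this.and self_mem_nhdsWithin).exists
    exact ⟨c₀, h2, h1⟩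
  have hwl : ∀ᶠ i in l, ∀ j, c₀ ≤ w i j :=
    eventually_all.2 fun j => ((hwj j).eventually_const_lt (hlt j)).mono fun _ h => h.le
  have hRp : ∀ᶠ i in l, 0 < R i := hR.eventually self_mem_nhdsWithin
  obtain ⟨D, hD0, hD⟩ := exists_rpow_mul_betaLaplacePi_le hb hb1 hc₀
  set L : ι → ℝ := fun i => Real.log (1 / R i) with hLdef
  have hL : Tendsto L l atTop := by
    simp only [hLdef, one_div]
    exact Real.tendsto_log_atTop.comp (tendsto_inv_nhdsGT_zero.comp hR)
  have hL1 : ∀ᶠ i in l, 1 ≤ L i := hL.eventually_ge_atTop 1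
  -- The dominating function decays at rate B for θ < 0, from s^B, and at rate 1 for θ > 1, from e^y
  -- ≥ 1 + y in the cutoff; the factor e covers 0 ≤ θ ≤ 1.
  let β := min B 1
  have hβ : 0 < β := lt_min hB one_pos
  have hlim : Tendsto (fun i => ∫ θ : ℝ, Real.exp (-Real.exp (L i * (θ - 1))) *
      (Real.exp (L i * θ) ^ B * betaLaplacePi b (fun j => Real.exp (L i * θ) * w i j))) l
      (𝓝 (∫ θ : ℝ, (Ioo (0 : ℝ) 1).indicator (fun _ => betaLimit b w₀) θ)) := by
    refine tendsto_integral_filter_of_dominated_convergence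
      (fun θ => max 1 D * Real.exp 1 * Real.exp (-(β * |θ|))) ?_ ?_
      ((integrable_exp_neg_mul_abs hβ).const_mul _) ?_
    · refine Eventually.of_forall fun i => Measurable.aestronglyMeasurable ?_
      refine Measurable.mul (by fun_prop) (Measurable.mul (by fun_prop) ?_)
      exact (measurable_betaLaplacePi hb).comp (by fun_prop)
    · filter_upwards [hwl, hL1] with i hi hLi
      refine ae_of_all _ fun θ => ?_
      have hs := Real.exp_pos (L i * θ)
      have hP0 := betaLaplacePi_nonneg b (fun j => Real.exp (L i * θ) * w i j)
      have hP1 := betaLaplacePi_le_one hb (v := fun j => Real.exp (L i * θ) * w i j)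
        fun j => mul_nonneg hs.le (hc₀.le.trans (hi j))
      rw [Real.norm_of_nonneg (by positivity), mul_assoc, ← Real.exp_add, mul_comm]
      rcases lt_or_ge θ 0 with hθ | hθ
      · have h1 : Real.exp (L i * θ) ^ B ≤ Real.exp (1 + -(β * |θ|)) := by
          rw [← Real.exp_mul, abs_of_neg hθ, Real.exp_le_exp]
          have : β ≤ L i * B := by nlinarith [min_le_left B 1]
          nlinarith
        have h2 : Real.exp (-Real.exp (L i * (θ - 1))) ≤ 1 :=
          Real.exp_le_one_iff.2 (by linarith [Real.exp_pos (L i * (θ - 1))])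
        have h3 := Real.rpow_nonneg hs.le B
        calc _ ≤ Real.exp (L i * θ) ^ B * 1 * 1 := by gcongr
          _ ≤ 1 * Real.exp (1 + -(β * |θ|)) := by simpa using h1
          _ ≤ _ := by
            gcongr
            exact le_max_left _ _
      · have h1 := hD _ hi _ hs
        have h2 : Real.exp (-Real.exp (L i * (θ - 1))) ≤ Real.exp (1 + -(β * |θ|)) := by
          rw [Real.exp_le_exp, abs_of_nonneg hθ]
          have hβ1 : β ≤ 1 := min_le_right _ _
          rcases le_total θ 1 with h | h
          · have := Real.exp_pos (L i * (θ - 1))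
            nlinarith
          · have h4 := Real.add_one_le_exp (L i * (θ - 1))
            nlinarith
        calc _ ≤ D * Real.exp (1 + -(β * |θ|)) := by gcongr
          _ ≤ _ := by
            gcongr
            exact le_max_right _ _
    · have h01 : ∀ᵐ θ : ℝ, θ ≠ 0 ∧ θ ≠ 1 := by
        have h : ∀ y : ℝ, ∀ᵐ θ : ℝ, θ ≠ y := fun y => by rw [ae_iff]; simp
        exact (h 0).and (h 1)
      filter_upwards [h01] with θ hθ
      rcases lt_or_gt_of_ne hθ.1 with h0 | h0
      · rw [indicator_of_notMem fun h => h0.not_gt h.1]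
        have hz : Tendsto (fun i => Real.exp (L i * θ) ^ B) l (𝓝 0) := by
          simp only [← Real.exp_mul]
          refine Real.tendsto_exp_atBot.comp ?_
          exact (hL.atTop_mul_const_of_neg h0).atBot_mul_const hB
        refine squeeze_zero' ?_ ?_ hz
        · refine Eventually.of_forall fun i => ?_
          have := betaLaplacePi_nonneg b (fun j => Real.exp (L i * θ) * w i j)
          positivity
        · filter_upwards [hwl] with i hi
          have hs := Real.exp_pos (L i * θ)
          have hP0 := betaLaplacePi_nonneg b (fun j => Real.exp (L i * θ) * w i j)
          have hP1 := betaLaplacePi_le_one hb (v := fun j => Real.exp (L i * θ) * w i j)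
            fun j => mul_nonneg hs.le (hc₀.le.trans (hi j))
          have h2 : Real.exp (-Real.exp (L i * (θ - 1))) ≤ 1 :=
            Real.exp_le_one_iff.2 (by linarith [Real.exp_pos (L i * (θ - 1))])
          calc _ ≤ 1 * (Real.exp (L i * θ) ^ B * 1) := by gcongr
            _ = _ := by ring
      have hs : Tendsto (fun i => Real.exp (L i * θ)) l atTop :=
        Real.tendsto_exp_atTop.comp (hL.atTop_mul_const h0)
      have hPi := tendsto_rpow_mul_betaLaplacePi hb hb1 hw₀ hs hw
      rcases lt_or_gt_of_ne hθ.2 with h1 | h1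
      · have hmem : θ ∈ Ioo (0 : ℝ) 1 := ⟨h0, h1⟩
        rw [indicator_of_mem hmem]
        have hz : Tendsto (fun i => Real.exp (-Real.exp (L i * (θ - 1)))) l (𝓝 1) := by
          have h2 : Tendsto (fun i => Real.exp (L i * (θ - 1))) l (𝓝 0) :=
            Real.tendsto_exp_atBot.comp (hL.atTop_mul_const_of_neg (sub_neg.2 h1))
          have h3 := (Real.continuous_exp.tendsto (-0)).comp h2.neg
          rw [neg_zero, Real.exp_zero] at h3
          exact h3
        simpa using hz.mul hPi
      · rw [indicator_of_notMem fun h => h1.not_gt h.2]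
        have hz : Tendsto (fun i => Real.exp (-Real.exp (L i * (θ - 1)))) l (𝓝 0) := by
          have h2 : Tendsto (fun i => Real.exp (L i * (θ - 1))) l atTop :=
            Real.tendsto_exp_atTop.comp (hL.atTop_mul_const (sub_pos.2 h1))
          exact Real.tendsto_exp_neg_atTop_nhds_zero.comp h2
        simpa using hz.mul hPi
  rw [integral_indicator measurableSet_Ioo] at hlim
  simp only [setIntegral_const, Real.volume_real_Ioo, sub_zero, smul_eq_mul] at hlim
  rw [max_eq_left zero_le_one, one_mul] at hlim
  refine hlim.congr' ?_
  filter_upwards [hwl, hRp, hL1] with i hi hRi hLi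
  have hL0 : 0 < L i := by linarith
  have hexp : R i = Real.exp (-L i) := by
    simp only [hLdef]
    rw [one_div, Real.log_inv, neg_neg, Real.exp_log hRi]
  rw [hexp, Gamma_mul_betaPower_eq_integral_exp hb hB hL0 fun j => hc₀.le.trans (hi j),
    ← hexp, ← mul_assoc]
  rw [inv_mul_cancel₀ hL0.ne', one_mul]

end Logarithm

/-! ### Asymptotics at the pole -/

section NearPole

variable {n m : ℕ} (hnm : n ≤ m) {x₀ : EuclideanSpace ℝ (Fin m)} {b : Fin n → ℝ}

/-- Pointwise ρ^{-(a-1)} = ρ · ρ^{-a}, which is at most δ ρ^{-a} where ρ ≤ δ and bounded where ρ ≥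
δ. So the correction is negligible against the leading average, with no case distinction on a - 1.
-/
theorem exists_betaPower_sub_one_le (hx₀ : x₀ ∈ posDomain hnm) (hb : ∀ j, 0 < b j) {a : ℝ}
    (ha : 0 < a) {K : Set (EuclideanSpace ℝ (Fin m))} (hK : IsCompact K)
    (hKp : K ⊆ posDomain hnm) {δ : ℝ} (hδ : 0 < δ) :
    ∃ C : ℝ, 0 ≤ C ∧ ∀ x ∈ K, 0 < rSq x₀ x →
      betaPower b (a - 1) (rSq x₀ x) (poleWeight hnm x₀ x) ≤
        δ * betaPower b a (rSq x₀ x) (poleWeight hnm x₀ x) + C := by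
  have := isProbabilityMeasure_betaProd hb
  obtain ⟨R, hR⟩ := exists_rho_le hnm x₀ hK
  refine ⟨max R 0 * δ ^ (-a), by positivity, fun x hx hp => ?_⟩
  have hreg : x ∈ regDomain hnm x₀ 0 := ⟨hKp hx, by simpa using hp⟩
  have h1 := betaPower_poleWeight hnm (x₀ := x₀) (b := b) (a - 1) 0 x
  have h2 := betaPower_poleWeight hnm (x₀ := x₀) (b := b) a 0 x
  rw [add_zero] at h1 h2
  have hc : ∫ _, max R 0 * δ ^ (-a) ∂(betaProd b) = max R 0 * δ ^ (-a) := by simp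
  have hI := (integrable_rho_rpow hnm hx₀ hb hreg a).const_mul δ
  rw [h1, h2, ← integral_const_mul, ← hc, ← integral_add hI (integrable_const _)]
  refine integral_mono_ae (integrable_rho_rpow hnm hx₀ hb hreg _)
    (hI.add (integrable_const _)) ?_
  filter_upwards [ae_betaProd_mem_Icc hb] with t ht
  have hρ := rho_add_pos hnm hx₀ hreg ht
  set ρ := rho hnm x₀ x t + 0
  have e : ρ ^ (-(a - 1)) = ρ * ρ ^ (-a) := by
    rw [neg_sub, sub_eq_add_neg, Real.rpow_add hρ, Real.rpow_one]
  have hρa : 0 < ρ ^ (-a) := Real.rpow_pos_of_pos hρ _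
  have hδa : 0 < δ ^ (-a) := Real.rpow_pos_of_pos hδ _
  change ρ ^ (-(a - 1)) ≤ δ * ρ ^ (-a) + max R 0 * δ ^ (-a)
  rw [e]
  rcases le_total ρ δ with h | h
  · have h3 : 0 ≤ max R 0 * δ ^ (-a) := by positivity
    nlinarith
  · have h4 : ρ ^ (-a) ≤ δ ^ (-a) := Real.rpow_le_rpow_of_nonpos hδ h (by linarith)
    have h5 : ρ ≤ max R 0 := by
      refine le_trans ?_ (le_max_left _ _)
      have := hR x hx t ht
      linarith
    have h6 : ρ * ρ ^ (-a) ≤ max R 0 * δ ^ (-a) := by gcongr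
    have h7 : 0 ≤ δ * ρ ^ (-a) := by positivity
    linarith

/-- Transfers the asymptotics of the leading average to the full integral. The normaliser `N` is
left general so that a power of r² and the inverse logarithm are treated at once; N → 0 disposes of
the bounded part of the correction. -/
theorem tendsto_mul_rhoIntegral (hx₀ : x₀ ∈ posDomain hnm) (hb : ∀ j, 0 < b j) (κ : ℂ) {a : ℝ}
    (ha : 0 < a) (hac : (a : ℂ) ∈ Complex.integerComplement) {N : EuclideanSpace ℝ (Fin m) → ℝ}
    (hN : Tendsto N (𝓝[≠] x₀) (𝓝 0)) (hN0 : ∀ᶠ x in 𝓝[≠] x₀, 0 ≤ N x) {l : ℝ}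
    (hF : Tendsto (fun x => N x * (Real.Gamma a *
      betaPower b a (rSq x₀ x) (poleWeight hnm x₀ x))) (𝓝[≠] x₀) (𝓝 l)) :
    Tendsto (fun x => (N x : ℂ) * rhoIntegral hnm x₀ 0 κ a b x) (𝓝[≠] x₀) (𝓝 (l : ℂ)) := by
  obtain ⟨r, hr, hrU⟩ := Metric.nhds_basis_closedBall.mem_iff.1
    ((isOpen_posDomain hnm).mem_nhds hx₀)
  have hK := isCompact_closedBall x₀ r
  obtain ⟨C, hC0, hC⟩ := exists_norm_rhoIntegral_sub_le hnm hx₀ hb κ hac hK hrU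
  have hG := Real.Gamma_pos_of_pos ha
  have hxK : ∀ᶠ x in 𝓝[≠] x₀, x ∈ Metric.closedBall x₀ r :=
    mem_nhdsWithin_of_mem_nhds (Metric.closedBall_mem_nhds x₀ hr)
  have hne : ∀ᶠ x in 𝓝[≠] x₀, x ≠ x₀ := self_mem_nhdsWithin
  have hF' : Tendsto (fun x => N x * betaPower b a (rSq x₀ x) (poleWeight hnm x₀ x)) (𝓝[≠] x₀)
      (𝓝 (l / Real.Gamma a)) := by
    refine (hF.div_const (Real.Gamma a)).congr fun x => ?_
    field_simp
  have herr : Tendsto (fun x => N x *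
      betaPower b (a - 1) (rSq x₀ x) (poleWeight hnm x₀ x)) (𝓝[≠] x₀) (𝓝 0) := by
    set M := |l / Real.Gamma a| + 1
    have hM : 0 < M := by positivity
    have hFM := hF'.eventually_lt_const ((le_abs_self _).trans_lt (lt_add_one |l / Real.Gamma a|))
    rw [Metric.tendsto_nhds]
    intro η hη
    obtain ⟨C', hC'0, hC'⟩ := exists_betaPower_sub_one_le hnm hx₀ hb ha hK hrU
      (δ := η / (2 * M)) (by positivity)
    have hNC : ∀ᶠ x in 𝓝[≠] x₀, N x * C' < η / 2 := by
      have := hN.mul_const C'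
      rw [zero_mul] at this
      exact this.eventually_lt_const (by positivity)
    filter_upwards [hxK, hne, hN0, hFM, hNC] with x h1 h2 h3 h4 h5
    have hp : 0 < rSq x₀ x := rSq_pos x₀ h2
    have hb0 := betaPower_nonneg hb (a - 1) hp.le fun j => (poleWeight_pos hnm hx₀ (hrU h1) j).le
    rw [Real.dist_eq, sub_zero, abs_of_nonneg (mul_nonneg h3 hb0)]
    calc _ ≤ N x * (η / (2 * M) * betaPower b a (rSq x₀ x) (poleWeight hnm x₀ x) + C') := by
          gcongr
          exact hC' x h1 hp
      _ = η / (2 * M) * (N x * betaPower b a (rSq x₀ x) (poleWeight hnm x₀ x)) + N x * C' := by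
          ring
      _ < η / (2 * M) * M + η / 2 := by
          refine add_lt_add ?_ h5
          gcongr
      _ = η := by field_simp; ring
  have hdiff : Tendsto (fun x => (N x : ℂ) * (rhoIntegral hnm x₀ 0 κ a b x -
      ((Real.Gamma a * betaPower b a (rSq x₀ x) (poleWeight hnm x₀ x) : ℝ) : ℂ))) (𝓝[≠] x₀)
      (𝓝 0) := by
    have h0 := herr.const_mul C
    rw [mul_zero] at h0
    refine squeeze_zero_norm' ?_ h0
    filter_upwards [hxK, hne, hN0] with x h1 h2 h3
    have hp : 0 < rSq x₀ x := rSq_pos x₀ h2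
    have := hC x h1 0 zero_le_one (by simpa using hp)
    rw [add_zero] at this
    rw [norm_mul, Complex.norm_real, Real.norm_of_nonneg h3]
    calc _ ≤ N x * (C * betaPower b (a - 1) (rSq x₀ x) (poleWeight hnm x₀ x)) := by gcongr
      _ = _ := by ring
  have h := hdiff.add ((Complex.continuous_ofReal.tendsto l).comp hF)
  rw [zero_add] at h
  refine h.congr fun x => ?_
  simp only [Function.comp_apply]
  push_cast
  ring

theorem tendsto_rSq (x₀ : EuclideanSpace ℝ (Fin m)) :
    Tendsto (rSq x₀) (𝓝[≠] x₀) (𝓝[>] 0) := by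
  refine tendsto_nhdsWithin_iff.2 ⟨?_, ?_⟩
  · have := (continuous_rSq x₀).tendsto x₀
    rw [rSq_eq_norm_sq, sub_self, norm_zero, zero_pow two_ne_zero] at this
    exact this.mono_left nhdsWithin_le_nhds
  · filter_upwards [self_mem_nhdsWithin] with x hx using rSq_pos x₀ hx

theorem tendsto_rSq_rpow_mul_rhoIntegral (hm : 2 < m) (hx₀ : x₀ ∈ posDomain hnm)
    (hb : ∀ j, 0 < b j) (hb1 : ∀ j, b j ≤ 1) (κ : ℂ) {a : ℝ}
    (ha : a = (m : ℝ) / 2 - 1 + ∑ j, b j) (hac : (a : ℂ) ∈ Complex.integerComplement) :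
    Tendsto (fun x => ((rSq x₀ x ^ ((m : ℝ) / 2 - 1) : ℝ) : ℂ) * rhoIntegral hnm x₀ 0 κ a b x)
      (𝓝[≠] x₀)
      (𝓝 ((Real.Gamma ((m : ℝ) / 2 - 1) * betaLimit b (poleWeight hnm x₀ x₀) : ℝ) : ℂ)) := by
  have hm' : (2 : ℝ) < m := by exact_mod_cast hm
  have hB0 : 0 ≤ ∑ j, b j := Finset.sum_nonneg fun j _ => (hb j).le
  have hcB : a - ∑ j, b j = (m : ℝ) / 2 - 1 := by rw [ha]; ring
  refine tendsto_mul_rhoIntegral hnm hx₀ hb κ (by linarith) hac ?_ ?_ ?_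
  · have h : Tendsto (fun R : ℝ => R ^ ((m : ℝ) / 2 - 1)) (𝓝 0) (𝓝 (0 ^ ((m : ℝ) / 2 - 1))) :=
      (Real.continuousAt_rpow_const 0 _ (Or.inr (by linarith))).tendsto
    rw [Real.zero_rpow (by linarith)] at h
    exact h.comp ((tendsto_rSq x₀).mono_right nhdsWithin_le_nhds)
  · exact Eventually.of_forall fun x => Real.rpow_nonneg (rSq_nonneg x₀ x) _
  · have h := tendsto_rpow_mul_betaPower hb hb1 (c := a) (by linarith) (l := 𝓝[≠] x₀)
      (fun j => poleWeight_pos hnm hx₀ hx₀ j) (tendsto_rSq x₀)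
      (((continuous_poleWeight hnm x₀).tendsto x₀).mono_left nhdsWithin_le_nhds)
    rwa [hcB] at h

theorem tendsto_rhoIntegral_div_log (hx₀ : x₀ ∈ posDomain hnm)
    (hb : ∀ j, 0 < b j) (hb1 : ∀ j, b j ≤ 1) (hB : 0 < ∑ j, b j) (κ : ℂ)
    (hac : ((∑ j, b j : ℝ) : ℂ) ∈ Complex.integerComplement) :
    Tendsto (fun x => (((Real.log (1 / rSq x₀ x))⁻¹ : ℝ) : ℂ) *
      rhoIntegral hnm x₀ 0 κ (∑ j, b j : ℝ) b x)
      (𝓝[≠] x₀) (𝓝 ((betaLimit b (poleWeight hnm x₀ x₀) : ℝ) : ℂ)) := by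
  have hL : Tendsto (fun x => Real.log (1 / rSq x₀ x)) (𝓝[≠] x₀) atTop := by
    simp only [one_div]
    exact Real.tendsto_log_atTop.comp (tendsto_inv_nhdsGT_zero.comp (tendsto_rSq x₀))
  refine tendsto_mul_rhoIntegral hnm hx₀ hb κ hB hac (tendsto_inv_atTop_zero.comp hL) ?_ ?_
  · filter_upwards [hL.eventually_ge_atTop 0] with x hx using inv_nonneg.2 hx
  · exact tendsto_betaPower_div_log hb hb1 hB (fun j => poleWeight_pos hnm hx₀ hx₀ j)
      (tendsto_rSq x₀) (((continuous_poleWeight hnm x₀).tendsto x₀).mono_left nhdsWithin_le_nhds)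

end NearPole

/-! ### The functions `qₖ` -/

section Parameters

variable {n : ℕ}

/-- The exponents `1 - 2αᵢ` for `i ≤ k` and `0` for `i > k`. -/
def weightExponent (k : ℕ) (α : Fin n → ℝ) (j : Fin n) : ℝ := if j.val < k then 1 - 2 * α j else 0

/-- The real numerator parameters `1 - α₁, …, 1 - αₖ, αₖ₊₁, …, αₙ`. -/
def betaParam (k : ℕ) (α : Fin n → ℝ) (j : Fin n) : ℝ := α j + weightExponent k α j

theorem betaParam_of_lt {k : ℕ} (α : Fin n → ℝ) {j : Fin n} (h : j.val < k) :
    betaParam k α j = 1 - α j := by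
  rw [betaParam, weightExponent, if_pos h]
  ring

theorem betaParam_of_not_lt {k : ℕ} (α : Fin n → ℝ) {j : Fin n} (h : ¬ j.val < k) :
    betaParam k α j = α j := by
  rw [betaParam, weightExponent, if_neg h, add_zero]

theorem betaParam_mem_Ioo {α : Fin n → ℝ} (hα : ∀ j, 0 < 2 * α j ∧ 2 * α j < 1) (k : ℕ)
    (j : Fin n) : betaParam k α j ∈ Ioo (0 : ℝ) 1 := by
  have := hα j
  by_cases h : j.val < k
  · rw [betaParam_of_lt α h]
    constructor <;> linarith
  · rw [betaParam_of_not_lt α h]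
    constructor <;> linarith

/-- The exponents 0 and 1 - 2αⱼ are the two indicial roots of the operator at xⱼ = 0. -/
theorem weightExponent_mul (k : ℕ) (α : Fin n → ℝ) (j : Fin n) :
    weightExponent k α j * (weightExponent k α j - 1 + 2 * α j) = 0 := by
  unfold weightExponent
  split_ifs <;> ring

theorem bParam_eq (k : ℕ) (α : Fin n → ℝ) : bParam k α = fun j => (betaParam k α j : ℂ) := by
  ext j
  by_cases h : j.val < k
  · rw [bParam, if_pos h, betaParam_of_lt α h]
  · rw [bParam, if_neg h, betaParam_of_not_lt α h]

theorem cParam_eq (k : ℕ) (α : Fin n → ℝ) :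
    cParam k α = fun j => ((2 * betaParam k α j : ℝ) : ℂ) := by
  ext j
  by_cases h : j.val < k
  · rw [cParam, if_pos h, betaParam_of_lt α h]
    congr 1
    ring
  · rw [cParam, if_neg h, betaParam_of_not_lt α h]

/-- This relation between the exponent and the beta parameters is the one under which the averaged
radial function solves the equation. -/
theorem alphaTilde_eq (m : ℕ) {k : ℕ} (hk : k ≤ n) (α : Fin n → ℝ) :
    alphaTilde m k α = (m : ℝ) / 2 - 1 + ∑ j, betaParam k α j := by
  have h1 : ∑ j : Fin n with j.val < k, betaParam k α j =
      k - ∑ j : Fin n with j.val < k, α j := by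
    rw [Finset.sum_congr rfl fun j hj => betaParam_of_lt α (Finset.mem_filter.1 hj).2,
      Finset.sum_sub_distrib, Finset.sum_const, nsmul_eq_mul, mul_one, Fin.card_filter_val_lt,
      min_eq_right hk]
  have h2 : ∑ j : Fin n with ¬ j.val < k, betaParam k α j = ∑ j : Fin n with ¬ j.val < k, α j :=
    Finset.sum_congr rfl fun j hj => betaParam_of_not_lt α (Finset.mem_filter.1 hj).2
  rw [alphaTilde, ← Finset.sum_filter_add_sum_filter_not Finset.univ (fun j : Fin n => j.val < k)
    (betaParam k α), h1, h2]
  ring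

theorem gammaCoeff_eq (m k : ℕ) (α : Fin n → ℝ) :
    gammaCoeff m k α = (2 : ℝ) ^ (2 * alphaTilde m k α - m) *
      (Real.Gamma (alphaTilde m k α) / Real.pi ^ ((m : ℝ) / 2)) *
      ∏ j, Real.Gamma (betaParam k α j) / Real.Gamma (2 * betaParam k α j) := by
  rw [gammaCoeff, mul_assoc, ← Finset.prod_filter_mul_prod_filter_not Finset.univ
    (fun j : Fin n => j.val < k)
    (fun j => Real.Gamma (betaParam k α j) / Real.Gamma (2 * betaParam k α j))]
  congr 2
  · refine Finset.prod_congr rfl fun j hj => ?_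
    rw [betaParam_of_lt α (Finset.mem_filter.1 hj).2]
    congr 2
    ring
  · refine Finset.prod_congr rfl fun j hj => ?_
    rw [betaParam_of_not_lt α (Finset.mem_filter.1 hj).2]

end Parameters

theorem pd_const_mul {m : ℕ} (C : ℂ) (f : EuclideanSpace ℝ (Fin m) → ℂ) (i : Fin m) :
    pd i (fun x => C * f x) = fun x => C * pd i f x := by
  ext x
  change fderiv ℝ (C • f) x _ = _
  rw [fderiv_const_smul_field]
  rfl

theorem helmholtzOp_const_mul {n m p : ℕ} (hnm : n ≤ m) (α : Fin n → ℝ) (lam : Fin p → ℂ) (C : ℂ)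
    (u : EuclideanSpace ℝ (Fin m) → ℂ) (x : EuclideanSpace ℝ (Fin m)) :
    helmholtzOp hnm α lam (fun x => C * u x) x = C * helmholtzOp hnm α lam u x := by
  simp only [helmholtzOp, pd_const_mul, mul_sub, mul_add, Finset.mul_sum]
  congr 1
  · congr 1
    exact Finset.sum_congr rfl fun j _ => by ring
  · ring

/-! ### The functions qₖ as weighted averages of radial solutions -/

section Q

variable {n m p : ℕ} (hnm : n ≤ m) {x₀ : EuclideanSpace ℝ (Fin m)}

theorem rjSq_eq (x : EuclideanSpace ℝ (Fin m)) (j : Fin n) :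
    rjSq hnm x₀ x j = rSq x₀ x + poleWeight hnm x₀ x j := by
  rw [rjSq, rSq, poleWeight, ← Finset.add_sum_erase Finset.univ (fun i => (x i - x₀ i) ^ 2)
    (Finset.mem_univ (Fin.castLE hnm j))]
  ring

theorem xiVar_eq (x : EuclideanSpace ℝ (Fin m)) (j : Fin n) :
    xiVar hnm x₀ x j = -(poleWeight hnm x₀ x j / rSq x₀ x) := by
  rw [xiVar, rjSq_eq]
  ring

theorem xiVar_nonpos (hx₀ : x₀ ∈ posDomain hnm) {x : EuclideanSpace ℝ (Fin m)}
    (hx : x ∈ posDomain hnm) (j : Fin n) : xiVar hnm x₀ x j ≤ 0 := by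
  rw [xiVar_eq, neg_nonpos]
  exact div_nonneg (poleWeight_pos hnm hx₀ hx j).le (rSq_nonneg x₀ x)

theorem sum_etaVar (lam : Fin p → ℂ) (x : EuclideanSpace ℝ (Fin m)) :
    ∑ l, etaVar lam x₀ x l = -(1 / 4) * (∑ l, lam l ^ 2) * rSq x₀ x := by
  simp only [etaVar, Finset.mul_sum, Finset.sum_mul]

/-- Since ξⱼ = -4xⱼx₀ⱼ/r², one has ρ = r²(1 - ∑ tⱼ ξⱼ), and homogeneity of the radial solution in r²
gives the rest. -/
theorem rhoIntegral_eq_eulerIntegral (hx₀ : x₀ ∈ posDomain hnm) {b : Fin n → ℝ}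
    (hb : ∀ j, 0 < b j) {a : ℂ} (ha : Complex.Gamma a ≠ 0) (lam : Fin p → ℂ)
    {x : EuclideanSpace ℝ (Fin m)} (hx : x ∈ posDomain hnm) (hne : x ≠ x₀) :
    rhoIntegral hnm x₀ 0 (-(1 / 4) * ∑ l, lam l ^ 2) a b x =
      Complex.Gamma a * ((rSq x₀ x : ℂ) ^ (-a) *
        eulerIntegral a b (fun j => (xiVar hnm x₀ x j : ℂ)) (∑ l, etaVar lam x₀ x l)) := by
  have hr := rSq_pos x₀ hne
  rw [eulerIntegral_eq_radialIntegral, mul_left_comm, ← mul_assoc (Complex.Gamma a),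
    mul_inv_cancel₀ ha, one_mul, radialIntegral, ← integral_const_mul, rhoIntegral]
  refine integral_congr_ae ?_
  filter_upwards [ae_betaProd_mem_Icc hb] with t ht
  have h1 : 0 ≤ 1 + ∑ j, t j * -xiVar hnm x₀ x j := by
    have : 0 ≤ ∑ j, t j * -xiVar hnm x₀ x j := Finset.sum_nonneg fun j _ =>
      mul_nonneg (ht.1 j) (neg_nonneg.2 (xiVar_nonpos hnm hx₀ hx j))
    linarith
  have h2 : rho hnm x₀ x t + 0 = rSq x₀ x * (1 + ∑ j, t j * -xiVar hnm x₀ x j) := by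
    rw [rho_add_eq, add_zero, mul_add, mul_one, Finset.mul_sum]
    congr 1
    refine Finset.sum_congr rfl fun j _ => ?_
    rw [xiVar_eq]
    field_simp
  rw [h2, radialSol_ofReal_mul _ a hr.le h1, sum_etaVar]
  congr 2
  push_cast
  rfl

/-- The constant factor of `qₖ`. -/
def qConst (k : ℕ) (α : Fin n → ℝ) (x₀ : EuclideanSpace ℝ (Fin m)) : ℝ :=
  gammaCoeff m k α / Real.Gamma (alphaTilde m k α) * powWeight hnm (weightExponent k α) x₀

theorem prod_mul_rpow_eq_powWeight (hx₀ : x₀ ∈ posDomain hnm) {x : EuclideanSpace ℝ (Fin m)}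
    (hx : x ∈ posDomain hnm) (k : ℕ) (α : Fin n → ℝ) :
    ∏ i : Fin n with i.val < k, (x (Fin.castLE hnm i) * x₀ (Fin.castLE hnm i)) ^ (1 - 2 * α i) =
      powWeight hnm (weightExponent k α) x * powWeight hnm (weightExponent k α) x₀ := by
  rw [powWeight, powWeight, ← Finset.prod_mul_distrib, Finset.prod_filter]
  refine Finset.prod_congr rfl fun j _ => ?_
  unfold weightExponent
  split_ifs
  · rw [Real.mul_rpow (hx j).le (hx₀ j).le]
  · simp

theorem isHAContinuation_qFun (hx₀ : x₀ ∈ posDomain hnm) {α : Fin n → ℝ}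
    (hα : ∀ j, 0 < 2 * α j ∧ 2 * α j < 1) {k : ℕ}
    (ha : (alphaTilde m k α : ℂ) ∈ Complex.integerComplement) (lam : Fin p → ℂ)
    {x : EuclideanSpace ℝ (Fin m)} (hx : x ∈ posDomain hnm) :
    IsHAContinuation (alphaTilde m k α : ℂ) (bParam k α) (cParam k α)
      (fun j => (xiVar hnm x₀ x j : ℂ)) (etaVar lam x₀ x)
      fun z => eulerIntegral (alphaTilde m k α : ℂ) (betaParam k α)
        (fun j => z * xiVar hnm x₀ x j) (∑ l, etaVar lam x₀ x l) := by
  rw [bParam_eq, cParam_eq]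
  exact isHAContinuation_eulerIntegral ha (fun j => (betaParam_mem_Ioo hα k j).1)
    (fun j => xiVar_nonpos hnm hx₀ hx j) _

theorem HA_eq_eulerIntegral (hx₀ : x₀ ∈ posDomain hnm) {α : Fin n → ℝ}
    (hα : ∀ j, 0 < 2 * α j ∧ 2 * α j < 1) {k : ℕ}
    (ha : (alphaTilde m k α : ℂ) ∈ Complex.integerComplement) (lam : Fin p → ℂ)
    {x : EuclideanSpace ℝ (Fin m)} (hx : x ∈ posDomain hnm) :
    HA (alphaTilde m k α : ℂ) (bParam k α) (cParam k α)
      (fun j => (xiVar hnm x₀ x j : ℂ)) (etaVar lam x₀ x) =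
      eulerIntegral (alphaTilde m k α : ℂ) (betaParam k α)
        (fun j => (xiVar hnm x₀ x j : ℂ)) (∑ l, etaVar lam x₀ x l) := by
  rw [HA_eq_of_isHAContinuation (isHAContinuation_qFun hnm hx₀ hα ha lam hx)]
  simp only [one_mul]

/-- Everything claimed about qₖ off the pole is read off from this form, whose only x-dependence is
the power weight and the averaged radial solution. -/
theorem qFun_eq (hx₀ : x₀ ∈ posDomain hnm) {α : Fin n → ℝ}
    (hα : ∀ j, 0 < 2 * α j ∧ 2 * α j < 1) {k : ℕ}
    (ha : (alphaTilde m k α : ℂ) ∈ Complex.integerComplement) (lam : Fin p → ℂ)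
    {x : EuclideanSpace ℝ (Fin m)} (hx : x ∈ posDomain hnm) (hne : x ≠ x₀) :
    qFun hnm k α lam x₀ x = (qConst hnm k α x₀ : ℂ) *
      ((powWeight hnm (weightExponent k α) x : ℂ) *
        rhoIntegral hnm x₀ 0 (-(1 / 4) * ∑ l, lam l ^ 2) (alphaTilde m k α) (betaParam k α) x) := by
  have hG := Gamma_ne_zero_of_mem_integerComplement ha
  have hr := rSq_pos x₀ hne
  rw [qFun, HA_eq_eulerIntegral hnm hx₀ hα ha lam hx,
    rhoIntegral_eq_eulerIntegral hnm hx₀ (fun j => (betaParam_mem_Ioo hα k j).1) hG lam hx hne,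
    qFactor, prod_mul_rpow_eq_powWeight hnm hx₀ hx, qConst]
  have e : ((√(rSq x₀ x) ^ (-2 * alphaTilde m k α) : ℝ) : ℂ) =
      (rSq x₀ x : ℂ) ^ (-(alphaTilde m k α : ℂ)) := by
    rw [← Complex.ofReal_neg, ← Complex.ofReal_cpow hr.le, Real.sqrt_eq_rpow, ← Real.rpow_mul hr.le]
    congr 2
    ring
  rw [← e]
  have hG' : (Real.Gamma (alphaTilde m k α) : ℂ) ≠ 0 := by rwa [← Complex.Gamma_ofReal]
  rw [Complex.Gamma_ofReal]
  push_cast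
  field_simp

/-- The Gamma quotients of γₖ cancel those of the limit constant. At the pole rⱼ² - r² = 4x₀ⱼ², so
the powers of 2 are 2^{2α̃ₖ - m - 2∑bⱼ} = 2^{-2}. The two weights at x₀ turn x₀ⱼ^{-2bⱼ} into
x₀ⱼ^{-2αⱼ}. -/
theorem qConst_mul_eq (hx₀ : x₀ ∈ posDomain hnm) {α : Fin n → ℝ}
    (hα : ∀ j, 0 < 2 * α j ∧ 2 * α j < 1) {k : ℕ} (hk : k ≤ n) (ha : 0 < alphaTilde m k α) :
    qConst hnm k α x₀ * (Real.pi ^ ((m : ℝ) / 2) *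
      betaLimit (betaParam k α) (poleWeight hnm x₀ x₀) * powWeight hnm (weightExponent k α) x₀) =
      1 / 4 * ∏ j, x₀ (Fin.castLE hnm j) ^ (-2 * α j) := by
  have hG := (Real.Gamma_pos_of_pos ha).ne'
  have hπ : Real.pi ^ ((m : ℝ) / 2) ≠ 0 := (Real.rpow_pos_of_pos Real.pi_pos _).ne'
  have hterm : ∀ j, Real.Gamma (betaParam k α j) / Real.Gamma (2 * betaParam k α j) *
      (Real.Gamma (2 * betaParam k α j) / Real.Gamma (betaParam k α j) *
        poleWeight hnm x₀ x₀ j ^ (-betaParam k α j)) *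
      (x₀ (Fin.castLE hnm j) ^ weightExponent k α j *
        x₀ (Fin.castLE hnm j) ^ weightExponent k α j) =
      (2 : ℝ) ^ (-2 * betaParam k α j) * x₀ (Fin.castLE hnm j) ^ (-2 * α j) := by
    intro j
    have hb := (betaParam_mem_Ioo hα k j).1
    have h1 := (Real.Gamma_pos_of_pos hb).ne'
    have h2 := (Real.Gamma_pos_of_pos (mul_pos two_pos hb)).ne'
    have hx := hx₀ j
    have e1 : poleWeight hnm x₀ x₀ j = 2 ^ (2 : ℝ) * x₀ (Fin.castLE hnm j) ^ (2 : ℝ) := by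
      rw [poleWeight, Real.rpow_two, Real.rpow_two]
      ring
    have e2 : poleWeight hnm x₀ x₀ j ^ (-betaParam k α j) = (2 : ℝ) ^ (-2 * betaParam k α j) *
        x₀ (Fin.castLE hnm j) ^ (-2 * betaParam k α j) := by
      rw [e1, Real.mul_rpow (by positivity) (by positivity), ← Real.rpow_mul two_pos.le,
        ← Real.rpow_mul hx.le]
      congr 2 <;> ring
    have e3 : x₀ (Fin.castLE hnm j) ^ (-2 * α j) = x₀ (Fin.castLE hnm j) ^ (-2 * betaParam k α j) *
        (x₀ (Fin.castLE hnm j) ^ weightExponent k α j *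
          x₀ (Fin.castLE hnm j) ^ weightExponent k α j) := by
      rw [← Real.rpow_add hx, ← Real.rpow_add hx]
      congr 1
      rw [betaParam]
      ring
    rw [e2, e3]
    field_simp
  have hprod := Finset.prod_congr (rfl : (Finset.univ : Finset (Fin n)) = Finset.univ)
    fun j _ => hterm j
  simp only [Finset.prod_mul_distrib] at hprod
  have h2 : ∏ j, (2 : ℝ) ^ (-2 * betaParam k α j) = 2 ^ (∑ j, -2 * betaParam k α j) :=
    (Real.rpow_sum_of_pos two_pos _ _).symm
  have h4 : (2 : ℝ) ^ (2 * alphaTilde m k α - m) * 2 ^ (∑ j, -2 * betaParam k α j) = 1 / 4 := by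
    rw [← Real.rpow_add two_pos, ← Finset.mul_sum, alphaTilde_eq m hk]
    have : 2 * ((m : ℝ) / 2 - 1 + ∑ j, betaParam k α j) - m + -2 * ∑ j, betaParam k α j =
        ((-2 : ℤ) : ℝ) := by
      push_cast
      ring
    rw [this, Real.rpow_intCast]
    norm_num
  rw [h2] at hprod
  rw [qConst, gammaCoeff_eq, ← h4, mul_assoc ((2 : ℝ) ^ (2 * alphaTilde m k α - m)) _
    (∏ j, x₀ (Fin.castLE hnm j) ^ (-2 * α j)), ← hprod, betaLimit, powWeight,
    Finset.prod_mul_distrib]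
  field_simp

end Q

end

/-! ### The theorem -/

theorem mainTheorem5 {m n p : ℕ} (hm : 2 ≤ m) (hn : 1 ≤ n) (hnm : n ≤ m) (hp : 1 ≤ p)
    (α : Fin n → ℝ) (hα : ∀ j, 0 < 2 * α j ∧ 2 * α j < 1)
    (lam : Fin p → ℂ) (hlam : ∀ l, (lam l).im = 0 ∨ (lam l).re = 0)
    (x₀ : EuclideanSpace ℝ (Fin m)) (hx₀ : x₀ ∈ posDomain hnm)
    (k : ℕ) (hk : k ≤ n) (hint : ∀ l : ℕ, alphaTilde m k α ≠ l + 1) :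
    -- the continuation that defines `qₖ` exists at every point of the domain other than `x₀`
    (∀ x ∈ posDomain hnm, x ≠ x₀ → ∃ f,
      IsHAContinuation (alphaTilde m k α : ℂ) (bParam k α) (cParam k α)
        (fun j => (xiVar hnm x₀ x j : ℂ)) (etaVar lam x₀ x) f) ∧
    -- where `|ξ₁| + ⋯ + |ξₙ| < 1`, the function is given by the convergent series itself
    (∀ x ∈ posDomain hnm, x ≠ x₀ → ∑ j, |xiVar hnm x₀ x j| < 1 →
      Summable (HATerm (alphaTilde m k α : ℂ) (bParam k α) (cParam k α)
        (fun j => (xiVar hnm x₀ x j : ℂ)) (etaVar lam x₀ x)) ∧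
      qFun hnm k α lam x₀ x = (qFactor hnm k α x₀ x : ℂ) *
        HASeries (alphaTilde m k α : ℂ) (bParam k α) (cParam k α)
          (fun j => (xiVar hnm x₀ x j : ℂ)) (etaVar lam x₀ x)) ∧
    -- `qₖ` is a real-analytic solution of the equation away from `x₀`
    AnalyticOnNhd ℝ (qFun hnm k α lam x₀) (posDomain hnm \ {x₀}) ∧
    (∀ x ∈ posDomain hnm, x ≠ x₀ → helmholtzOp hnm α lam (qFun hnm k α lam x₀) x = 0) ∧
    -- it is a fundamental solution with pole `x₀`
    IsFundamentalSolution hnm α lam x₀ (qFun hnm k α lam x₀) ∧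
    -- its singularity is of the order `r^{2-m}` if `m > 2`, and logarithmic if `m = 2`
    (2 < m → Tendsto (fun x => ((√(rSq x₀ x) ^ (m - 2) : ℝ) : ℂ) * qFun hnm k α lam x₀ x) (𝓝[≠] x₀)
      (𝓝 ((Real.Gamma ((m : ℝ) / 2 - 1) / (4 * Real.pi ^ ((m : ℝ) / 2)) *
        ∏ j, x₀ (Fin.castLE hnm j) ^ (-2 * α j) : ℝ) : ℂ))) ∧
    (m = 2 → Tendsto (fun x => qFun hnm k α lam x₀ x / ((Real.log (1 / √(rSq x₀ x)) : ℝ) : ℂ))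
      (𝓝[≠] x₀)
      (𝓝 ((1 / (2 * Real.pi) * ∏ j, x₀ (Fin.castLE hnm j) ^ (-2 * α j) : ℝ) : ℂ))) := by
  have hm' : (2 : ℝ) ≤ m := by exact_mod_cast hm
  have hU := isOpen_posDomain hnm
  have : NeZero m := ⟨by omega⟩
  have : NeZero n := ⟨by omega⟩
  have hb : ∀ j, 0 < betaParam k α j := fun j => (betaParam_mem_Ioo hα k j).1
  have hb1 : ∀ j, betaParam k α j ≤ 1 := fun j => (betaParam_mem_Ioo hα k j).2.le
  have hB : 0 < ∑ j, betaParam k α j :=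
    Finset.sum_pos (fun j _ => hb j) Finset.univ_nonempty
  have ha := alphaTilde_eq m hk α
  have ha0 : 0 < alphaTilde m k α := by linarith
  -- As α̃ₖ is positive, excluding the positive integers excludes all integers; this is what gives
  -- meaning to every Γ(α̃ₖ - N).
  have hac : (alphaTilde m k α : ℂ) ∈ Complex.integerComplement := by
    rintro ⟨z, hz⟩
    have hz' : (z : ℝ) = alphaTilde m k α := by exact_mod_cast hz
    have hz0 : 0 < z := by
      rw [← hz'] at ha0
      exact_mod_cast ha0
    -- The excluded values are written l + 1, so the integer z ≥ 1 corresponds to l = z - 1.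
    refine hint (z - 1).toNat ?_
    rw [← hz']
    have h : (((z - 1).toNat : ℤ) : ℝ) = ((z - 1 : ℤ) : ℝ) := by
      rw [Int.toNat_of_nonneg (by omega)]
    push_cast at h
    linarith
  set κ : ℂ := -(1 / 4) * ∑ l, lam l ^ 2 with hκdef
  have hκ : ∑ l, lam l ^ 2 = -4 * κ := by
    rw [hκdef]
    ring
  have hq : ∀ x ∈ posDomain hnm, x ≠ x₀ → qFun hnm k α lam x₀ x = (qConst hnm k α x₀ : ℂ) *
      ((powWeight hnm (weightExponent k α) x : ℂ) *
        rhoIntegral hnm x₀ 0 κ (alphaTilde m k α) (betaParam k α) x) := fun x hx hne =>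
    qFun_eq hnm hx₀ hα hac lam hx hne
  have hopen : IsOpen (posDomain hnm \ {x₀}) := hU.sdiff isClosed_singleton
  have hrho : AnalyticOnNhd ℝ (rhoIntegral hnm x₀ 0 κ (alphaTilde m k α) (betaParam k α))
      (posDomain hnm \ {x₀}) := by
    rw [← regDomain_zero]
    exact analyticOnNhd_rhoIntegral hnm hx₀ hb 0 κ hac
  have hW := analyticOnNhd_powWeight hnm (weightExponent k α)
  have hev : ∀ x ∈ posDomain hnm \ {x₀}, qFun hnm k α lam x₀ =ᶠ[𝓝 x]
      fun x => (qConst hnm k α x₀ : ℂ) * ((powWeight hnm (weightExponent k α) x : ℂ) *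
        rhoIntegral hnm x₀ 0 κ (alphaTilde m k α) (betaParam k α) x) := fun x hx => by
    filter_upwards [hopen.mem_nhds hx] with y hy using hq y hy.1 hy.2
  have hconst := qConst_mul_eq hnm hx₀ hα hk ha0
  have hWlim : Tendsto (fun x => (powWeight hnm (weightExponent k α) x : ℂ)) (𝓝[≠] x₀)
      (𝓝 (powWeight hnm (weightExponent k α) x₀ : ℂ)) :=
    (hW x₀ hx₀).continuousAt.tendsto.mono_left nhdsWithin_le_nhds
  have hqnear : ∀ᶠ x in 𝓝[≠] x₀, qFun hnm k α lam x₀ x = (qConst hnm k α x₀ : ℂ) *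
      ((powWeight hnm (weightExponent k α) x : ℂ) *
        rhoIntegral hnm x₀ 0 κ (alphaTilde m k α) (betaParam k α) x) := by
    filter_upwards [self_mem_nhdsWithin, mem_nhdsWithin_of_mem_nhds (hU.mem_nhds hx₀)] with x h1 h2
    exact hq x h2 h1
  refine ⟨fun x hx _ => ⟨_, isHAContinuation_qFun hnm hx₀ hα hac lam hx⟩, ?_, ?_, ?_, ⟨?_, ?_⟩,
    ?_, ?_⟩
  · intro x hx hne hξ
    have h := hasSum_HATerm hac hb (ξ := fun j => (xiVar hnm x₀ x j : ℂ))
      (by simpa using hξ) (etaVar lam x₀ x)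
    rw [← cParam_eq, ← bParam_eq] at h
    refine ⟨h.summable, ?_⟩
    rw [qFun, HA_eq_eulerIntegral hnm hx₀ hα hac lam hx, HASeries, h.tsum_eq]
  · intro x hx
    exact (analyticAt_const.mul ((hW x hx.1).mul (hrho x hx))).congr (hev x hx).symm
  · intro x hx hne
    rw [helmholtzOp_congr hnm α lam (hev x ⟨hx, hne⟩), helmholtzOp_const_mul,
      helmholtzOp_powWeight_mul hnm (weightExponent_mul k α) lam hopen sdiff_subset hrho ⟨hx, hne⟩]
    -- Off the pole ε = 0 is allowed, and the defect -4ε F_{a+2} disappears.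
    have h := helmholtzOp_rhoIntegral hnm hx₀ hac hb (by rw [ha]) hκ (x := x) (ε := 0)
      (by rw [regDomain_zero]; exact ⟨hx, hne⟩)
    have hbe : (fun j => α j + weightExponent k α j) = betaParam k α := rfl
    rw [hbe, h]
    simp
  · refine (locallyIntegrableOn_iff hU.isLocallyClosed).2 fun K hKp hK => ?_
    have hI := integrableOn_rhoIntegral hnm hm hx₀ hb hb1 hB κ ha hac hK hKp
    have hI2 : IntegrableOn (fun x => (qConst hnm k α x₀ : ℂ) *
        ((powWeight hnm (weightExponent k α) x : ℂ) *
        rhoIntegral hnm x₀ 0 κ (alphaTilde m k α) (betaParam k α) x)) K :=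
      (hI.continuousOn_mul (hW.continuousOn.mono hKp) hK).const_mul _
    refine hI2.congr ?_
    have hne : ∀ᵐ x : EuclideanSpace ℝ (Fin m), x ≠ x₀ := by
      rw [ae_iff]
      simp
    filter_upwards [ae_restrict_mem hK.isClosed.measurableSet, ae_restrict_of_ae hne] with x h1 h2
    exact (hq x (hKp h1) h2).symm
  · intro φ h1 h2 h3
    have hφ : IsTestFunction (posDomain hnm) φ := ⟨h1, h2, h3⟩
    have hL := hφ.helmholtzAdjoint hnm hU subset_rfl α lam
    have h := integral_rhoIntegral_mul_helmholtzAdjoint hnm (b := betaParam k α) hm hx₀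
      (weightExponent_mul k α)
      (fun j => rfl) hb hb1 hB ha hac hκ hφ
    have hne : ∀ᵐ x : EuclideanSpace ℝ (Fin m), x ≠ x₀ := by
      rw [ae_iff]
      simp
    have h4 : ∫ x, qFun hnm k α lam x₀ x * helmholtzAdjoint hnm α lam φ x =
        ∫ x, (qConst hnm k α x₀ : ℂ) * (((powWeight hnm (weightExponent k α) x : ℂ) *
          rhoIntegral hnm x₀ 0 κ (alphaTilde m k α) (betaParam k α) x) *
            helmholtzAdjoint hnm α lam φ x) := by
      refine integral_congr_ae ?_
      filter_upwards [hne] with x hx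
      -- The representation of qₖ is available on the domain only; elsewhere the adjoint of φ
      -- vanishes.
      by_cases hxs : x ∈ tsupport (helmholtzAdjoint hnm α lam φ)
      · rw [hq x (hL.tsupport_subset hxs) hx, mul_assoc]
      · simp [image_eq_zero_of_notMem_tsupport hxs]
    rw [h4, integral_const_mul, h]
    have hc := congrArg (fun r : ℝ => (r : ℂ)) hconst
    push_cast at hc ⊢
    -- The factor -4 of the regularisation defect meets the 1/4 of the constant, which leaves
    -- exactly -1.
    linear_combination (-4 * φ x₀) * hc
  · intro hm2
    have h := tendsto_rSq_rpow_mul_rhoIntegral hnm hm2 hx₀ hb hb1 κ ha hac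
    have h5 := (tendsto_const_nhds (x := (qConst hnm k α x₀ : ℂ))).mul (hWlim.mul h)
    refine (h5.congr' ?_).trans_eq ?_
    · filter_upwards [hqnear] with x hx
      rw [hx]
      have e : √(rSq x₀ x) ^ (m - 2) = rSq x₀ x ^ ((m : ℝ) / 2 - 1) := by
        rw [Real.sqrt_eq_rpow, ← Real.rpow_natCast, ← Real.rpow_mul (rSq_nonneg x₀ x),
          Nat.cast_sub hm]
        congr 1
        push_cast
        ring
      rw [e]
      ring
    · congr 1
      have hπ : Real.pi ^ ((m : ℝ) / 2) ≠ 0 := (Real.rpow_pos_of_pos Real.pi_pos _).ne'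
      rw [← Complex.ofReal_mul, ← Complex.ofReal_mul]
      congr 1
      generalize ∏ j, x₀ (Fin.castLE hnm j) ^ (-2 * α j) = P at hconst ⊢
      generalize Real.Gamma ((m : ℝ) / 2 - 1) = G
      field_simp
      linear_combination (4 * G) * hconst
  · intro hm2
    have hae : alphaTilde m k α = ∑ j, betaParam k α j := by
      rw [ha, hm2]
      norm_num
    have h := tendsto_rhoIntegral_div_log hnm hx₀ hb hb1 hB κ (by rw [← hae]; exact hac)
    rw [← hae] at h
    -- The factor 2 accounts for log(1/r²) = 2 log(1/r).
    have h5 := (tendsto_const_nhds (x := 2 * (qConst hnm k α x₀ : ℂ))).mul (hWlim.mul h)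
    refine (h5.congr' ?_).trans_eq ?_
    · filter_upwards [hqnear, self_mem_nhdsWithin] with x hx hne
      rw [hx]
      have e : Real.log (1 / √(rSq x₀ x)) = Real.log (1 / rSq x₀ x) / 2 := by
        rw [one_div, one_div, Real.log_inv, Real.log_inv, Real.log_sqrt (rSq_nonneg x₀ x)]
        ring
      rw [e]
      push_cast
      rw [div_div_eq_mul_div, div_eq_mul_inv]
      ring
    · congr 1
      have hπ : Real.pi ^ ((m : ℝ) / 2) = Real.pi := by
        rw [hm2]
        norm_num
      rw [hπ] at hconst
      have e2 : (2 * (qConst hnm k α x₀ : ℂ)) * ((powWeight hnm (weightExponent k α) x₀ : ℂ) *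
          (betaLimit (betaParam k α) (poleWeight hnm x₀ x₀) : ℂ)) =
          ((2 * qConst hnm k α x₀ * (powWeight hnm (weightExponent k α) x₀ *
            betaLimit (betaParam k α) (poleWeight hnm x₀ x₀)) : ℝ) : ℂ) := by
        push_cast
        ring
      rw [e2]
      congr 1
      have hπ0 := Real.pi_ne_zero
      generalize ∏ j, x₀ (Fin.castLE hnm j) ^ (-2 * α j) = P at hconst ⊢
      field_simp
      linear_combination 4 * hconst
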